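/- Let $f:\mathbb R\to[0,\infty)$ be a uniformly continuous probability density with finite second moment, $\int x^2 f(x)\,dx<\infty$, and with $f(x)=O(|x|^{-r})$ as $|x|\to\infty$ for some $r>1$. Let $X_1,\dots,X_{2n}$ be i.i.d. with density $f$ (one covariate, $2n$ subjects). An allocation splits the $2n$ subjects into a treatment group $T$ and a control group $C$ of $n$ subjects each; its balance is $$B=\left|\frac{\overline X_T-\overline X_C}{s}\right|,$$ where $\overline X_T,\overline X_C$ are the two group means and $s$ is the sample standard deviation of all $2n$ values. Write $D=\sum_{i\in T}X_i-\sum_{i\in C}X_i$. A switch exchanges one treated subject with one control subject. Modified greedy heuristic with parameters $b,c>0$: start with an allocation drawn uniformly from the $\binom{2n}{n}$ possible ones, independently of the $X_i$. Let $E$ consist of the $\lfloor b\sqrt n\rfloor$ subjects with the largest and the $\lfloor b\sqrt n\rfloor$ subjects with the smallest values. As long as $|D|\ge c$ and some switch of two subjects in $E$ strictly reduces $|D|$, carry out a switch of two subjects in $E$ that makes $|D|$ (equivalently $B$) as small as possible. When this stops (because $|D|<c$, or because no switch within $E$ reduces $|D|$), make one additional switch, chosen among all $n^2$ treatment-control pairs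 so that the resulting $|D|$ is as small as possible. Ties may be broken in any way. Let $c>0$ be such that $P(t)=\int_{\mathbb R} f(x+t)f(x)\,dx>0$ for all $0\le t\le c/2$ (this holds for all sufficiently small $c>0$). Then for every $\gamma<1$ there are a (suitably chosen) $b>0$, a constant $K>0$ and an $N$ such that for all $n>N$, the allocation produced by the modified greedy heuristic satisfies $$\mathbb P\left(B\le K n^{-3}\right)>\gamma .$$ -/

import Mathlib

open MeasureTheory Set Filter Asymptotics

namespace GreedySwitch

/-- An allocation vector for `2n` subjects: `true` means treatment, `false` means control. -/
abbrev Allocation (n : ℕ) : Type := Fin (2 * n) → Bool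

/-- The allocation puts exactly `n` of the `2n` subjects into the treatment group. -/
def IsBalanced {n : ℕ} (w : Allocation n) : Prop :=
  (Finset.univ.filter fun i => w i = true).card = n

/-- Sum of the covariate over the treatment group. -/
def treatSum {n : ℕ} (x : Fin (2 * n) → ℝ) (w : Allocation n) : ℝ :=
  ∑ i, if w i = true then x i else 0

/-- Sum of the covariate over the control group. -/
def controlSum {n : ℕ} (x : Fin (2 * n) → ℝ) (w : Allocation n) : ℝ :=
  ∑ i, if w i = false then x i else 0

/-- Difference of the treatment sum and the control sum. -/
def diffSum {n : ℕ} (x : Fin (2 * n) → ℝ) (w : Allocation n) : ℝ :=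
  treatSum x w - controlSum x w

/-- Mean of the covariate over all `2n` subjects. -/
noncomputable def overallMean {n : ℕ} (x : Fin (2 * n) → ℝ) : ℝ :=
  (∑ i, x i) / (2 * n)

/-- Sample standard deviation of the covariate over all `2n` subjects. -/
noncomputable def sampleSD {n : ℕ} (x : Fin (2 * n) → ℝ) : ℝ :=
  Real.sqrt ((∑ i, (x i - overallMean x) ^ 2) / (2 * n - 1))

/-- The covariate balance: the absolute standardized difference in means. -/
noncomputable def balance {n : ℕ} (x : Fin (2 * n) → ℝ) (w : Allocation n) : ℝ :=
  |(treatSum x w / n - controlSum x w / n) / sampleSD x|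

/-- The subjects whose covariate is among the `m` smallest or the `m` largest observations
(for pairwise distinct observations these are exactly `m` smallest and `m` largest ones). -/
def extremes {n : ℕ} (x : Fin (2 * n) → ℝ) (m : ℕ) : Set (Fin (2 * n)) :=
  {i | (Finset.univ.filter fun j => x j < x i).card < m ∨
       (Finset.univ.filter fun j => x i < x j).card < m}

/-- `w'` arises from `w` by switching a treated subject of `S` with a control subject of `S`. -/
def IsSwitch {n : ℕ} (S : Set (Fin (2 * n))) (w w' : Allocation n) : Prop :=
  ∃ i ∈ S, ∃ j ∈ S, w i = true ∧ w j = false ∧ w' = w ∘ Equiv.swap i j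

/-- `w'` is a best switch of `w` within `S`. Minimizing `|diffSum|` is minimizing `balance`, since
both group sizes and the standard deviation are unaffected by a switch. -/
def IsBestSwitch {n : ℕ} (x : Fin (2 * n) → ℝ) (S : Set (Fin (2 * n)))
    (w w' : Allocation n) : Prop :=
  IsSwitch S w w' ∧ ∀ v, IsSwitch S w v → |diffSum x w'| ≤ |diffSum x v|

/-- One step of greedy pair-switching within `S`, performed only while the sums of the two groups
differ by at least `c`, and only if it strictly reduces the imbalance. -/
def GreedyStep {n : ℕ} (x : Fin (2 * n) → ℝ) (S : Set (Fin (2 * n))) (c : ℝ)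
    (w w' : Allocation n) : Prop :=
  c ≤ |diffSum x w| ∧ IsBestSwitch x S w w' ∧ |diffSum x w'| < |diffSum x w|

/-- `w` is a possible result of the modified greedy heuristic started at `w₀`: greedy steps among
the `⌊b √n⌋` largest and `⌊b √n⌋` smallest observations are made until none is possible (either
the sums differ by less than `c`, or no such switch reduces the imbalance); then one additional,
best possible, switch is made among all subjects. The result is unique up to the way in which ties
between equally good switches are broken. -/
def IsModifiedGreedyOutput {n : ℕ} (x : Fin (2 * n) → ℝ) (b c : ℝ) (w₀ w : Allocation n) : Prop :=
  ∃ v, Relation.ReflTransGen (GreedyStep x (extremes x ⌊b * Real.sqrt n⌋₊) c) w₀ v ∧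
    (∀ v', ¬ GreedyStep x (extremes x ⌊b * Real.sqrt n⌋₊) c v v') ∧
    IsBestSwitch x Set.univ v w

/-- The law on `ℝ` with density `f`. -/
noncomputable def covariateLaw (f : ℝ → ℝ) : Measure ℝ :=
  volume.withDensity fun t => ENNReal.ofReal (f t)

/-- The joint law of the `2n` i.i.d. covariates with density `f` and of the initial allocation,
which is independent of them and uniform over the balanced allocations. -/
noncomputable def experimentLaw (f : ℝ → ℝ) (n : ℕ) :
    Measure ((Fin (2 * n) → ℝ) × Allocation n) :=
  (Measure.pi fun _ => covariateLaw f).prod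
    (ProbabilityTheory.uniformOn {w : Allocation n | IsBalanced w})

/-- The density at `t` of the difference of two independent variables with density `f`. -/
noncomputable def pairDensity (f : ℝ → ℝ) (t : ℝ) : ℝ :=
  ∫ x, f (x + t) * f x

theorem IsSwitch.isBalanced {n : ℕ} {S : Set (Fin (2 * n))} {w w' : Allocation n}
    (h : IsSwitch S w w') (hw : IsBalanced w) : IsBalanced w' := by
  obtain ⟨i, -, j, -, -, -, rfl⟩ := h
  unfold IsBalanced at hw ⊢
  exact (Finset.card_equiv (Equiv.swap i j) (by simp)).trans hw

/-- The heuristic never gets lost: it has a result from every balanced initial allocation. -/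
theorem exists_output {n : ℕ} (hn : 0 < n) (x : Fin (2 * n) → ℝ) (b c : ℝ) (w₀ : Allocation n)
    (hw₀ : IsBalanced w₀) : ∃ w, IsModifiedGreedyOutput x b c w₀ w := by
  classical
  set S := extremes x ⌊b * Real.sqrt n⌋₊ with hS
  obtain ⟨v, hv, hmin⟩ := Finset.exists_min_image
    (Finset.univ.filter fun v => Relation.ReflTransGen (GreedyStep x S c) w₀ v)
    (fun v => |diffSum x v|) ⟨w₀, by simp [Relation.ReflTransGen.refl]⟩
  simp only [Finset.mem_filter, Finset.mem_univ, true_and] at hv hmin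
  have hvb : IsBalanced v := by
    clear hmin
    induction hv with
    | refl => exact hw₀
    | tail _ h ih => exact h.2.1.1.isBalanced ih
  have ht : ∃ i, v i = true := by
    by_contra! h
    simp only [ne_eq, Bool.not_eq_true] at h
    simp [IsBalanced, h] at hvb
    omega
  have hf : ∃ j, v j = false := by
    by_contra! h
    simp only [ne_eq, Bool.not_eq_false] at h
    simp [IsBalanced, h] at hvb
    omega
  obtain ⟨i, hi⟩ := ht
  obtain ⟨j, hj⟩ := hf
  obtain ⟨w, hw, hwmin⟩ := Finset.exists_min_image
    (Finset.univ.filter fun w => IsSwitch Set.univ v w) (fun w => |diffSum x w|)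
    ⟨v ∘ Equiv.swap i j, by
      simp only [Finset.mem_filter, Finset.mem_univ, true_and]
      exact ⟨i, trivial, j, trivial, hi, hj, rfl⟩⟩
  simp only [Finset.mem_filter, Finset.mem_univ, true_and] at hw hwmin
  exact ⟨w, v, hv, fun v' h => (hmin v' (hv.tail h)).not_gt h.2.2, hw, hwmin⟩

end GreedySwitch

/-! The exponent comes from counting pairs. Switching `i` and `j` changes `D = diffSum` by `2 * (x i
- x j)`, so the last switch needs a treatment-control pair whose difference is within `O(n⁻²)` of `D
/ 2`. There are `n²` pairs, and when `|D| < c` the density of a difference near `D / 2` is bounded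
below, so with high probability some pair qualifies. Then `|D| = O(n⁻²)`, and dividing by `n` times
the sample standard deviation, which is bounded below because both tails hold a positive share of
the sample, gives `O(n⁻³)`. Two facts remain: the greedy phase ends with `|D| < c`, and the target
`D / 2`, which depends on the sample, does not spoil the count.

Greedy phase (`exists_greedyPhase`). At the start `|D| = O(√n)` with high probability. Each tail is
cut into `4 u` bins of mass `lam / n`, with `u` about `a √n`; for large `lam` most bins contain
subjects of both groups, and this persists because the steps needed relabel at most `u / 10`
subjects. While `|D|` is larger than twice the distance of the two inner quantiles, a switch across
the tails lowers it by at least a constant. Afterwards one works in the tail with the larger inner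
quantile `q`. There the density is at most `B (1 + ζ) ^ (-r)`, so not too many bins fit into short
intervals; since both labels occur in most bins, some pair has a difference between `ρ |D| / 2` and
`|D| / 2`, where `ρ = ρ₁ (1 + q) ^ (r - 1)` (`card_le_of_no_moderate_gap`, `exists_outer`). Each
step thus multiplies `|D|` by at most `1 - ρ`, and the growth of `ρ` in `q` outweighs the initial
size of order `q`, so `O(√n)` steps suffice whatever `q` is (`TailControl.abs_diffSum_lt`).

Decoupling (`exists_lastSwitch`). Subjects in a central interval are never extreme, hence never
switched in the greedy phase; with all other values fixed, the run depends on them only through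
their signed sum. So the target is a function of that sum, well defined because almost surely there
are no ties. The law is written as a mixture of a rest, a small share `θ` of pair subjects and a
fixed share `κ` of reservoir subjects with density `φ ^ 2` (`exists_mixture`). A fluctuation of the
pair sum is absorbed by translating every reservoir coordinate slightly; by a Hellinger estimate
this is cheap when the pairs are few compared with the reservoir (`measureReal_pi_translate_le`,
`measure_prod_no_hit_le`). After that the target is independent of the pair subjects, and a second
moment bound provides a hit (`measureReal_no_pair_le`). -/

namespace GreedySwitch

/-! ### Signed sums, switches and greedy runs -/

/-- The sign attached to a group label: `1` for treatment, `-1` for control. -/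
def labelSign (b : Bool) : ℝ := if b = true then 1 else -1

@[simp] theorem labelSign_true : labelSign true = 1 := rfl
@[simp] theorem labelSign_false : labelSign false = -1 := rfl

theorem labelSign_sq (b : Bool) : labelSign b ^ 2 = 1 := by cases b <;> norm_num

theorem labelSign_not (b : Bool) : labelSign (!b) = -labelSign b := by cases b <;> norm_num

theorem labelSign_injective : Function.Injective labelSign := by
  intro a b h
  cases a <;> cases b <;> first | rfl | (norm_num at h)

theorem diffSum_eq_sum {n : ℕ} (x : Fin (2 * n) → ℝ) (w : Allocation n) :
    diffSum x w = ∑ i, labelSign (w i) * x i := by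
  unfold diffSum treatSum controlSum
  rw [← Finset.sum_sub_distrib]
  refine Finset.sum_congr rfl fun i _ => ?_
  cases w i <;> simp

theorem sum_labelSign_of_isBalanced {n : ℕ} {w : Allocation n} (hw : IsBalanced w) :
    ∑ i, labelSign (w i) = 0 := by
  have h1 : ∀ i, labelSign (w i) = 2 * (if w i = true then 1 else 0) - 1 := by
    intro i
    cases w i <;> norm_num
  simp_rw [h1]
  rw [Finset.sum_sub_distrib, ← Finset.mul_sum, Finset.sum_boole]
  unfold IsBalanced at hw
  rw [hw]
  simp

theorem IsBalanced.card_false {n : ℕ} {w : Allocation n} (hw : IsBalanced w) :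
    (Finset.univ.filter fun i => w i = false).card = n := by
  have h := Finset.card_filter_add_card_filter_not (s := (Finset.univ : Finset (Fin (2 * n))))
    (fun i => w i = true)
  unfold IsBalanced at hw
  simp only [Bool.not_eq_true, Finset.card_univ, Fintype.card_fin] at h
  omega

theorem diffSum_swap {n : ℕ} (x : Fin (2 * n) → ℝ) (w : Allocation n) {i j : Fin (2 * n)}
    (hi : w i = true) (hj : w j = false) :
    diffSum x (w ∘ Equiv.swap i j) = diffSum x w - 2 * (x i - x j) := by
  have hij : i ≠ j := by
    rintro rfl
    simp [hi] at hj
  rw [diffSum_eq_sum, diffSum_eq_sum, sub_eq_add_neg, ← sub_eq_iff_eq_add',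
    ← Finset.sum_sub_distrib]
  have hz : ∀ k, k ≠ i ∧ k ≠ j →
      labelSign ((w ∘ Equiv.swap i j) k) * x k - labelSign (w k) * x k = 0 := by
    rintro k ⟨h1, h2⟩
    simp [Equiv.swap_apply_of_ne_of_ne h1 h2]
  rw [Fintype.sum_eq_add i j hij hz]
  simp [hi, hj]
  ring

/-- A greedy step for an arbitrary imbalance functional `Φ` of the allocation. -/
def FunctionalStep {n : ℕ} (Φ : Allocation n → ℝ) (S : Set (Fin (2 * n))) (c : ℝ)
    (w w' : Allocation n) : Prop :=
  c ≤ |Φ w| ∧ (IsSwitch S w w' ∧ ∀ v, IsSwitch S w v → |Φ w'| ≤ |Φ v|) ∧ |Φ w'| < |Φ w|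

/-- `v` is reached from `w₀` by greedy steps for `Φ`, and no further step is possible. -/
def IsStop {n : ℕ} (Φ : Allocation n → ℝ) (S : Set (Fin (2 * n))) (c : ℝ)
    (w₀ v : Allocation n) : Prop :=
  Relation.ReflTransGen (FunctionalStep Φ S c) w₀ v ∧ ∀ v', ¬ FunctionalStep Φ S c v v'

theorem isModifiedGreedyOutput_iff {n : ℕ} {x : Fin (2 * n) → ℝ} {b c : ℝ}
    {w₀ w : Allocation n} :
    IsModifiedGreedyOutput x b c w₀ w ↔
      ∃ v, IsStop (diffSum x) (extremes x ⌊b * Real.sqrt n⌋₊) c w₀ v ∧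
        IsBestSwitch x Set.univ v w := by
  simp only [IsStop, and_assoc]
  rfl

theorem IsSwitch.eq_of_notMem {n : ℕ} {S : Set (Fin (2 * n))} {w w' : Allocation n}
    (h : IsSwitch S w w') {i : Fin (2 * n)} (hi : i ∉ S) : w' i = w i := by
  obtain ⟨k, hk, l, hl, -, -, rfl⟩ := h
  have h1 : i ≠ k := fun e => hi (e ▸ hk)
  have h2 : i ≠ l := fun e => hi (e ▸ hl)
  simp [Equiv.swap_apply_of_ne_of_ne h1 h2]

theorem reflTransGen_eq_of_notMem {n : ℕ} {Φ : Allocation n → ℝ} {S : Set (Fin (2 * n))} {c : ℝ}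
    {w v : Allocation n} (h : Relation.ReflTransGen (FunctionalStep Φ S c) w v)
    {i : Fin (2 * n)} (hi : i ∉ S) : v i = w i := by
  induction h with
  | refl => rfl
  | tail _ h ih => exact (h.2.1.1.eq_of_notMem hi).trans ih

theorem functionalStep_congr {n : ℕ} {Φ Ψ : Allocation n → ℝ} {S : Set (Fin (2 * n))} {c : ℝ}
    {w₀ w w' : Allocation n} (hΦ : ∀ w, (∀ i ∉ S, w i = w₀ i) → Φ w = Ψ w)
    (hw : ∀ i ∉ S, w i = w₀ i) : FunctionalStep Φ S c w w' ↔ FunctionalStep Ψ S c w w' := by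
  have hs : ∀ v, IsSwitch S w v → Φ v = Ψ v := fun v hv =>
    hΦ v fun i hi => (hv.eq_of_notMem hi).trans (hw i hi)
  unfold FunctionalStep
  rw [hΦ w hw]
  constructor
  · rintro ⟨h1, ⟨h2, h3⟩, h4⟩
    refine ⟨h1, ⟨h2, fun v hv => ?_⟩, ?_⟩
    · rw [← hs v hv, ← hs w' h2]; exact h3 v hv
    · rw [← hs w' h2]; exact h4
  · rintro ⟨h1, ⟨h2, h3⟩, h4⟩
    refine ⟨h1, ⟨h2, fun v hv => ?_⟩, ?_⟩
    · rw [hs v hv, hs w' h2]; exact h3 v hv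
    · rw [hs w' h2]; exact h4

/-- A run within `S` only visits allocations that agree with `w₀` off `S`, so only the values of the
functional on these matter. This is what lets the signed sum of the central subjects replace their
individual values. -/
theorem isStop_of_congr {n : ℕ} {Φ Ψ : Allocation n → ℝ} {S : Set (Fin (2 * n))} {c : ℝ}
    {w₀ v : Allocation n} (hΦ : ∀ w, (∀ i ∉ S, w i = w₀ i) → Φ w = Ψ w)
    (h : IsStop Φ S c w₀ v) : IsStop Ψ S c w₀ v := by
  obtain ⟨h1, h2⟩ := h
  refine ⟨?_, fun v' hv' => h2 v' ((functionalStep_congr hΦ fun i hi =>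
    reflTransGen_eq_of_notMem h1 hi).2 hv')⟩
  clear h2
  induction h1 with
  | refl => exact .refl
  | tail h h' ih =>
    exact ih.tail ((functionalStep_congr hΦ fun i hi => reflTransGen_eq_of_notMem h hi).1 h')

/-- No two essentially different allocations are equally imbalanced. -/
def NoTies {n : ℕ} (Φ : Allocation n → ℝ) : Prop :=
  ∀ w w', |Φ w| = |Φ w'| → w = w' ∨ ∀ i, w i = !(w' i)

/-- Two switches of one allocation touch at most four subjects, fewer than the `2 n ≥ 6` available.
Hence their results are not complementary, and complementary allocations are the only ties that
`NoTies` permits. -/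
theorem IsSwitch.exists_eq {n : ℕ} (hn : 3 ≤ n) {S : Set (Fin (2 * n))} {w w' w'' : Allocation n}
    (h' : IsSwitch S w w') (h'' : IsSwitch S w w'') : ∃ u, w' u = w'' u := by
  obtain ⟨i, -, j, -, -, -, rfl⟩ := h'
  obtain ⟨k, -, l, -, -, -, rfl⟩ := h''
  obtain ⟨u, hu⟩ : ∃ u, u ∉ ({i, j, k, l} : Finset (Fin (2 * n))) := by
    by_contra! h
    have h1 : (Finset.univ : Finset (Fin (2 * n))) ⊆ {i, j, k, l} := fun u _ => h u
    have h2 := (Finset.card_le_card h1).trans Finset.card_le_four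
    simp at h2
    omega
  simp only [Finset.mem_insert, Finset.mem_singleton, not_or] at hu
  refine ⟨u, ?_⟩
  simp [Equiv.swap_apply_of_ne_of_ne hu.1 hu.2.1, Equiv.swap_apply_of_ne_of_ne hu.2.2.1 hu.2.2.2]

/-- Without ties the best switch is unique, so the greedy step is a partial function and its maximal
chains share their endpoint. -/
theorem IsStop.unique {n : ℕ} (hn : 3 ≤ n) {Φ : Allocation n → ℝ} (hΦ : NoTies Φ)
    {S : Set (Fin (2 * n))} {c : ℝ} {w₀ v v' : Allocation n}
    (h : IsStop Φ S c w₀ v) (h' : IsStop Φ S c w₀ v') : v = v' := by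
  have hu : Relator.RightUnique (FunctionalStep Φ S c) := by
    intro w w1 w2 h1 h2
    have he : |Φ w1| = |Φ w2| := le_antisymm (h1.2.1.2 _ h2.2.1.1) (h2.2.1.2 _ h1.2.1.1)
    rcases hΦ _ _ he with h | h
    · exact h
    · obtain ⟨u, hu⟩ := h1.2.1.1.exists_eq hn h2.2.1.1
      have := h u
      rw [hu] at this
      simp at this
  rcases Relation.ReflTransGen.total_of_right_unique hu h.1 h'.1 with h1 | h1
  · rcases h1.cases_head with h2 | ⟨u, h2, -⟩
    · exact h2
    · exact absurd h2 (h.2 u)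
  · rcases h1.cases_head with h2 | ⟨u, h2, -⟩
    · exact h2.symm
    · exact absurd h2 (h'.2 u)

/-! ### Extremes and a central interval -/

/-- Extreme observations do not depend on the values of observations lying in a central interval,
and no such observation is extreme. -/
theorem extremes_central {n m : ℕ} {x : Fin (2 * n) → ℝ} {a₁ a₂ : ℝ}
    (hlow : m ≤ (Finset.univ.filter fun j => x j < a₁).card)
    (hhigh : m ≤ (Finset.univ.filter fun j => a₂ < x j).card) {i : Fin (2 * n)}
    (hi : x i ∈ Set.Icc a₁ a₂) : i ∉ extremes x m := by
  rintro (h | h)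
  · refine absurd h (not_lt.2 (hlow.trans (Finset.card_le_card fun j => ?_)))
    simp only [Finset.mem_filter, Finset.mem_univ, true_and]
    exact fun hj => hj.trans_le hi.1
  · refine absurd h (not_lt.2 (hhigh.trans (Finset.card_le_card fun j => ?_)))
    simp only [Finset.mem_filter, Finset.mem_univ, true_and]
    exact fun hj => hi.2.trans_lt hj

theorem extremes_subset_of_central {n m : ℕ} {x y : Fin (2 * n) → ℝ} {a₁ a₂ : ℝ} (ha : a₁ ≤ a₂)
    (hxy : ∀ i, x i = y i ∨ (x i ∈ Set.Icc a₁ a₂ ∧ y i ∈ Set.Icc a₁ a₂))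
    (hlow : m ≤ (Finset.univ.filter fun j => x j < a₁).card)
    (hhigh : m ≤ (Finset.univ.filter fun j => a₂ < x j).card) :
    extremes x m ⊆ extremes y m := by
  intro i hi
  have hio : x i ∉ Set.Icc a₁ a₂ := fun h => extremes_central hlow hhigh h hi
  have hiy : x i = y i := (hxy i).resolve_right fun h => hio h.1
  have hcase : x i < a₁ ∨ a₂ < x i := by
    by_contra! h
    exact hio h
  rcases hcase with h | h
  · rcases hi with hi | hi
    · refine Or.inl (lt_of_le_of_lt (Finset.card_le_card fun j => ?_) hi)
      simp only [Finset.mem_filter, Finset.mem_univ, true_and]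
      intro hj
      rcases hxy j with h1 | ⟨-, h1⟩
      · rw [h1, hiy]; exact hj
      · exact absurd (hj.trans (hiy ▸ h)) (not_lt.2 h1.1)
    · refine absurd hi (not_lt.2 (hhigh.trans (Finset.card_le_card fun j => ?_)))
      simp only [Finset.mem_filter, Finset.mem_univ, true_and]
      exact fun hj => (h.trans_le ha).trans hj
  · rcases hi with hi | hi
    · refine absurd hi (not_lt.2 (hlow.trans (Finset.card_le_card fun j => ?_)))
      simp only [Finset.mem_filter, Finset.mem_univ, true_and]
      exact fun hj => hj.trans (ha.trans_lt h)
    · refine Or.inr (lt_of_le_of_lt (Finset.card_le_card fun j => ?_) hi)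
      simp only [Finset.mem_filter, Finset.mem_univ, true_and]
      intro hj
      rcases hxy j with h1 | ⟨-, h1⟩
      · rw [h1, hiy]; exact hj
      · exact absurd ((hiy ▸ h).trans hj) (not_lt.2 h1.2)

theorem card_filter_lt_congr {n : ℕ} {x y : Fin (2 * n) → ℝ} {a₁ a₂ : ℝ}
    (hxy : ∀ i, x i = y i ∨ (x i ∈ Set.Icc a₁ a₂ ∧ y i ∈ Set.Icc a₁ a₂)) :
    (Finset.univ.filter fun j => x j < a₁) = (Finset.univ.filter fun j => y j < a₁) ∧
    (Finset.univ.filter fun j => a₂ < x j) = (Finset.univ.filter fun j => a₂ < y j) := by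
  constructor <;>
  · ext j
    simp only [Finset.mem_filter, Finset.mem_univ, true_and]
    rcases hxy j with h | ⟨⟨h1, h2⟩, ⟨h3, h4⟩⟩
    · rw [h]
    · constructor <;> intro h <;> linarith

theorem extremes_eq_of_central {n m : ℕ} {x y : Fin (2 * n) → ℝ} {a₁ a₂ : ℝ} (ha : a₁ ≤ a₂)
    (hxy : ∀ i, x i = y i ∨ (x i ∈ Set.Icc a₁ a₂ ∧ y i ∈ Set.Icc a₁ a₂))
    (hlow : m ≤ (Finset.univ.filter fun j => x j < a₁).card)
    (hhigh : m ≤ (Finset.univ.filter fun j => a₂ < x j).card) :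
    extremes x m = extremes y m := by
  obtain ⟨h1, h2⟩ := card_filter_lt_congr hxy
  refine (extremes_subset_of_central ha hxy hlow hhigh).antisymm
    (extremes_subset_of_central ha (fun i => ?_) (h1 ▸ hlow) (h2 ▸ hhigh))
  rcases hxy i with h | h
  · exact Or.inl h.symm
  · exact Or.inr h.symm

/-! ### Moderate gaps between interlaced points -/

/-- Interlaced points `y k ≤ z k` in consecutive cells of a decreasing sequence `τ`, all `y k` in
one interval of length `h`: if no difference `z k - y l` lies in `[δ, h]`, then all but three of the
cells lie in an interval of length `δ`. -/
theorem card_le_of_no_moderate_gap_local {τ y z : ℕ → ℝ} {N : ℕ} {G : Finset ℕ}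
    {p B r z₀ h δ : ℝ}
    (hτ : ∀ k l, k ≤ l → l ≤ N → τ l ≤ τ k) (hG : ∀ k ∈ G, k + 1 ≤ N)
    (hy : ∀ k ∈ G, τ (k + 1) ≤ y k) (hyz : ∀ k ∈ G, y k ≤ z k) (hz : ∀ k ∈ G, z k ≤ τ k)
    (hp : 0 < p) (hB : 0 ≤ B) (hδ : 0 ≤ δ) (hz₀ : 0 ≤ z₀)
    (hcell : ∀ k ∈ G, z₀ ≤ y k ∧ y k < z₀ + h)
    (hdens : ∀ k l, k ≤ l → l ≤ N → ∀ ζ, 0 ≤ ζ → ζ ≤ τ l →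
      ((l : ℝ) - k) * p ≤ B * (1 + ζ) ^ (-r) * (τ k - τ l))
    (hno : ∀ k ∈ G, ∀ l ∈ G, ¬ (δ ≤ z k - y l ∧ z k - y l ≤ h)) :
    (G.card : ℝ) ≤ 3 + B * (1 + z₀) ^ (-r) * δ / p := by
  have hpos : 0 ≤ B * (1 + z₀) ^ (-r) := mul_nonneg hB (Real.rpow_nonneg (by linarith) _)
  have hnn : 0 ≤ B * (1 + z₀) ^ (-r) * δ / p := div_nonneg (mul_nonneg hpos hδ) hp.le
  rcases le_or_gt G.card 3 with h3 | h3
  · have : (G.card : ℝ) ≤ 3 := by exact_mod_cast h3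
    linarith
  have hne : G.Nonempty := Finset.card_pos.1 (by omega)
  -- The first cell `a` is sacrificed: for the next cell `k` it gives `z k ≤ τ (a + 1) ≤ y a < z₀ +
  -- h`, hence `z k - y l ≤ h`. As moderate gaps are excluded, this difference is below `δ`, and the
  -- cells strictly between `k` and `l` are squeezed into length `δ`.
  set a := G.min' hne with ha
  have haG : a ∈ G := Finset.min'_mem _ _
  have hne' : (G.erase a).Nonempty := by
    rw [← Finset.card_pos, Finset.card_erase_of_mem haG]; omega
  set k := (G.erase a).min' hne' with hk
  have hkG' : k ∈ G.erase a := Finset.min'_mem _ _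
  have hkG : k ∈ G := Finset.mem_of_mem_erase hkG'
  set l := G.max' hne with hl
  have hlG : l ∈ G := Finset.max'_mem _ _
  have hak : a < k := lt_of_le_of_ne (Finset.min'_le _ _ hkG) (Finset.ne_of_mem_erase hkG').symm
  have hsub : G ⊆ {a, k, l} ∪ Finset.Ioo k l := by
    intro i hi
    simp only [Finset.mem_union, Finset.mem_insert, Finset.mem_singleton, Finset.mem_Ioo]
    by_cases h1 : i = a
    · tauto
    have h2 : k ≤ i := Finset.min'_le _ _ (Finset.mem_erase.2 ⟨h1, hi⟩)
    have h3 : i ≤ l := Finset.le_max' _ _ hi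
    rcases h2.eq_or_lt with h4 | h4
    · exact Or.inl (Or.inr (Or.inl h4.symm))
    rcases h3.eq_or_lt with h5 | h5
    · exact Or.inl (Or.inr (Or.inr h5))
    exact Or.inr ⟨h4, h5⟩
  have hcard := (Finset.card_le_card hsub).trans (Finset.card_union_le _ _)
  have h3' : ({a, k, l} : Finset ℕ).card ≤ 3 := Finset.card_le_three
  rw [Nat.card_Ioo] at hcard
  have hkl : k + 1 ≤ l := by omega
  have hzk : z k - y l ≤ h := by
    have h1 : z k ≤ τ k := hz k hkG
    have h2 : τ k ≤ τ (a + 1) := hτ _ _ hak (by have := hG k hkG; omega)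
    have h4 := hy a haG
    have h5 := (hcell a haG).2
    have h6 := (hcell l hlG).1
    linarith
  have hzk' : z k - y l < δ := by
    by_contra! h'
    exact hno k hkG l hlG ⟨h', hzk⟩
  have hd := hdens (k + 1) l hkl (by have := hG l hlG; omega) z₀ hz₀
    ((hcell l hlG).1.trans ((hyz l hlG).trans (hz l hlG)))
  have hw : τ (k + 1) - τ l ≤ δ := by
    have h1 := hy k hkG
    have h2 := hyz k hkG
    have h4 := hyz l hlG
    have h5 := hz l hlG
    linarith
  have h6 : ((l : ℝ) - (k + 1 : ℕ)) ≤ B * (1 + z₀) ^ (-r) * δ / p := by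
    rw [le_div_iff₀ hp]
    exact hd.trans (mul_le_mul_of_nonneg_left hw hpos)
  have h7 : (G.card : ℝ) ≤ 3 + ((l : ℝ) - (k + 1 : ℕ)) := by
    have : G.card + (k + 1) ≤ 3 + l := by omega
    have : ((G.card + (k + 1) : ℕ) : ℝ) ≤ ((3 + l : ℕ) : ℝ) := by exact_mod_cast this
    push_cast at this ⊢
    linarith
  linarith

/-- The range `[q, T]` of the points `y k` is cut into windows of length `h`, and the local bound is
applied in each window with `z₀` its left end, where the density bound over that window is weakest.
-/
theorem card_le_of_no_moderate_gap {τ y z : ℕ → ℝ} {N : ℕ} {G : Finset ℕ}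
    {p B r q h δ T : ℝ}
    (hτ : ∀ k l, k ≤ l → l ≤ N → τ l ≤ τ k) (hG : ∀ k ∈ G, k + 1 ≤ N)
    (hy : ∀ k ∈ G, τ (k + 1) ≤ y k) (hyz : ∀ k ∈ G, y k ≤ z k) (hz : ∀ k ∈ G, z k ≤ τ k)
    (hp : 0 < p) (hB : 0 ≤ B) (hδ : 0 ≤ δ) (hq : 0 ≤ q) (hh : 0 < h)
    (hqy : ∀ k ∈ G, q ≤ y k) (hT : ∀ k ∈ G, y k ≤ T)
    (hdens : ∀ k l, k ≤ l → l ≤ N → ∀ ζ, 0 ≤ ζ → ζ ≤ τ l →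
      ((l : ℝ) - k) * p ≤ B * (1 + ζ) ^ (-r) * (τ k - τ l))
    (hno : ∀ k ∈ G, ∀ l ∈ G, ¬ (δ ≤ z k - y l ∧ z k - y l ≤ h)) :
    (G.card : ℝ) ≤ ∑ j ∈ Finset.range (⌊(T - q) / h⌋₊ + 1),
      (3 + B * (1 + (q + j * h)) ^ (-r) * δ / p) := by
  have hmap : ∀ k ∈ G, ⌊(y k - q) / h⌋₊ ∈ Finset.range (⌊(T - q) / h⌋₊ + 1) := by
    intro k hk
    rw [Finset.mem_range, Nat.lt_succ_iff]
    refine Nat.floor_le_floor ?_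
    have := hT k hk
    gcongr
  rw [Finset.card_eq_sum_card_fiberwise hmap, Nat.cast_sum]
  refine Finset.sum_le_sum fun j _ => ?_
  have hm : ∀ {k}, k ∈ G.filter (fun k => ⌊(y k - q) / h⌋₊ = j) → k ∈ G :=
    fun hk => (Finset.mem_filter.1 hk).1
  refine card_le_of_no_moderate_gap_local (h := h) hτ (fun k hk => hG k (hm hk))
    (fun k hk => hy k (hm hk)) (fun k hk => hyz k (hm hk)) (fun k hk => hz k (hm hk)) hp hB hδ
    (by positivity) (fun k hk => ?_) hdens (fun k hk l hl => hno k (hm hk) l (hm hl))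
  have h1 := (Finset.mem_filter.1 hk).2
  have h0 : 0 ≤ (y k - q) / h := div_nonneg (sub_nonneg.2 (hqy k (hm hk))) hh.le
  have h2 := Nat.floor_le h0
  have h3 := Nat.lt_floor_add_one ((y k - q) / h)
  rw [h1] at h2 h3
  rw [le_div_iff₀ hh] at h2
  rw [div_lt_iff₀ hh] at h3
  constructor <;> linarith

theorem rpow_neg_mul_le_sub {r a h : ℝ} (hr : 1 < r) (ha : 0 < a) (hh : 0 ≤ h) :
    (r - 1) * h * (a + h) ^ (-r) ≤ a ^ (1 - r) - (a + h) ^ (1 - r) := by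
  have hah : 0 < a + h := by linarith
  have hc : 0 < a / (a + h) := by positivity
  -- Bernoulli's inequality for the exponent `r - 1` is applied through the convex function `exp`.
  have hb : 1 + (r - 1) * (h / (a + h)) ≤ (a / (a + h)) ^ (1 - r) := by
    rw [Real.rpow_def_of_pos hc]
    have h1 : Real.log (a / (a + h)) ≤ a / (a + h) - 1 := Real.log_le_sub_one_of_pos hc
    have h2 : a / (a + h) - 1 = -(h / (a + h)) := by field_simp; ring
    have h3 := Real.add_one_le_exp (Real.log (a / (a + h)) * (1 - r))
    nlinarith
  rw [Real.div_rpow ha.le hah.le, le_div_iff₀ (Real.rpow_pos_of_pos hah _)] at hb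
  have h4 : (a + h) ^ (1 - r) = (a + h) * (a + h) ^ (-r) := by
    rw [sub_eq_add_neg, Real.rpow_add hah, Real.rpow_one]
  have h5 : (1 + (r - 1) * (h / (a + h))) * (a + h) ^ (1 - r) =
      (a + h) ^ (1 - r) + (r - 1) * h * (a + h) ^ (-r) := by
    rw [h4]; field_simp
  linarith

/-- Comparison of the sum with an integral: all terms but the first telescope by
`rpow_neg_mul_le_sub`. -/
theorem sum_rpow_neg_le {r q h : ℝ} (hr : 1 < r) (hq : 0 ≤ q) (hh : 0 < h) (J : ℕ) :
    ∑ j ∈ Finset.range (J + 1), (1 + (q + j * h)) ^ (-r) ≤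
      (1 + q) ^ (-r) + (1 + q) ^ (1 - r) / ((r - 1) * h) := by
  have hr' : 0 < (r - 1) * h := mul_pos (by linarith) hh
  have key : ∑ j ∈ Finset.range (J + 1), (1 + (q + j * h)) ^ (-r) ≤
      (1 + q) ^ (-r) + ((1 + q) ^ (1 - r) - (1 + (q + J * h)) ^ (1 - r)) / ((r - 1) * h) := by
    induction J with
    | zero => simp
    | succ J ih =>
      rw [Finset.sum_range_succ]
      have h1 := rpow_neg_mul_le_sub hr (a := 1 + (q + J * h)) (by positivity) hh.le
      have h2 : 1 + (q + J * h) + h = 1 + (q + (J + 1 : ℕ) * h) := by push_cast; ring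
      rw [h2] at h1
      have h3 : (1 + (q + (J + 1 : ℕ) * h)) ^ (-r) ≤
          ((1 + (q + J * h)) ^ (1 - r) - (1 + (q + (J + 1 : ℕ) * h)) ^ (1 - r)) /
            ((r - 1) * h) := by
        rw [le_div_iff₀ hr']
        linarith
      rw [sub_div] at ih h3 ⊢
      linarith
  refine key.trans ?_
  gcongr
  have : 0 ≤ (1 + (q + J * h)) ^ (1 - r) := Real.rpow_nonneg (by positivity) _
  linarith

/-! ### Tail bins and improving switches -/

/-- A decreasing sequence `t 0 ≥ t 1 ≥ … ≥ t (4 u)` of tail quantiles (successive levels differ by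
`p`) of a law whose density is at most `B (1 + ζ) ^ (-r)`. -/
structure TailBins (B r p : ℝ) (u : ℕ) (t : ℕ → ℝ) : Prop where
  anti : ∀ k l, k ≤ l → l ≤ 4 * u → t l ≤ t k
  dens : ∀ k l, k ≤ l → l ≤ 4 * u → ∀ ζ, 0 ≤ ζ → ζ ≤ t l →
    ((l : ℝ) - k) * p ≤ B * (1 + ζ) ^ (-r) * (t k - t l)

/-- In each of the two groups only few bins contain no observation. -/
def MostlyFilled {n : ℕ} (ξ : Fin (2 * n) → ℝ) (u : ℕ) (t : ℕ → ℝ) (w₀ : Allocation n) : Prop :=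
  ∀ β : Bool, (((Finset.range (4 * u)).filter fun k =>
    ∀ i, w₀ i = β → ξ i ∉ Set.Ioc (t (k + 1)) (t k)).card : ℝ) ≤ u / 20

open Classical in
/-- The bins without a subject that belongs to group `β` in both allocations. -/
noncomputable def unfilledBins {n : ℕ} (ξ : Fin (2 * n) → ℝ) (u : ℕ) (t : ℕ → ℝ)
    (w₀ v : Allocation n) (β : Bool) : Finset ℕ :=
  (Finset.range (4 * u)).filter fun k =>
    ¬ ∃ i, w₀ i = β ∧ v i = β ∧ ξ i ∈ Set.Ioc (t (k + 1)) (t k)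

/-- Such a bin either lacked group `β` from the start (at most `u / 20` bins) or contains a
relabelled subject; the bins are disjoint, so at most `u / 10` are of the second kind. -/
theorem card_unfilledBins_le {n : ℕ} {ξ : Fin (2 * n) → ℝ} {u : ℕ} {t : ℕ → ℝ}
    {w₀ v : Allocation n} {B r p : ℝ} (ht : TailBins B r p u t)
    (hf : MostlyFilled ξ u t w₀)
    (hv : ((Finset.univ.filter fun i => v i ≠ w₀ i).card : ℝ) ≤ u / 10) (β : Bool) :
    ((unfilledBins ξ u t w₀ v β).card : ℝ) ≤ 3 * u / 20 := by
  classical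
  set X := (Finset.range (4 * u)).filter fun k =>
    ∀ i, w₀ i = β → ξ i ∉ Set.Ioc (t (k + 1)) (t k) with hX
  set Y := (Finset.range (4 * u)).filter fun k =>
    ∃ i, v i ≠ w₀ i ∧ ξ i ∈ Set.Ioc (t (k + 1)) (t k) with hY
  have hsub : unfilledBins ξ u t w₀ v β ⊆ X ∪ Y := by
    intro k hk
    simp only [unfilledBins, Finset.mem_filter, not_exists, not_and] at hk
    simp only [hX, hY, Finset.mem_union, Finset.mem_filter]
    by_contra! h
    obtain ⟨h1, h2⟩ := h
    obtain ⟨i, hi, hi'⟩ := h1 hk.1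
    refine hk.2 i hi ?_ hi'
    by_contra h3
    exact h2 hk.1 i (by rw [hi]; exact h3) hi'
  have hYc : Y.card ≤ (Finset.univ.filter fun i => v i ≠ w₀ i).card := by
    refine Finset.card_le_card_of_forall_subsingleton
      (fun k i => ξ i ∈ Set.Ioc (t (k + 1)) (t k)) (fun k hk => ?_) (fun i _ => ?_)
    · obtain ⟨i, hi, hi'⟩ := (Finset.mem_filter.1 hk).2
      exact ⟨i, by simpa using hi, hi'⟩
    · have hlt : ∀ k l, k ∈ Y → l ∈ Y → ξ i ∈ Set.Ioc (t (k + 1)) (t k) →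
          ξ i ∈ Set.Ioc (t (l + 1)) (t l) → ¬ k < l := by
        intro k l hk hl hki hli hkl
        have h1 := Finset.mem_range.1 (Finset.mem_filter.1 hl).1
        have h2 := ht.anti (k + 1) l hkl h1.le
        have h3 := hki.1
        have h4 := hli.2
        linarith
      rintro k ⟨hk, hki⟩ l ⟨hl, hli⟩
      exact le_antisymm (not_lt.1 (hlt l k hl hk hli hki)) (not_lt.1 (hlt k l hk hl hki hli))
  have h1 := (Finset.card_le_card hsub).trans (Finset.card_union_le _ _)
  have h2 : ((unfilledBins ξ u t w₀ v β).card : ℝ) ≤ X.card + Y.card := by exact_mod_cast h1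
  have h3 : (Y.card : ℝ) ≤ ((Finset.univ.filter fun i => v i ≠ w₀ i).card : ℝ) := by
    exact_mod_cast hYc
  have h4 := hf β
  linarith

theorem exists_mem_bin_of_notMem_unfilledBins {n : ℕ} {ξ : Fin (2 * n) → ℝ} {u : ℕ} {t : ℕ → ℝ}
    {w₀ v : Allocation n} {β : Bool} {k : ℕ} (hk : k < 4 * u)
    (h : k ∉ unfilledBins ξ u t w₀ v β) : ∃ i, v i = β ∧ ξ i ∈ Set.Ioc (t (k + 1)) (t k) := by
  classical
  simp only [unfilledBins, Finset.mem_filter, Finset.mem_range, hk, true_and, not_not] at h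
  obtain ⟨i, -, h1, h2⟩ := h
  exact ⟨i, h1, h2⟩

/-- The last `u` bins cannot all be among the at most `3 u / 20` unfilled ones. These subjects serve
switches across the two tails. -/
theorem exists_inner {n : ℕ} {ξ : Fin (2 * n) → ℝ} {u : ℕ} (hu : 0 < u) {t : ℕ → ℝ}
    {w₀ v : Allocation n} {B r p : ℝ} (ht : TailBins B r p u t) (hf : MostlyFilled ξ u t w₀)
    (hv : ((Finset.univ.filter fun i => v i ≠ w₀ i).card : ℝ) ≤ u / 10) (β : Bool) :
    ∃ i, v i = β ∧ t (4 * u) < ξ i ∧ ξ i ≤ t (3 * u) := by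
  have hc := card_unfilledBins_le ht hf hv β
  obtain ⟨k, hk, hk'⟩ : ∃ k ∈ Finset.Ico (3 * u) (4 * u), k ∉ unfilledBins ξ u t w₀ v β := by
    by_contra! h
    have h1 : Finset.Ico (3 * u) (4 * u) ⊆ unfilledBins ξ u t w₀ v β := h
    have h2 := Finset.card_le_card h1
    rw [Nat.card_Ico] at h2
    have h3 : u ≤ (unfilledBins ξ u t w₀ v β).card := by omega
    have h4 : (u : ℝ) ≤ (unfilledBins ξ u t w₀ v β).card := by exact_mod_cast h3
    have h5 : (0 : ℝ) < u := by exact_mod_cast hu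
    linarith
  rw [Finset.mem_Ico] at hk
  obtain ⟨i, h1, h2⟩ := exists_mem_bin_of_notMem_unfilledBins hk.2 hk'
  exact ⟨i, h1, (ht.anti (k + 1) (4 * u) hk.2 le_rfl).trans_lt h2.1,
    h2.2.trans (ht.anti _ _ hk.1 hk.2.le)⟩

/-- If no such pair existed, `card_le_of_no_moderate_gap` would bound the number of good cells by
the left side of `hnum`, while at least `7 u / 10` are good. The factor `(1 + q) ^ (r - 1)` in the
gap is exactly what cancels the tail sum of the densities. Only the bins from `u` to `3 u` are used:
the top `u` are left out so that `t u` can be bounded by a second moment. -/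
theorem exists_outer {n : ℕ} {ξ : Fin (2 * n) → ℝ} {u : ℕ} {t : ℕ → ℝ}
    {w₀ v : Allocation n} {B r p : ℝ} (ht : TailBins B r p u t) (hf : MostlyFilled ξ u t w₀)
    (hv : ((Finset.univ.filter fun i => v i ≠ w₀ i).card : ℝ) ≤ u / 10) (β : Bool)
    (hr : 1 < r) (hp : 0 < p) (hB : 0 ≤ B) (hq : 0 ≤ t (3 * u)) {h : ℝ} (hh : 0 < h)
    (hhq : h ≤ 2 * t (3 * u)) {ρ₁ : ℝ} (hρ₁ : 0 ≤ ρ₁)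
    (hnum : 3 * ((⌊(t u - t (3 * u)) / h⌋₊ : ℝ) + 1) + B * ρ₁ / p * (2 + 1 / (r - 1)) <
      7 * u / 10) :
    ∃ i j, v i = β ∧ v j = !β ∧ t (4 * u) < ξ i ∧ t (4 * u) < ξ j ∧
      ρ₁ * (1 + t (3 * u)) ^ (r - 1) * h ≤ ξ i - ξ j ∧ ξ i - ξ j ≤ h := by
  classical
  by_contra hcon
  push Not at hcon
  set q := t (3 * u) with hqdef
  set X := unfilledBins ξ u t w₀ v β with hX
  set Y := unfilledBins ξ u t w₀ v (!β) with hY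
  have hXc := card_unfilledBins_le ht hf hv β
  have hYc := card_unfilledBins_le ht hf hv (!β)
  -- A cell consists of two consecutive bins, with a subject of `β` in the upper and one of the
  -- other group in the lower bin. This interlaces the points and doubles the mass of a cell to `2 *
  -- p`.
  set G := (Finset.range u).filter fun k => u + 2 * k ∉ X ∧ u + 2 * k + 1 ∉ Y with hG
  have hGm : ∀ {k}, k ∈ G → k < u ∧ u + 2 * k ∉ X ∧ u + 2 * k + 1 ∉ Y := by
    intro k hk
    simpa [hG] using hk
  have hcard : 7 * (u : ℝ) / 10 ≤ G.card := by
    have h1 : Finset.range u ⊆ G ∪ (((Finset.range u).filter fun k => u + 2 * k ∈ X) ∪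
        ((Finset.range u).filter fun k => u + 2 * k + 1 ∈ Y)) := by
      intro k hk
      simp only [hG, Finset.mem_union, Finset.mem_filter, hk, true_and]
      tauto
    have h2 := (Finset.card_le_card h1).trans ((Finset.card_union_le _ _).trans
      (Nat.add_le_add_left (Finset.card_union_le _ _) _))
    have h3 : ((Finset.range u).filter fun k => u + 2 * k ∈ X).card ≤ X.card :=
      Finset.card_le_card_of_injOn (fun k => u + 2 * k) (fun k hk => (Finset.mem_filter.1 hk).2)
        (fun a _ b _ hab => by simpa using hab)
    have h4 : ((Finset.range u).filter fun k => u + 2 * k + 1 ∈ Y).card ≤ Y.card :=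
      Finset.card_le_card_of_injOn (fun k => u + 2 * k + 1) (fun k hk => (Finset.mem_filter.1 hk).2)
        (fun a _ b _ hab => by simpa using hab)
    rw [Finset.card_range] at h2
    have h5 : (u : ℝ) ≤ G.card + (X.card + Y.card) := by exact_mod_cast h2.trans (by omega)
    linarith
  have hu : 0 < u := by
    have h1 : 0 < r - 1 := by linarith
    have h2 : (0 : ℝ) < u := by
      have : 0 ≤ 3 * ((⌊(t u - q) / h⌋₊ : ℝ) + 1) + B * ρ₁ / p * (2 + 1 / (r - 1)) := by
        positivity
      linarith
    exact_mod_cast h2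
  have hz : ∀ k, ∃ i, k ∈ G → v i = β ∧ ξ i ∈ Set.Ioc (t (u + 2 * k + 1)) (t (u + 2 * k)) := by
    intro k
    -- Only a default index for the choice at `k ∉ G`.
    obtain ⟨i₀, -⟩ := exists_inner (ξ := ξ) hu ht hf hv β
    by_cases hk : k ∈ G
    · obtain ⟨h1, h2, -⟩ := hGm hk
      obtain ⟨i, hi⟩ := exists_mem_bin_of_notMem_unfilledBins (by omega) h2
      exact ⟨i, fun _ => hi⟩
    · exact ⟨i₀, fun h => absurd h hk⟩
  choose a ha using hz
  have hy : ∀ k, ∃ i, k ∈ G → v i = (!β) ∧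
      ξ i ∈ Set.Ioc (t (u + 2 * k + 1 + 1)) (t (u + 2 * k + 1)) := by
    intro k
    by_cases hk : k ∈ G
    · obtain ⟨h1, -, h2⟩ := hGm hk
      obtain ⟨i, hi⟩ := exists_mem_bin_of_notMem_unfilledBins (by omega) h2
      exact ⟨i, fun _ => hi⟩
    · exact ⟨a k, fun h => absurd h hk⟩
  choose b hb using hy
  have hr' : 0 < r - 1 := by linarith
  have hq1 : 0 < 1 + q := by linarith
  have hpw : 0 < (1 + q) ^ (r - 1) := Real.rpow_pos_of_pos hq1 _
  have hmain := card_le_of_no_moderate_gap (τ := fun k => t (u + 2 * k)) (y := fun k => ξ (b k))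
    (z := fun k => ξ (a k)) (N := u) (G := G) (p := 2 * p) (B := B) (r := r) (q := q) (h := h)
    (δ := ρ₁ * (1 + q) ^ (r - 1) * h) (T := t u)
    (fun k l hkl hl => ht.anti _ _ (by omega) (by omega))
    (fun k hk => (hGm hk).1)
    (fun k hk => (hb k hk).2.1.le)
    (fun k hk => (hb k hk).2.2.trans (ha k hk).2.1.le)
    (fun k hk => (ha k hk).2.2) (by positivity) hB (by positivity) hq hh
    (fun k hk => (ht.anti (u + 2 * k + 1 + 1) (3 * u) (by have := (hGm hk).1; omega)
      (by omega)).trans (hb k hk).2.1.le)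
    (fun k hk => (hb k hk).2.2.trans (ht.anti u (u + 2 * k + 1) (by omega)
      (by have := (hGm hk).1; omega)))
    (fun k l hkl hl ζ h0 hζ => by
      have := ht.dens (u + 2 * k) (u + 2 * l) (by omega) (by omega) ζ h0 hζ
      push_cast at this
      calc ((l : ℝ) - k) * (2 * p) = ((u : ℝ) + 2 * l - (u + 2 * k)) * p := by ring
        _ ≤ _ := this)
    (fun k hk l hl hkl => by
      have hk1 := (hGm hk).1
      have hl1 := (hGm hl).1
      refine absurd hkl.2 (not_le.2 (hcon (a k) (b l) (ha k hk).1 (hb l hl).1 ?_ ?_ hkl.1))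
      · exact (ht.anti _ _ (by omega) le_rfl).trans_lt (ha k hk).2.1
      · exact (ht.anti _ _ (by omega) le_rfl).trans_lt (hb l hl).2.1)
  rw [Finset.sum_add_distrib, Finset.sum_const, Finset.card_range, nsmul_eq_mul,
    ← Finset.sum_div, ← Finset.sum_mul, ← Finset.mul_sum] at hmain
  have hs := sum_rpow_neg_le hr hq hh ⌊(t u - q) / h⌋₊
  have h1 : B * (∑ j ∈ Finset.range (⌊(t u - q) / h⌋₊ + 1), (1 + (q + j * h)) ^ (-r)) *
      (ρ₁ * (1 + q) ^ (r - 1) * h) / (2 * p) ≤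
      B * ((1 + q) ^ (-r) + (1 + q) ^ (1 - r) / ((r - 1) * h)) *
      (ρ₁ * (1 + q) ^ (r - 1) * h) / (2 * p) := by
    gcongr
  have h2 : (1 + q) ^ (1 - r) = ((1 + q) ^ (r - 1))⁻¹ := by
    rw [← Real.rpow_neg hq1.le]; congr 1; ring
  have h3 : (1 + q) ^ (-r) = ((1 + q) ^ (r - 1))⁻¹ / (1 + q) := by
    rw [← h2, eq_div_iff hq1.ne', ← Real.rpow_add_one hq1.ne']; congr 1; ring
  have h4 : B * ((1 + q) ^ (-r) + (1 + q) ^ (1 - r) / ((r - 1) * h)) *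
      (ρ₁ * (1 + q) ^ (r - 1) * h) / (2 * p) =
      B * ρ₁ / p * ((h / (1 + q) + 1 / (r - 1)) / 2) := by
    rw [h3, h2]
    field_simp
  -- Here `h ≤ 2 * q` is needed: it bounds the contribution `h / (1 + q)` of the first window.
  have h5 : B * ρ₁ / p * ((h / (1 + q) + 1 / (r - 1)) / 2) ≤ B * ρ₁ / p * (2 + 1 / (r - 1)) := by
    have h6 : h / (1 + q) ≤ 2 := by
      rw [div_le_iff₀ hq1]; linarith
    have h7 : 0 < 1 / (r - 1) := by positivity
    gcongr
    linarith
  push_cast at hmain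
  linarith

/-- A switch of a subject labelled in the direction of the imbalance against a smaller one of the
other group, at distance at most half the imbalance, improves the balance. -/
theorem exists_improving_switch {n : ℕ} {x : Fin (2 * n) → ℝ} {S : Set (Fin (2 * n))}
    {v : Allocation n} {β : Bool} (hβ : |diffSum x v| = labelSign β * diffSum x v)
    {i j : Fin (2 * n)} (hi : v i = β) (hj : v j = !β) (hiS : i ∈ S) (hjS : j ∈ S) {η : ℝ}
    (h1 : η ≤ x i - x j) (h2 : x i - x j ≤ |diffSum x v| / 2) :
    ∃ v', IsSwitch S v v' ∧ |diffSum x v'| ≤ |diffSum x v| - 2 * η := by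
  cases β
  · refine ⟨v ∘ Equiv.swap j i, ⟨j, hjS, i, hiS, by simpa using hj, hi, rfl⟩, ?_⟩
    rw [diffSum_swap x v (by simpa using hj) hi]
    rw [labelSign_false] at hβ
    rw [abs_le]
    constructor <;> linarith
  · refine ⟨v ∘ Equiv.swap i j, ⟨i, hiS, j, hjS, hi, by simpa using hj, rfl⟩, ?_⟩
    rw [diffSum_swap x v hi (by simpa using hj)]
    rw [labelSign_true] at hβ
    rw [abs_le]
    constructor <;> linarith

theorem exists_label_eq_abs (d : ℝ) : ∃ β : Bool, |d| = labelSign β * d := by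
  rcases le_total 0 d with h | h
  · exact ⟨true, by simp [abs_of_nonneg h]⟩
  · exact ⟨false, by simp [abs_of_nonpos h]⟩

/-- The event on which the greedy phase is controlled: both tails are described by bins that are
mostly filled by both groups and whose observations all are extreme. -/
structure TailControl {n : ℕ} (x : Fin (2 * n) → ℝ) (S : Set (Fin (2 * n))) (w₀ : Allocation n)
    (B r p L : ℝ) (u : ℕ) (tH tL : ℕ → ℝ) : Prop where
  binsH : TailBins B r p u tH
  binsL : TailBins B r p u tL
  filledH : MostlyFilled x u tH w₀
  filledL : MostlyFilled (fun i => -x i) u tL w₀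
  memH : ∀ i, tH (4 * u) < x i → i ∈ S
  memL : ∀ i, tL (4 * u) < -x i → i ∈ S
  separated : L ≤ tH (4 * u) + tL (4 * u)

/-- For a large imbalance an inner subject of one tail is exchanged with an inner subject of the
other: their distance is at least `L` and at most half the imbalance. Otherwise `h = |D| / 2` is at
most twice the larger inner quantile, and `exists_outer` applies in that tail. -/
theorem TailControl.exists_switch {n : ℕ} {x : Fin (2 * n) → ℝ} {S : Set (Fin (2 * n))}
    {w₀ v : Allocation n} {B r p L c ρ₁ : ℝ} {u : ℕ} {tH tL : ℕ → ℝ}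
    (hx : TailControl x S w₀ B r p L u tH tL) (hu : 0 < u) (hr : 1 < r) (hp : 0 < p)
    (hB : 0 ≤ B) (hc : 0 < c) (hρ₁ : 0 ≤ ρ₁)
    (hnumH : 3 * (2 * max 0 (tH u) / c + 1) + B * ρ₁ / p * (2 + 1 / (r - 1)) < 7 * u / 10)
    (hnumL : 3 * (2 * max 0 (tL u) / c + 1) + B * ρ₁ / p * (2 + 1 / (r - 1)) < 7 * u / 10)
    (hv : ((Finset.univ.filter fun i => v i ≠ w₀ i).card : ℝ) ≤ u / 10)
    (hcv : c ≤ |diffSum x v|) :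
    (2 * (tH (3 * u) + tL (3 * u)) < |diffSum x v| →
      ∃ v', IsSwitch S v v' ∧ |diffSum x v'| ≤ |diffSum x v| - 2 * L) ∧
    (|diffSum x v| ≤ 2 * (tH (3 * u) + tL (3 * u)) →
      ∃ v', IsSwitch S v v' ∧ |diffSum x v'| ≤
        |diffSum x v| * (1 - ρ₁ * (1 + max (tH (3 * u)) (tL (3 * u))) ^ (r - 1))) := by
  obtain ⟨β, hβ⟩ := exists_label_eq_abs (diffSum x v)
  constructor
  · intro hD
    obtain ⟨i, hi, hi1, hi2⟩ := exists_inner hu hx.binsH hx.filledH hv β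
    obtain ⟨j, hj, hj1, hj2⟩ := exists_inner hu hx.binsL hx.filledL hv (!β)
    have := hx.separated
    exact exists_improving_switch hβ hi hj (hx.memH i hi1) (hx.memL j hj1) (by linarith)
      (by linarith)
  · intro hD
    have hh : 0 < |diffSum x v| / 2 := by linarith
    -- As `c ≤ |D|`, the window length `|D| / 2` is at least `c / 2`, which bounds the number of
    -- windows.
    have hfl : ∀ a b : ℝ, 0 ≤ b →
        (⌊(a - b) / (|diffSum x v| / 2)⌋₊ : ℝ) ≤ 2 * max 0 a / c := by
      intro a b hb
      refine (Nat.cast_le.2 (Nat.floor_le_floor (b := 2 * max 0 a / c) ?_)).trans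
        (Nat.floor_le (by positivity))
      rw [div_le_div_iff₀ hh hc]
      have h1 : a - b ≤ max 0 a := (by linarith : a - b ≤ a).trans (le_max_right _ _)
      have h2 : (0 : ℝ) ≤ max 0 a := le_max_left _ _
      nlinarith [mul_le_mul_of_nonneg_right h1 hc.le, mul_le_mul_of_nonneg_left hcv h2]
    rcases le_total (tL (3 * u)) (tH (3 * u)) with hle | hle
    · rw [max_eq_left hle]
      have hq : 0 ≤ tH (3 * u) := by linarith
      obtain ⟨i, j, hi, hj, hi1, hj1, h1, h2⟩ := exists_outer hx.binsH hx.filledH hv β hr hp hB hq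
        hh (by linarith) hρ₁ (by linarith [hfl (tH u) (tH (3 * u)) hq])
      obtain ⟨v', hv', hv''⟩ := exists_improving_switch hβ hi hj (hx.memH i hi1) (hx.memH j hj1)
        h1 h2
      exact ⟨v', hv', hv''.trans (le_of_eq (by ring))⟩
    · rw [max_eq_right hle]
      have hq : 0 ≤ tL (3 * u) := by linarith
      -- In the lower tail the values are negated, so the groups exchange their roles.
      obtain ⟨i, j, hi, hj, hi1, hj1, h1, h2⟩ := exists_outer hx.binsL hx.filledL hv (!β) hr hp hB
        hq hh (by linarith) hρ₁ (by linarith [hfl (tL u) (tL (3 * u)) hq])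
      rw [Bool.not_not] at hj
      rw [neg_sub_neg] at h1 h2
      obtain ⟨v', hv', hv''⟩ := exists_improving_switch hβ hj hi (hx.memL j hj1) (hx.memL i hi1)
        h1 h2
      exact ⟨v', hv', hv''.trans (le_of_eq (by ring))⟩

/-! ### Number of greedy steps -/

/-- `FunctionalStep` chains of length exactly `k`. -/
inductive StepChain {n : ℕ} (Φ : Allocation n → ℝ) (S : Set (Fin (2 * n))) (c : ℝ)
    (w₀ : Allocation n) : ℕ → Allocation n → Prop
  | zero : StepChain Φ S c w₀ 0 w₀
  | succ {k : ℕ} {v v' : Allocation n} : StepChain Φ S c w₀ k v → FunctionalStep Φ S c v v' →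
      StepChain Φ S c w₀ (k + 1) v'

theorem exists_stepChain_of_reflTransGen {n : ℕ} {Φ : Allocation n → ℝ} {S : Set (Fin (2 * n))}
    {c : ℝ} {w₀ v : Allocation n} (h : Relation.ReflTransGen (FunctionalStep Φ S c) w₀ v) :
    ∃ k, StepChain Φ S c w₀ k v := by
  induction h with
  | refl => exact ⟨0, .zero⟩
  | tail _ h ih =>
    obtain ⟨k, hk⟩ := ih
    exact ⟨k + 1, hk.succ h⟩

theorem IsSwitch.card_ne_le {n : ℕ} {S : Set (Fin (2 * n))} {w₀ w w' : Allocation n}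
    (h : IsSwitch S w w') : (Finset.univ.filter fun i => w' i ≠ w₀ i).card ≤
      (Finset.univ.filter fun i => w i ≠ w₀ i).card + 2 := by
  obtain ⟨i, -, j, -, -, -, rfl⟩ := h
  have hsub : (Finset.univ.filter fun k => (w ∘ Equiv.swap i j) k ≠ w₀ k) ⊆
      (Finset.univ.filter fun k => w k ≠ w₀ k) ∪ {i, j} := by
    intro k hk
    simp only [Finset.mem_filter, Finset.mem_univ, true_and, Finset.mem_union, Finset.mem_insert,
      Finset.mem_singleton, Function.comp_apply] at hk ⊢
    by_contra! h
    rw [Equiv.swap_apply_of_ne_of_ne h.2.1 h.2.2] at hk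
    exact hk h.1
  exact (Finset.card_le_card hsub).trans ((Finset.card_union_le _ _).trans
    (Nat.add_le_add_left Finset.card_le_two _))

theorem StepChain.card_ne_le {n : ℕ} {Φ : Allocation n → ℝ} {S : Set (Fin (2 * n))} {c : ℝ}
    {w₀ v : Allocation n} {k : ℕ} (h : StepChain Φ S c w₀ k v) :
    (Finset.univ.filter fun i => v i ≠ w₀ i).card ≤ 2 * k := by
  induction h with
  | zero => simp
  | succ _ h ih => exact h.2.1.1.card_ne_le.trans (by omega)

/-- Under tail control the greedy phase ends with an imbalance below `c`. -/
theorem TailControl.abs_diffSum_lt {n : ℕ} {x : Fin (2 * n) → ℝ} {S : Set (Fin (2 * n))}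
    {w₀ v : Allocation n} {B r p L c ρ₁ A : ℝ} {u k₁ k₂ : ℕ} {tH tL : ℕ → ℝ}
    (hx : TailControl x S w₀ B r p L u tH tL) (hu : 0 < u) (hr : 1 < r) (hp : 0 < p)
    (hB : 0 ≤ B) (hL : 0 < L) (hc : 0 < c) (hρ₁ : 0 < ρ₁)
    (hnumH : 3 * (2 * max 0 (tH u) / c + 1) + B * ρ₁ / p * (2 + 1 / (r - 1)) < 7 * u / 10)
    (hnumL : 3 * (2 * max 0 (tL u) / c + 1) + B * ρ₁ / p * (2 + 1 / (r - 1)) < 7 * u / 10)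
    (hA : |diffSum x w₀| ≤ A) (hk₁ : A ≤ 2 * L * k₁) (hk : 2 * (k₁ + k₂ : ℝ) ≤ u / 10)
    (hk₂ : ∀ q : ℝ, 0 ≤ q → 4 * (1 + q) * Real.exp (-(ρ₁ * (1 + q) ^ (r - 1) * k₂)) < c)
    (hv : IsStop (diffSum x) S c w₀ v) : |diffSum x v| < c := by
  by_contra! hcv
  set D₂ := 2 * (tH (3 * u) + tL (3 * u)) with hD₂
  set q := max (tH (3 * u)) (tL (3 * u)) with hq
  have hsep := hx.separated
  have hH := hx.binsH.anti (3 * u) (4 * u) (by omega) le_rfl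
  have hL' := hx.binsL.anti (3 * u) (4 * u) (by omega) le_rfl
  have hqH : tH (3 * u) ≤ q := le_max_left _ _
  have hqL : tL (3 * u) ≤ q := le_max_right _ _
  have hq0 : 0 < q := by linarith
  set ρ := ρ₁ * (1 + q) ^ (r - 1) with hρ
  have hρ0 : 0 < ρ := mul_pos hρ₁ (Real.rpow_pos_of_pos (by linarith) _)
  -- The imbalance after `k` steps.
  have hbound : ∀ k w, StepChain (diffSum x) S c w₀ k w → k ≤ k₁ + k₂ →
      (|diffSum x w| ≤ A - 2 * L * k ∨ |diffSum x w| ≤ D₂) ∧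
      (k₁ ≤ k → |diffSum x w| ≤ D₂ * Real.exp (-(ρ * (k - k₁)))) := by
    intro k w h
    induction h with
    | zero =>
      intro _
      refine ⟨Or.inl (by simpa using hA), fun h0 => ?_⟩
      have h0' : k₁ = 0 := by omega
      subst h0'
      have : |diffSum x w₀| ≤ 0 := hA.trans (by simpa using hk₁)
      simp only [Nat.cast_zero, sub_zero, mul_zero, neg_zero, Real.exp_zero, mul_one]
      linarith
    | @succ k w w' hw hstep ih =>
      intro hkk
      obtain ⟨ih1, ih2⟩ := ih (by omega)
      have hkk' : (k : ℝ) + 1 ≤ k₁ + k₂ := by exact_mod_cast hkk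
      have hcard : ((Finset.univ.filter fun i => w i ≠ w₀ i).card : ℝ) ≤ u / 10 := by
        have h1 : ((Finset.univ.filter fun i => w i ≠ w₀ i).card : ℝ) ≤ 2 * k := by
          exact_mod_cast hw.card_ne_le
        linarith
      obtain ⟨s1, s2⟩ := hx.exists_switch hu hr hp hB hc hρ₁.le hnumH hnumL hcard hstep.1
      rcases lt_or_ge D₂ |diffSum x w| with hlt | hge
      · obtain ⟨w'', hw1, hw2⟩ := s1 hlt
        have h1 := (hstep.2.1.2 w'' hw1).trans hw2
        have h2 := ih1.resolve_right (not_le.2 hlt)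
        refine ⟨Or.inl ?_, fun hk1 => ?_⟩
        · push_cast
          linarith
        -- With `k + 1 ≥ k₁` the linear decrease has brought the imbalance of `w` to at most `2 * L
        -- ≤ D₂`.
        · exfalso
          have h3 : (k₁ : ℝ) ≤ k + 1 := by exact_mod_cast hk1
          have h4 : 2 * L * k₁ ≤ 2 * L * (k + 1) := by gcongr
          have h5 := abs_nonneg (diffSum x w')
          have h6 := hstep.2.2
          linarith
      · obtain ⟨w'', hw1, hw2⟩ := s2 hge
        have h1 := (hstep.2.1.2 w'' hw1).trans hw2
        refine ⟨Or.inr (hstep.2.2.le.trans hge), fun hk1 => ?_⟩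
        rcases hk1.eq_or_lt with h3 | h3
        · rw [h3]
          simp only [sub_self, mul_zero, neg_zero, Real.exp_zero, mul_one]
          exact hstep.2.2.le.trans hge
        · have h4 := ih2 (by omega)
          have h5 : 1 - ρ ≤ Real.exp (-ρ) := by
            have := Real.add_one_le_exp (-ρ)
            linarith
          calc |diffSum x w'| ≤ |diffSum x w| * (1 - ρ) := h1
            _ ≤ |diffSum x w| * Real.exp (-ρ) := by gcongr
            _ ≤ D₂ * Real.exp (-(ρ * (k - k₁))) * Real.exp (-ρ) := by gcongr
            _ = _ := by
              rw [mul_assoc, ← Real.exp_add]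
              push_cast
              congr 2
              ring
  obtain ⟨k, hkv⟩ := exists_stepChain_of_reflTransGen hv.1
  have hlast : ∀ w, StepChain (diffSum x) S c w₀ (k₁ + k₂) w → |diffSum x w| < c := by
    intro w hw
    have h1 := (hbound _ w hw le_rfl).2 (by omega)
    refine h1.trans_lt (lt_of_le_of_lt ?_ (hk₂ q hq0.le))
    push_cast
    rw [add_sub_cancel_left]
    gcongr
    linarith
  have hshort : k < k₁ + k₂ := by
    by_contra! hge
    -- A longer chain would contain a step from a state with small imbalance.
    have hpre : ∀ k w, StepChain (diffSum x) S c w₀ k w → k₁ + k₂ ≤ k → |diffSum x w| < c := by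
      intro k w h
      induction h with
      | zero =>
        intro h0
        have h0' : k₁ + k₂ = 0 := by omega
        exact hlast w₀ (h0' ▸ .zero)
      | @succ k w w' hw hstep ih =>
        intro h0
        rcases h0.eq_or_lt with h1 | h1
        · exact hlast w' (h1 ▸ hw.succ hstep)
        · exact absurd hstep.1 (not_le.2 (ih (by omega)))
    exact absurd hcv (not_le.2 (hpre k v hkv hge))
  have hcard : ((Finset.univ.filter fun i => v i ≠ w₀ i).card : ℝ) ≤ u / 10 := by
    have h1 : ((Finset.univ.filter fun i => v i ≠ w₀ i).card : ℝ) ≤ 2 * k := by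
      exact_mod_cast hkv.card_ne_le
    have h2 : (k : ℝ) ≤ k₁ + k₂ := by exact_mod_cast hshort.le
    linarith
  obtain ⟨s1, s2⟩ := hx.exists_switch hu hr hp hB hc hρ₁.le hnumH hnumL hcard hcv
  -- If any switch improved, a best one would be a legal greedy step.
  have hstuck : ¬ ∃ v', IsSwitch S v v' ∧ |diffSum x v'| < |diffSum x v| := by
    rintro ⟨v', h1, h2⟩
    classical
    obtain ⟨z, hz, hzmin⟩ := Finset.exists_min_image
      (Finset.univ.filter fun z => IsSwitch S v z) (fun z => |diffSum x z|) ⟨v', by simpa using h1⟩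
    simp only [Finset.mem_filter, Finset.mem_univ, true_and] at hz hzmin
    exact hv.2 z ⟨hcv, ⟨hz, hzmin⟩, (hzmin v' h1).trans_lt h2⟩
  rcases lt_or_ge D₂ |diffSum x v| with hlt | hge
  · obtain ⟨v', h1, h2⟩ := s1 hlt
    exact hstuck ⟨v', h1, by linarith⟩
  · obtain ⟨v', h1, h2⟩ := s2 hge
    refine hstuck ⟨v', h1, h2.trans_lt ?_⟩
    have : 0 < |diffSum x v| := by linarith
    nlinarith

/-! ### Chebyshev and Markov bounds for product measures -/

open ProbabilityTheory in
/-- Chebyshev's inequality for sums of functions of the coordinates of a power measure. -/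
theorem measureReal_pi_le_of_variance {ι Ω : Type*} [Fintype ι] [MeasurableSpace Ω]
    {ρ : Measure Ω} [IsProbabilityMeasure ρ] {g : ι → Ω → ℝ} (hg : ∀ i, MemLp (g i) 2 ρ)
    {V : ℝ} (hV : ∑ i, Var[g i; ρ] ≤ V) {s : ℝ} (hs : 0 < s) :
    (Measure.pi fun _ : ι => ρ).real
      {ω | s ≤ |∑ i, g i (ω i) - ∑ i, ∫ x, g i x ∂ρ|} ≤ V / s ^ 2 := by
  have hgi : ∀ i, MemLp (fun ω : ι → Ω => g i (ω i)) 2 (Measure.pi fun _ : ι => ρ) := fun i =>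
    (hg i).comp_measurePreserving (measurePreserving_eval (fun _ : ι => ρ) i)
  have hvar := variance_sum_pi (μ := fun _ : ι => ρ) hg
  have hmem : MemLp (∑ i, fun ω : ι → Ω => g i (ω i)) 2 (Measure.pi fun _ : ι => ρ) :=
    memLp_finsetSum' _ fun i _ => hgi i
  have hint : ∫ ω, (∑ i, fun ω : ι → Ω => g i (ω i)) ω ∂(Measure.pi fun _ : ι => ρ) =
      ∑ i, ∫ x, g i x ∂ρ := by
    simp only [Finset.sum_apply]
    rw [integral_finsetSum _ fun i _ => (hgi i).integrable one_le_two]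
    exact Finset.sum_congr rfl fun i _ => integral_comp_eval (hg i).aestronglyMeasurable
  have h := meas_ge_le_variance_div_sq hmem hs
  rw [hint, hvar] at h
  simp only [Finset.sum_apply] at h
  have h2 : (∑ i, Var[g i; ρ]) / s ^ 2 ≤ V / s ^ 2 := by gcongr
  have h0 : 0 ≤ V / s ^ 2 :=
    (div_nonneg (Finset.sum_nonneg fun i _ => variance_nonneg _ _) (by positivity)).trans h2
  exact ENNReal.toReal_le_of_le_ofReal h0 (h.trans (ENNReal.ofReal_le_ofReal h2))

open ProbabilityTheory in
/-- Chebyshev's inequality for binomial counts. -/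
theorem measureReal_pi_card_deviation {ι Ω : Type*} [Fintype ι] [MeasurableSpace Ω]
    (ρ : Measure Ω) [IsProbabilityMeasure ρ] {S : Set Ω} (hS : MeasurableSet S)
    [DecidablePred (· ∈ S)] (A : Finset ι) {s : ℝ} (hs : 0 < s) :
    (Measure.pi fun _ : ι => ρ).real
      {ω | s ≤ |((A.filter fun i => ω i ∈ S).card : ℝ) - A.card * ρ.real S|} ≤
      A.card / s ^ 2 := by
  classical
  set g : ι → Ω → ℝ := fun i => if i ∈ A then S.indicator 1 else 0 with hg
  have hgm : ∀ i, MemLp (g i) 2 ρ := by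
    intro i
    by_cases hi : i ∈ A
    · simp only [hg, hi, if_true]
      exact (memLp_const (1 : ℝ)).indicator hS
    · simp [hg, hi]
  have hvar : ∑ i, Var[g i; ρ] ≤ (A.card : ℝ) := by
    have h1 : ∀ i, Var[g i; ρ] ≤ if i ∈ A then 1 else 0 := by
      intro i
      by_cases hi : i ∈ A
      · simp only [hg, hi, if_true]
        have h01 : ∀ x, S.indicator (1 : Ω → ℝ) x ∈ Set.Icc (0 : ℝ) 1 := by
          intro x
          by_cases hx : x ∈ S <;> simp [hx]
        have := variance_le_sq_of_bounded (μ := ρ) (a := 0) (b := 1) (X := S.indicator (1 : Ω → ℝ))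
          (Eventually.of_forall h01) ((measurable_one.indicator hS).aemeasurable)
        refine this.trans (by norm_num)
      · simp [hg, hi]
    refine (Finset.sum_le_sum fun i _ => h1 i).trans ?_
    simp
  have h := measureReal_pi_le_of_variance hgm hvar hs
  have e1 : ∀ ω : ι → Ω, ∑ i, g i (ω i) = ((A.filter fun i => ω i ∈ S).card : ℝ) := by
    intro ω
    rw [Finset.card_filter, Nat.cast_sum, ← Finset.sum_subset (Finset.subset_univ A)]
    · refine Finset.sum_congr rfl fun i hi => ?_
      by_cases h : ω i ∈ S <;> simp [hg, hi, h]
    · intro i _ hi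
      simp [hg, hi]
  have e2 : ∑ i, ∫ x, g i x ∂ρ = A.card * ρ.real S := by
    have h1 : ∀ i, ∫ x, g i x ∂ρ = if i ∈ A then ρ.real S else 0 := by
      intro i
      by_cases hi : i ∈ A
      · simp only [hg, hi, if_true]
        exact integral_indicator_one hS
      · simp [hg, hi]
    simp_rw [h1]
    simp
  simp_rw [e1, e2] at h
  exact h

/-- Markov's inequality for the number of events that occur. -/
theorem measureReal_card_ge_le {Ω κ : Type*} [MeasurableSpace Ω] (ρ : Measure Ω)
    [IsFiniteMeasure ρ] (F : Finset κ) (E : κ → Ω → Prop) [∀ k ω, Decidable (E k ω)]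
    (hE : ∀ k, MeasurableSet {ω | E k ω}) {s : ℝ} (hs : 0 < s) :
    ρ.real {ω | s ≤ ((F.filter fun k => E k ω).card : ℝ)} ≤ (∑ k ∈ F, ρ.real {ω | E k ω}) / s := by
  classical
  have h1 : ∀ ω, ((F.filter fun k => E k ω).card : ℝ) =
      ∑ k ∈ F, {ω | E k ω}.indicator (1 : Ω → ℝ) ω := by
    intro ω
    rw [Finset.card_filter, Nat.cast_sum]
    refine Finset.sum_congr rfl fun k _ => ?_
    by_cases h : E k ω <;> simp [h, Set.indicator]
  have hi : ∀ k ∈ F, Integrable ({ω | E k ω}.indicator (1 : Ω → ℝ)) ρ := fun k _ =>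
    (integrable_const (1 : ℝ)).indicator (hE k)
  have h2 := mul_meas_ge_le_integral_of_nonneg (μ := ρ)
    (f := fun ω => ((F.filter fun k => E k ω).card : ℝ))
    (Eventually.of_forall fun ω => Nat.cast_nonneg _)
    (by simp_rw [h1]; exact integrable_finsetSum _ hi) s
  rw [le_div_iff₀ hs, mul_comm]
  refine h2.trans (le_of_eq ?_)
  simp_rw [h1]
  rw [integral_finsetSum _ hi]
  exact Finset.sum_congr rfl fun k _ => integral_indicator_one (hE k)

/-- The event that no observation with index in `A` falls into `b`. -/
theorem measureReal_pi_forall_notMem {ι Ω : Type*} [Fintype ι] [MeasurableSpace Ω]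
    (ρ : Measure Ω) [IsProbabilityMeasure ρ] {b : Set Ω} (hb : MeasurableSet b) (A : Finset ι) :
    (Measure.pi fun _ : ι => ρ).real {x | ∀ i ∈ A, x i ∉ b} = (1 - ρ.real b) ^ A.card := by
  classical
  have h1 : {x : ι → Ω | ∀ i ∈ A, x i ∉ b} =
      Set.univ.pi fun i => if i ∈ A then bᶜ else Set.univ := by
    ext x
    simp only [Set.mem_ofPred_eq, Set.mem_pi, Set.mem_univ, true_imp_iff]
    refine forall_congr' fun i => ?_
    by_cases hi : i ∈ A <;> simp [hi]
  rw [h1, measureReal_def, Measure.pi_pi, ENNReal.toReal_prod,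
    ← Finset.prod_subset (Finset.subset_univ A)]
  · rw [Finset.prod_congr rfl (g := fun _ => 1 - ρ.real b), Finset.prod_const]
    intro i hi
    simp only [hi, if_true]
    exact probReal_compl_eq_one_sub hb
  · intro i _ hi
    simp [hi]

theorem measureReal_pi_eval_mem {ι Ω : Type*} [Fintype ι] [MeasurableSpace Ω]
    (ρ : Measure Ω) [IsProbabilityMeasure ρ] {b : Set Ω} (hb : MeasurableSet b) (i : ι) :
    (Measure.pi fun _ : ι => ρ).real {x | x i ∈ b} = ρ.real b := by
  have h := (measurePreserving_eval (fun _ : ι => ρ) i).measureReal_preimage hb.nullMeasurableSet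
  exact h

/-! ### Quantiles and the probability of tail control -/

/-- A law without atoms has upper quantiles of every level. -/
theorem exists_upper_quantile (μ : Measure ℝ) [IsProbabilityMeasure μ] [NullSingletonClass μ] {s : ℝ}
    (h0 : 0 < s) (h1 : s < 1) : ∃ q, μ.real (Set.Ioi q) = s := by
  have hc : Continuous (ProbabilityTheory.cdf μ) := by
    rw [continuous_iff_continuousAt]
    intro x
    rw [(ProbabilityTheory.cdf μ).mono.continuousAt_iff_leftLim_eq_rightLim]
    rw [StieltjesFunction.rightLim_eq]
    have h2 := StieltjesFunction.measure_singleton (ProbabilityTheory.cdf μ) x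
    rw [ProbabilityTheory.measure_cdf, measure_singleton, eq_comm, ENNReal.ofReal_eq_zero] at h2
    exact le_antisymm ((ProbabilityTheory.cdf μ).mono.leftLim_le le_rfl) (by linarith)
  obtain ⟨a, ha⟩ := ((ProbabilityTheory.tendsto_cdf_atBot μ).eventually
    (gt_mem_nhds (by linarith : 0 < 1 - s))).exists
  obtain ⟨b, hb⟩ := ((ProbabilityTheory.tendsto_cdf_atTop μ).eventually
    (lt_mem_nhds (by linarith : 1 - s < 1))).exists
  obtain ⟨q, hq⟩ := mem_range_of_exists_le_of_exists_ge hc ⟨a, ha.le⟩ ⟨b, hb.le⟩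
  refine ⟨q, ?_⟩
  rw [ProbabilityTheory.cdf_eq_real] at hq
  rw [← Set.compl_Iic, probReal_compl_eq_one_sub measurableSet_Iic, hq]
  ring

/-- The levels are `(k + 1) * p` instead of `k * p`, so that `t 0` is a finite quantile even for
unbounded support; the part above `t 0` belongs to no bin. -/
theorem exists_tailBins (μ : Measure ℝ) [IsProbabilityMeasure μ] [NullSingletonClass μ] {B r p : ℝ} {u : ℕ}
    (hp : 0 < p) (hp1 : (4 * u + 1) * p < 1)
    (hdens : ∀ ζ a b, 0 ≤ ζ → ζ ≤ a → a ≤ b → μ.real (Set.Ioc a b) ≤ B * (1 + ζ) ^ (-r) * (b - a)) :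
    ∃ t, TailBins B r p u t ∧ (∀ k ≤ 4 * u, μ.real (Set.Ioi (t k)) = (k + 1) * p) ∧
      ∀ k < 4 * u, μ.real (Set.Ioc (t (k + 1)) (t k)) = p := by
  have hq : ∀ k : ℕ, ∃ q, k ≤ 4 * u → μ.real (Set.Ioi q) = (k + 1) * p := by
    intro k
    by_cases hk : k ≤ 4 * u
    · have hk' : (k : ℝ) ≤ 4 * u := by exact_mod_cast hk
      obtain ⟨q, hq⟩ := exists_upper_quantile μ (s := (k + 1) * p) (by positivity)
        (lt_of_le_of_lt (by gcongr) hp1)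
      exact ⟨q, fun _ => hq⟩
    · exact ⟨0, fun h => absurd h hk⟩
  choose t ht using hq
  have hanti : ∀ k l, k ≤ l → l ≤ 4 * u → t l ≤ t k := by
    intro k l hkl hl
    rcases hkl.eq_or_lt with h | h
    · rw [h]
    by_contra! hlt
    have h1 : μ.real (Set.Ioi (t l)) ≤ μ.real (Set.Ioi (t k)) :=
      measureReal_mono (Set.Ioi_subset_Ioi hlt.le)
    rw [ht k (by omega), ht l hl] at h1
    have h2 := le_of_mul_le_mul_right h1 hp
    have h3 : (k : ℝ) < l := by exact_mod_cast h
    linarith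
  have hIoc : ∀ k l, k ≤ l → l ≤ 4 * u → μ.real (Set.Ioc (t l) (t k)) = ((l : ℝ) - k) * p := by
    intro k l hkl hl
    rw [← Set.Ioi_sdiff_Ioi, measureReal_sdiff (Set.Ioi_subset_Ioi (hanti k l hkl hl))
      measurableSet_Ioi, ht k (by omega), ht l hl]
    ring
  refine ⟨t, ⟨hanti, fun k l hkl hl ζ h0 hζ => ?_⟩, ht, fun k hk => ?_⟩
  · rw [← hIoc k l hkl hl]
    exact hdens ζ _ _ h0 hζ (hanti k l hkl hl)
  · rw [hIoc k (k + 1) (by omega) hk]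
    push_cast
    ring

/-- A given bin misses the `n` subjects of a group with probability `(1 - p) ^ n`. Markov's
inequality for the number of missed bins among `4 u`, at level `u / 20`, costs a factor `80`, and
there are two groups. -/
theorem measureReal_not_mostlyFilled_le {n : ℕ} {μ : Measure ℝ} [IsProbabilityMeasure μ]
    {g : ℝ → ℝ} (hg : Measurable g) {u : ℕ} (hu : 0 < u) {t : ℕ → ℝ} {p : ℝ}
    (ht : ∀ k < 4 * u, (μ.map g).real (Set.Ioc (t (k + 1)) (t k)) = p)
    {w₀ : Allocation n} (hw₀ : IsBalanced w₀) :
    (Measure.pi fun _ : Fin (2 * n) => μ).real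
      {x | ¬ MostlyFilled (fun i => g (x i)) u t w₀} ≤ 160 * (1 - p) ^ n := by
  classical
  set P := Measure.pi fun _ : Fin (2 * n) => μ with hP
  have hu' : (0 : ℝ) < u := by exact_mod_cast hu
  have hone : ∀ β : Bool, P.real {x | (u : ℝ) / 20 ≤ (((Finset.range (4 * u)).filter fun k =>
      ∀ i, w₀ i = β → g (x i) ∉ Set.Ioc (t (k + 1)) (t k)).card : ℝ)} ≤ 80 * (1 - p) ^ n := by
    intro β
    have hset : ∀ k, {x : Fin (2 * n) → ℝ | ∀ i, w₀ i = β → g (x i) ∉ Set.Ioc (t (k + 1)) (t k)} =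
        {x | ∀ i ∈ Finset.univ.filter (fun i => w₀ i = β),
          x i ∉ g ⁻¹' Set.Ioc (t (k + 1)) (t k)} := by
      intro k; ext x; simp
    have hcard : (Finset.univ.filter fun i => w₀ i = β).card = n := by
      cases β
      · exact hw₀.card_false
      · exact hw₀
    have hmeas : ∀ k, MeasurableSet
        {x : Fin (2 * n) → ℝ | ∀ i, w₀ i = β → g (x i) ∉ Set.Ioc (t (k + 1)) (t k)} := by
      intro k
      have : {x : Fin (2 * n) → ℝ | ∀ i, w₀ i = β → g (x i) ∉ Set.Ioc (t (k + 1)) (t k)} =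
          ⋂ i, ⋂ (_ : w₀ i = β), {x | g (x i) ∈ Set.Ioc (t (k + 1)) (t k)}ᶜ := by
        ext x; simp
      rw [this]
      exact MeasurableSet.iInter fun i => MeasurableSet.iInter fun _ =>
        ((hg.comp (measurable_pi_apply i)) measurableSet_Ioc).compl
    have h := measureReal_card_ge_le P (Finset.range (4 * u))
      (fun k x => ∀ i, w₀ i = β → g (x i) ∉ Set.Ioc (t (k + 1)) (t k)) hmeas
      (s := u / 20) (by positivity)
    have hk : ∀ k ∈ Finset.range (4 * u), P.real
        {x : Fin (2 * n) → ℝ | ∀ i, w₀ i = β → g (x i) ∉ Set.Ioc (t (k + 1)) (t k)} =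
        (1 - p) ^ n := by
      intro k hk
      rw [hset, hP, measureReal_pi_forall_notMem μ (hg measurableSet_Ioc), hcard,
        ← map_measureReal_apply hg measurableSet_Ioc, ht k (Finset.mem_range.1 hk)]
    rw [Finset.sum_congr rfl hk, Finset.sum_const, Finset.card_range, nsmul_eq_mul] at h
    refine h.trans (le_of_eq ?_)
    push_cast
    field_simp
    ring
  have hsub : {x : Fin (2 * n) → ℝ | ¬ MostlyFilled (fun i => g (x i)) u t w₀} ⊆
      {x | (u : ℝ) / 20 ≤ (((Finset.range (4 * u)).filter fun k =>
        ∀ i, w₀ i = true → g (x i) ∉ Set.Ioc (t (k + 1)) (t k)).card : ℝ)} ∪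
      {x | (u : ℝ) / 20 ≤ (((Finset.range (4 * u)).filter fun k =>
        ∀ i, w₀ i = false → g (x i) ∉ Set.Ioc (t (k + 1)) (t k)).card : ℝ)} := by
    intro x hx
    simp only [MostlyFilled, Set.mem_ofPred_eq, not_forall, not_le] at hx
    obtain ⟨β, hβ⟩ := hx
    cases β
    · right
      have := hβ.le
      simp only [Set.mem_ofPred_eq]
      convert this
    · left
      have := hβ.le
      simp only [Set.mem_ofPred_eq]
      convert this
  refine (measureReal_mono hsub).trans ((measureReal_union_le _ _).trans ?_)
  linarith [hone true, hone false]

theorem measureReal_card_tail_ge_le {n : ℕ} {μ : Measure ℝ} [IsProbabilityMeasure μ]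
    {g : ℝ → ℝ} (hg : Measurable g) {m : ℕ} (hm : 0 < m) {q s : ℝ}
    (hq : (μ.map g).real (Set.Ioi q) = s) :
    (Measure.pi fun _ : Fin (2 * n) => μ).real
      {x | m ≤ (Finset.univ.filter fun i => q < g (x i)).card} ≤ 2 * n * s / m := by
  classical
  have h := measureReal_card_ge_le (Measure.pi fun _ : Fin (2 * n) => μ) Finset.univ
    (fun i x => q < g (x i)) (fun i => (hg.comp (measurable_pi_apply i)) measurableSet_Ioi)
    (s := m) (by exact_mod_cast hm)
  have hk : ∀ i ∈ (Finset.univ : Finset (Fin (2 * n))),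
      (Measure.pi fun _ : Fin (2 * n) => μ).real {x | q < g (x i)} = s := by
    intro i _
    rw [← hq, map_measureReal_apply hg measurableSet_Ioi]
    exact measureReal_pi_eval_mem μ (hg measurableSet_Ioi) i
  rw [Finset.sum_congr rfl hk, Finset.sum_const, Finset.card_univ, Fintype.card_fin,
    nsmul_eq_mul] at h
  push_cast at h
  simpa using h

theorem measureReal_card_lt_le {n : ℕ} (hn : 0 < n) {μ : Measure ℝ} [IsProbabilityMeasure μ]
    {S : Set ℝ} (hS : MeasurableSet S) [DecidablePred (· ∈ S)] (hpos : 0 < μ.real S) :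
    (Measure.pi fun _ : Fin (2 * n) => μ).real
      {x | ((Finset.univ.filter fun i => x i ∈ S).card : ℝ) < n * μ.real S} ≤
      2 / (n * μ.real S ^ 2) := by
  have hn' : (0 : ℝ) < n := by exact_mod_cast hn
  have h := measureReal_pi_card_deviation μ hS (Finset.univ : Finset (Fin (2 * n)))
    (s := n * μ.real S) (by positivity)
  refine (measureReal_mono fun x hx => ?_).trans (h.trans (le_of_eq ?_))
  · simp only [Set.mem_ofPred_eq, Finset.card_univ, Fintype.card_fin] at hx ⊢
    push_cast
    rw [le_abs]
    right
    linarith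
  · rw [Finset.card_univ, Fintype.card_fin]
    push_cast
    field_simp

/-- The signs of a balanced allocation sum to zero, so the signed sum is centred whatever the mean
of `μ` is, and Chebyshev's inequality applies. -/
theorem measureReal_abs_diffSum_ge_le {n : ℕ} {μ : Measure ℝ} [IsProbabilityMeasure μ]
    (hμ : MemLp id 2 μ) {w₀ : Allocation n} (hw₀ : IsBalanced w₀) {A : ℝ} (hA : 0 < A) :
    (Measure.pi fun _ : Fin (2 * n) => μ).real {x | A ≤ |diffSum x w₀|} ≤
      2 * n * (∫ x, x ^ 2 ∂μ) / A ^ 2 := by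
  have hg : ∀ i, MemLp (fun x => labelSign (w₀ i) * x) 2 μ := fun i => hμ.const_mul _
  have h := measureReal_pi_le_of_variance hg (V := 2 * n * (∫ x, x ^ 2 ∂μ)) ?_ hA
  · have h0 : ∑ i, ∫ x, labelSign (w₀ i) * x ∂μ = 0 := by
      rw [Finset.sum_congr rfl fun i _ => integral_const_mul _ _, ← Finset.sum_mul, sum_labelSign_of_isBalanced hw₀, zero_mul]
    refine (measureReal_mono fun x hx => ?_).trans h
    simp only [Set.mem_ofPred_eq] at hx ⊢
    rw [h0, sub_zero, ← diffSum_eq_sum]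
    exact hx
  · have h1 : ∀ i, ProbabilityTheory.variance (fun x => labelSign (w₀ i) * x) μ ≤
        ∫ x, x ^ 2 ∂μ := by
      intro i
      refine (ProbabilityTheory.variance_le_expectation_sq (hg i).aestronglyMeasurable).trans
        (le_of_eq ?_)
      refine integral_congr_ae (Eventually.of_forall fun x => ?_)
      simp only [Pi.pow_apply, mul_pow, labelSign_sq, one_mul]
    refine (Finset.sum_le_sum fun i _ => h1 i).trans ?_
    rw [Finset.sum_const, Finset.card_univ, Fintype.card_fin, nsmul_eq_mul]
    push_cast
    exact le_rfl

/-- Markov's inequality for `x ^ 2`: a quantile above `T` would make the second moment exceed `s * T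
^ 2`. -/
theorem upper_quantile_le {μ : Measure ℝ} [IsProbabilityMeasure μ] (hμ : MemLp id 2 μ) {q s T : ℝ}
    (hs : 0 < s) (hq : μ.real (Set.Ioi q) = s) (hT : 0 ≤ T) (hsT : ∫ x, x ^ 2 ∂μ ≤ s * T ^ 2) :
    max 0 q ≤ T := by
  refine max_le hT ?_
  by_contra! hlt
  have hint : Integrable (fun x : ℝ => x ^ 2) μ := by simpa using hμ.integrable_sq
  have h := mul_meas_ge_le_integral_of_nonneg (μ := μ) (f := fun x : ℝ => x ^ 2)
    (Eventually.of_forall fun x => sq_nonneg x) hint (q ^ 2)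
  have h2 : s ≤ μ.real {x | q ^ 2 ≤ x ^ 2} := by
    rw [← hq]
    refine measureReal_mono fun x hx => ?_
    have hx' : q < x := hx
    simp only [Set.mem_ofPred_eq]
    nlinarith
  have h3 : s * q ^ 2 ≤ s * T ^ 2 := by
    calc s * q ^ 2 ≤ q ^ 2 * μ.real {x | q ^ 2 ≤ x ^ 2} := by
          rw [mul_comm]; gcongr
      _ ≤ _ := h.trans hsT
  have h4 := le_of_mul_le_mul_left h3 hs
  nlinarith

/-- Quantitative control of the greedy phase for a fixed sample size. -/
theorem measureReal_greedyPhase_fails_le {μ : Measure ℝ} [IsProbabilityMeasure μ]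
    [NullSingletonClass μ] (hμ : MemLp id 2 μ) {B r : ℝ} (hr : 1 < r) (hB : 0 ≤ B)
    (hdensH : ∀ ζ a b, 0 ≤ ζ → ζ ≤ a → a ≤ b →
      μ.real (Set.Ioc a b) ≤ B * (1 + ζ) ^ (-r) * (b - a))
    (hdensL : ∀ ζ a b, 0 ≤ ζ → ζ ≤ a → a ≤ b →
      (μ.map Neg.neg).real (Set.Ioc a b) ≤ B * (1 + ζ) ^ (-r) * (b - a))
    {a₁ a₂ : ℝ} (ha : a₁ < a₂) {c : ℝ} (hc : 0 < c) {n u m k₁ k₂ : ℕ} {p T A ρ₁ : ℝ}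
    (hu : 0 < u) (hm : 0 < m) (hn : 0 < n) (hp : 0 < p) (hp1 : (4 * u + 1) * p < 1)
    (hpL : (4 * u + 1) * p < μ.real (Set.Iio a₁)) (hpH : (4 * u + 1) * p < μ.real (Set.Ioi a₂))
    (hT : 0 ≤ T) (hT2 : ∫ x, x ^ 2 ∂μ ≤ (u + 1) * p * T ^ 2) (hρ₁ : 0 < ρ₁) (hA : 0 < A)
    (hnum : 3 * (2 * T / c + 1) + B * ρ₁ / p * (2 + 1 / (r - 1)) < 7 * u / 10)
    (hk₁ : A ≤ 2 * (a₂ - a₁) * k₁) (hk : 2 * (k₁ + k₂ : ℝ) ≤ u / 10)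
    (hk₂ : ∀ q : ℝ, 0 ≤ q → 4 * (1 + q) * Real.exp (-(ρ₁ * (1 + q) ^ (r - 1) * k₂)) < c)
    {w₀ : Allocation n} (hw₀ : IsBalanced w₀) :
    (Measure.pi fun _ : Fin (2 * n) => μ).real {x |
      ¬ ((∀ v, IsStop (diffSum x) (extremes x m) c w₀ v → |diffSum x v| < c) ∧
        n * μ.real (Set.Iio a₁) ≤ (Finset.univ.filter fun i => x i < a₁).card ∧
        n * μ.real (Set.Ioi a₂) ≤ (Finset.univ.filter fun i => a₂ < x i).card)} ≤
      2 * n * (∫ x, x ^ 2 ∂μ) / A ^ 2 + 320 * (1 - p) ^ n + 4 * n * ((4 * u + 1) * p) / m +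
        (2 / (n * μ.real (Set.Iio a₁) ^ 2) + 2 / (n * μ.real (Set.Ioi a₂) ^ 2)) := by
  classical
  have hneg : Measurable (Neg.neg : ℝ → ℝ) := measurable_neg
  have : IsProbabilityMeasure (μ.map Neg.neg) :=
    Measure.isProbabilityMeasure_map hneg.aemeasurable
  have : NullSingletonClass (μ.map Neg.neg) := by
    refine ⟨fun x => ?_⟩
    rw [Measure.map_apply hneg (measurableSet_singleton x), Set.neg_preimage, Set.neg_singleton,
      measure_singleton]
  have hμneg : MemLp id 2 (μ.map Neg.neg) := by
    rw [memLp_map_measure_iff aestronglyMeasurable_id hneg.aemeasurable]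
    exact hμ.neg
  have hσneg : ∫ x, x ^ 2 ∂(μ.map Neg.neg) = ∫ x, x ^ 2 ∂μ := by
    rw [integral_map hneg.aemeasurable (by fun_prop)]
    simp
  obtain ⟨tH, hbH, htH, hIH⟩ := exists_tailBins μ hp hp1 hdensH
  obtain ⟨tL, hbL, htL, hIL⟩ := exists_tailBins (μ.map Neg.neg) hp hp1 hdensL
  have htopH := htH (4 * u) le_rfl
  have htopL := htL (4 * u) le_rfl
  push_cast at htopH htopL
  have hTH : max 0 (tH u) ≤ T :=
    upper_quantile_le hμ (by positivity) (htH u (by omega)) hT hT2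
  have hTL : max 0 (tL u) ≤ T :=
    upper_quantile_le hμneg (by positivity) (htL u (by omega)) hT (hσneg ▸ hT2)
  have hnumH : 3 * (2 * max 0 (tH u) / c + 1) + B * ρ₁ / p * (2 + 1 / (r - 1)) < 7 * u / 10 :=
    lt_of_le_of_lt (by gcongr) hnum
  have hnumL : 3 * (2 * max 0 (tL u) / c + 1) + B * ρ₁ / p * (2 + 1 / (r - 1)) < 7 * u / 10 :=
    lt_of_le_of_lt (by gcongr) hnum
  have hsepH : a₂ ≤ tH (4 * u) := by
    by_contra! h
    have h1 : μ.real (Set.Ioi a₂) ≤ μ.real (Set.Ioi (tH (4 * u))) :=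
      measureReal_mono (Set.Ioi_subset_Ioi h.le)
    linarith
  have hsepL : -a₁ ≤ tL (4 * u) := by
    by_contra! h
    have h1 : μ.real (Set.Iio a₁) ≤ (μ.map Neg.neg).real (Set.Ioi (tL (4 * u))) := by
      rw [map_measureReal_apply hneg measurableSet_Ioi]
      refine measureReal_mono fun x hx => ?_
      have hx' : x < a₁ := hx
      simp only [Set.mem_preimage, Set.mem_Ioi]
      linarith
    linarith
  have hsub : {x : Fin (2 * n) → ℝ |
      ¬ ((∀ v, IsStop (diffSum x) (extremes x m) c w₀ v → |diffSum x v| < c) ∧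
        n * μ.real (Set.Iio a₁) ≤ (Finset.univ.filter fun i => x i < a₁).card ∧
        n * μ.real (Set.Ioi a₂) ≤ (Finset.univ.filter fun i => a₂ < x i).card)} ⊆
      {x | A ≤ |diffSum x w₀|} ∪ (({x | ¬ MostlyFilled (fun i => id (x i)) u tH w₀} ∪
        {x | ¬ MostlyFilled (fun i => -x i) u tL w₀}) ∪
      (({x | m ≤ (Finset.univ.filter fun i => tH (4 * u) < id (x i)).card} ∪
        {x | m ≤ (Finset.univ.filter fun i => tL (4 * u) < -x i).card}) ∪
      ({x | ((Finset.univ.filter fun i => x i ∈ Set.Iio a₁).card : ℝ) < n * μ.real (Set.Iio a₁)} ∪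
       {x | ((Finset.univ.filter fun i => x i ∈ Set.Ioi a₂).card : ℝ) <
        n * μ.real (Set.Ioi a₂)}))) := by
    intro x hx
    by_contra hcon
    simp only [Set.mem_union, Set.mem_ofPred_eq, not_or, not_not, not_le, not_lt, id] at hcon
    obtain ⟨hx1, ⟨hx2, hx3⟩, ⟨hx4, hx5⟩, hx6, hx7⟩ := hcon
    refine hx ⟨fun v hv => ?_, hx6, hx7⟩
    have htc : TailControl x (extremes x m) w₀ B r p (a₂ - a₁) u tH tL :=
      { binsH := hbH
        binsL := hbL
        filledH := hx2
        filledL := hx3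
        memH := fun i hi => Or.inr (lt_of_le_of_lt (Finset.card_le_card fun j hj => by
          simp only [Finset.mem_filter, Finset.mem_univ, true_and] at hj ⊢
          exact hi.trans hj) hx4)
        memL := fun i hi => Or.inl (lt_of_le_of_lt (Finset.card_le_card fun j hj => by
          simp only [Finset.mem_filter, Finset.mem_univ, true_and] at hj ⊢
          linarith) hx5)
        separated := by linarith }
    exact htc.abs_diffSum_lt hu hr hp hB (by linarith) hc hρ₁ hnumH hnumL hx1.le hk₁ hk hk₂ hv
  have e1 := measureReal_abs_diffSum_ge_le hμ hw₀ hA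
  have e2 := measureReal_not_mostlyFilled_le (μ := μ) measurable_id hu
    (by rw [Measure.map_id]; exact hIH) hw₀
  have e3 := measureReal_not_mostlyFilled_le (μ := μ) hneg hu hIL hw₀
  have e4 := measureReal_card_tail_ge_le (n := n) (μ := μ) measurable_id hm
    (q := tH (4 * u)) (s := (4 * u + 1) * p) (by rw [Measure.map_id]; exact htopH)
  have e5 := measureReal_card_tail_ge_le (n := n) (μ := μ) hneg hm htopL
  have hposL : 0 < μ.real (Set.Iio a₁) := lt_trans (by positivity) hpL
  have hposH : 0 < μ.real (Set.Ioi a₂) := lt_trans (by positivity) hpH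
  have e6 := measureReal_card_lt_le hn (μ := μ) (S := Set.Iio a₁) measurableSet_Iio hposL
  have e7 := measureReal_card_lt_le hn (μ := μ) (S := Set.Ioi a₂) measurableSet_Ioi hposH
  refine (measureReal_mono hsub).trans ?_
  refine (measureReal_union_le _ _).trans (le_trans (add_le_add e1
    ((measureReal_union_le _ _).trans (add_le_add ((measureReal_union_le _ _).trans
      (add_le_add e2 e3)) ((measureReal_union_le _ _).trans (add_le_add
      ((measureReal_union_le _ _).trans (add_le_add e4 e5))
      ((measureReal_union_le _ _).trans (add_le_add e6 e7))))))) (le_of_eq ?_))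
  ring

/-- With `z = (1 + q) ^ (r - 1) ≥ 1`, the bound `log z ≤ z` gives `1 + q ≤ exp (z / (r - 1))`, so
the exponential beats the prefactor uniformly in `q`. No control of how far out the quantile lies is
therefore needed. -/
theorem mul_exp_neg_rpow_lt {r c Γ : ℝ} (hr : 1 < r) (hc : 0 < c)
    (hΓ : 1 / (r - 1) + |Real.log (4 / c)| + 1 ≤ Γ) {q : ℝ} (hq : 0 ≤ q) :
    4 * (1 + q) * Real.exp (-(Γ * (1 + q) ^ (r - 1))) < c := by
  have hr' : 0 < r - 1 := by linarith
  set z := (1 + q) ^ (r - 1) with hz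
  have hz1 : 1 ≤ z := Real.one_le_rpow (by linarith) hr'.le
  have hlog : Real.log (1 + q) ≤ 1 / (r - 1) * z := by
    have h1 : Real.log z = (r - 1) * Real.log (1 + q) := Real.log_rpow (by linarith) _
    have h2 : Real.log z ≤ z := (Real.log_le_sub_one_of_pos (by linarith)).trans (by linarith)
    rw [div_mul_eq_mul_div, one_mul, le_div_iff₀ hr']
    linarith
  have h1 : 1 + q ≤ Real.exp (1 / (r - 1) * z) := by
    rw [← Real.exp_log (by linarith : 0 < 1 + q)]
    exact Real.exp_le_exp.2 hlog
  have h2 : |Real.log (4 / c)| + 1 ≤ (Γ - 1 / (r - 1)) * z := by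
    have h0 : 0 ≤ |Real.log (4 / c)| := abs_nonneg _
    nlinarith
  calc 4 * (1 + q) * Real.exp (-(Γ * z))
      ≤ 4 * Real.exp (1 / (r - 1) * z) * Real.exp (-(Γ * z)) := by gcongr
    _ = 4 * Real.exp (-((Γ - 1 / (r - 1)) * z)) := by
        rw [mul_assoc, ← Real.exp_add]; congr 2; ring
    _ ≤ 4 * Real.exp (-(|Real.log (4 / c)| + 1)) := by gcongr
    _ < 4 * Real.exp (-Real.log (4 / c)) := by
        have := le_abs_self (Real.log (4 / c))
        gcongr
        linarith
    _ = c := by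
        rw [Real.exp_neg, Real.exp_log (by positivity)]
        field_simp

/-- With probability close to one the greedy phase ends with imbalance below `c`, provided the
number of extreme subjects is a large multiple of `√n`. -/
theorem exists_greedyPhase {μ : Measure ℝ} [IsProbabilityMeasure μ]
    [NullSingletonClass μ] (hμ : MemLp id 2 μ) {B r : ℝ} (hr : 1 < r) (hB : 0 ≤ B)
    (hdensH : ∀ ζ a b, 0 ≤ ζ → ζ ≤ a → a ≤ b →
      μ.real (Set.Ioc a b) ≤ B * (1 + ζ) ^ (-r) * (b - a))
    (hdensL : ∀ ζ a b, 0 ≤ ζ → ζ ≤ a → a ≤ b →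
      (μ.map Neg.neg).real (Set.Ioc a b) ≤ B * (1 + ζ) ^ (-r) * (b - a))
    {a₁ a₂ : ℝ} (ha : a₁ < a₂) (h₁ : 0 < μ.real (Set.Iio a₁)) (h₂ : 0 < μ.real (Set.Ioi a₂))
    {c : ℝ} (hc : 0 < c) {ε : ℝ} (hε : 0 < ε) :
    ∃ b : ℝ, 0 < b ∧ ∃ N : ℕ, ∀ n : ℕ, N ≤ n → ∀ w₀ : Allocation n, IsBalanced w₀ →
      (Measure.pi fun _ : Fin (2 * n) => μ).real {x |
        ¬ ((∀ v, IsStop (diffSum x) (extremes x ⌊b * Real.sqrt n⌋₊) c w₀ v →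
            |diffSum x v| < c) ∧
          n * μ.real (Set.Iio a₁) ≤ (Finset.univ.filter fun i => x i < a₁).card ∧
          n * μ.real (Set.Ioi a₂) ≤ (Finset.univ.filter fun i => a₂ < x i).card)} ≤ ε ∧
      (⌊b * Real.sqrt n⌋₊ : ℝ) ≤ n * μ.real (Set.Iio a₁) ∧
      (⌊b * Real.sqrt n⌋₊ : ℝ) ≤ n * μ.real (Set.Ioi a₂) := by
  set P₁ := μ.real (Set.Iio a₁) with hP₁
  set P₂ := μ.real (Set.Ioi a₂) with hP₂
  set σ := ∫ x, x ^ 2 ∂μ with hσ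
  have hσ0 : 0 ≤ σ := integral_nonneg fun x => sq_nonneg x
  have hL : 0 < a₂ - a₁ := by linarith
  have hr' : 0 < r - 1 := by linarith
  set C₀ := 2 + 1 / (r - 1) with hC₀
  have hC₀0 : 0 < C₀ := by positivity
  -- `M √n` bounds the initial imbalance up to probability `ε / 8`.
  obtain ⟨M, hM, hM2⟩ : ∃ M : ℝ, 0 < M ∧ 2 * σ / M ^ 2 ≤ ε / 8 := by
    refine ⟨Real.sqrt (16 * σ / ε + 1), Real.sqrt_pos.2 (by positivity), ?_⟩
    rw [Real.sq_sqrt (by positivity), div_le_iff₀ (by positivity)]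
    have : ε / 8 * (16 * σ / ε + 1) = 2 * σ + ε / 8 := by field_simp; ring
    linarith
  -- The bins will have mass `lam / n`; `320 * exp (-lam)` covers both groups in both tails.
  obtain ⟨lam, hlam, hlam2⟩ : ∃ lam : ℝ, 1 ≤ lam ∧ 320 * Real.exp (-lam) ≤ ε / 8 := by
    refine ⟨1 + |Real.log (ε / 2560)|, by linarith [abs_nonneg (Real.log (ε / 2560))], ?_⟩
    have h1 : Real.exp (-(1 + |Real.log (ε / 2560)|)) ≤ Real.exp (Real.log (ε / 2560)) := by
      apply Real.exp_le_exp.2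
      linarith [neg_abs_le (Real.log (ε / 2560))]
    rw [Real.exp_log (by positivity)] at h1
    linarith
  have hlam0 : 0 < lam := by linarith
  set Γ := 1 / (r - 1) + |Real.log (4 / c)| + 1 with hΓ
  have hΓ0 : 0 < Γ := by positivity
  -- There will be `u ≈ a √n`. The second term keeps the number `k₁` of constant decreases near or
  -- below `a √n / 160`; the third makes `k₂ ≈ a √n / 80` contractions sufficient.
  set a := 1 + 80 * M / (a₂ - a₁) + 1600 * (B + 1) * C₀ * Γ with hadef
  have ha1 : 1 ≤ a := by
    have : 0 ≤ 80 * M / (a₂ - a₁) + 1600 * (B + 1) * C₀ * Γ := by positivity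
    linarith
  have ha0 : 0 < a := by linarith
  have haM : 80 * M ≤ a * (a₂ - a₁) := by
    rw [← div_le_iff₀ hL]
    have : 0 ≤ 1600 * (B + 1) * C₀ * Γ := by positivity
    linarith
  have haΓ : 1600 * (B + 1) * C₀ * Γ ≤ a := by
    have : 0 ≤ 80 * M / (a₂ - a₁) := by positivity
    linarith
  -- With `ρ₁ = ρ₀ / √n` the density term of `hnum` is at most `a √n / 20`, well below `7 u / 10`.
  set ρ₀ := a * lam / (20 * (B + 1) * C₀) with hρ₀
  have hρ₀0 : 0 < ρ₀ := by positivity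
  have hρΓ : Γ ≤ ρ₀ * (a / 80) := by
    have h1 : ρ₀ * (a / 80) = a * a * lam / (1600 * (B + 1) * C₀) := by
      rw [hρ₀]; field_simp; ring
    rw [h1, le_div_iff₀ (by positivity)]
    calc Γ * (1600 * (B + 1) * C₀) = 1600 * (B + 1) * C₀ * Γ := by ring
      _ ≤ a * 1 * 1 := by linarith
      _ ≤ a * a * lam := by gcongr
  -- The expected number of subjects beyond the innermost quantile is at most `10 a lam √n` in each
  -- tail; by Markov's inequality this `b` makes all of them extreme up to probability `ε / 4`.
  set b := 160 * lam * a / ε with hb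
  have hb0 : 0 < b := by positivity
  refine ⟨b, hb0, ?_⟩
  have hy : Tendsto (fun n : ℕ => Real.sqrt n) atTop atTop :=
    Real.tendsto_sqrt_atTop.comp tendsto_natCast_atTop_atTop
  clear_value a ρ₀ C₀
  have key : ∀ᶠ n : ℕ in atTop, ∀ w₀ : Allocation n, IsBalanced w₀ →
      (Measure.pi fun _ : Fin (2 * n) => μ).real {x |
        ¬ ((∀ v, IsStop (diffSum x) (extremes x ⌊b * Real.sqrt n⌋₊) c w₀ v →
            |diffSum x v| < c) ∧
          n * P₁ ≤ (Finset.univ.filter fun i => x i < a₁).card ∧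
          n * P₂ ≤ (Finset.univ.filter fun i => a₂ < x i).card)} ≤ ε ∧
      (⌊b * Real.sqrt n⌋₊ : ℝ) ≤ n * P₁ ∧ (⌊b * Real.sqrt n⌋₊ : ℝ) ≤ n * P₂ := by
    filter_upwards [hy.eventually_ge_atTop 1, hy.eventually_ge_atTop (400 / a),
      hy.eventually_gt_atTop (5 * a * lam / 1), hy.eventually_gt_atTop (5 * a * lam / P₁),
      hy.eventually_gt_atTop (5 * a * lam / P₂),
      hy.eventually_ge_atTop (σ * 10000 / (a ^ 3 * lam * c ^ 2)),
      hy.eventually_ge_atTop (b / P₁), hy.eventually_ge_atTop (b / P₂),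
      hy.eventually_ge_atTop (2 / b), hy.eventually_ge_atTop (16 / (ε * P₁ ^ 2)),
      hy.eventually_ge_atTop (16 / (ε * P₂ ^ 2))]
      with n y1 y2 y3 y4 y5 y6 y7 y8 y9 y10 y11 w₀ hw₀
    set y := Real.sqrt n with hydef
    have hn : (n : ℝ) = y ^ 2 := by rw [hydef, Real.sq_sqrt (Nat.cast_nonneg n)]
    have hy0 : 0 < y := by linarith only [y1]
    have hyn : y ≤ n := by rw [hn]; exact le_self_pow₀ y1 two_ne_zero
    have hn0 : (0 : ℝ) < n := hy0.trans_le hyn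
    rw [div_le_iff₀ ha0] at y2
    rw [div_lt_iff₀ (by positivity)] at y3 y4 y5
    rw [div_le_iff₀ (by positivity)] at y6 y7 y8 y9 y10 y11
    set u := ⌊a * y⌋₊ with hu
    set m := ⌊b * y⌋₊ with hm
    set k₁ := ⌈M * y / (2 * (a₂ - a₁))⌉₊ with hk₁
    set k₂ := ⌈a * y / 80⌉₊ with hk₂
    have hu1 : (u : ℝ) ≤ a * y := Nat.floor_le (by positivity)
    have hu2 : a * y < u + 1 := Nat.lt_floor_add_one _
    have hm1 : (m : ℝ) ≤ b * y := Nat.floor_le (by positivity)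
    have hm2 : b * y < m + 1 := Nat.lt_floor_add_one _
    have hm3 : b * y / 2 ≤ m := by linarith only [hm2, y9]
    have hk₁1 : (k₁ : ℝ) < M * y / (2 * (a₂ - a₁)) + 1 := Nat.ceil_lt_add_one (by positivity)
    have hk₁2 : M * y / (2 * (a₂ - a₁)) ≤ k₁ := Nat.le_ceil _
    have hk₂1 : (k₂ : ℝ) < a * y / 80 + 1 := Nat.ceil_lt_add_one (by positivity)
    have hk₂2 : a * y / 80 ≤ k₂ := Nat.le_ceil _
    have hupos : 0 < u := by
      have : (0 : ℝ) < u := by linarith only [hu2, y2]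
      exact_mod_cast this
    have hmpos : 0 < m := by
      have : (0 : ℝ) < m := lt_of_lt_of_le (by positivity) hm3
      exact_mod_cast this
    have hp0 : 0 < lam / n := by positivity
    have hlev : (4 * u + 1) * (lam / n) ≤ 5 * a * lam / y := by
      rw [hn, ← mul_div_assoc, div_le_div_iff₀ (by positivity) hy0]
      have h1 : (4 * (u : ℝ) + 1) ≤ 5 * (a * y) := by linarith only [hu1, y2]
      calc (4 * (u : ℝ) + 1) * lam * y ≤ 5 * (a * y) * lam * y := by gcongr
        _ = _ := by ring
    have hsmall : ∀ P : ℝ, 5 * a * lam < y * P → (4 * u + 1) * (lam / n) < P := by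
      intro P hP
      refine hlev.trans_lt ?_
      rw [div_lt_iff₀ hy0]
      linarith only [hP]
    have hm' : ∀ P : ℝ, 0 < P → b ≤ y * P → (m : ℝ) ≤ n * P := by
      intro P _ hP
      refine hm1.trans ?_
      rw [hn]
      calc b * y ≤ y * P * y := by gcongr
        _ = _ := by ring
    refine ⟨?_, hm' P₁ h₁ y7, hm' P₂ h₂ y8⟩
    have hmain := measureReal_greedyPhase_fails_le hμ hr hB hdensH hdensL ha hc (n := n) (u := u)
      (m := m) (k₁ := k₁) (k₂ := k₂) (p := lam / n) (T := a * c * y / 100) (A := M * y)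
      (ρ₁ := ρ₀ / y) hupos hmpos (by exact_mod_cast hn0) hp0 (hsmall 1 y3)
      (hsmall _ y4) (hsmall _ y5) (by positivity) ?_ (by positivity) (by positivity) ?_ ?_ ?_ ?_ hw₀
    · refine hmain.trans ?_
      have t1 : 2 * n * σ / (M * y) ^ 2 ≤ ε / 8 := by
        refine le_trans (le_of_eq ?_) hM2
        rw [hn]; field_simp
      have t2 : 320 * (1 - lam / n) ^ n ≤ ε / 8 := by
        refine le_trans ?_ hlam2
        have := Real.one_sub_div_pow_le_exp_neg (n := n) (t := lam) (by
          have h3 : 5 * lam * 1 ≤ 5 * lam * a := by gcongr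
          linarith only [h3, hyn, y3, hlam0])
        linarith only [this]
      have t3 : 4 * n * ((4 * u + 1) * (lam / n)) / m ≤ ε / 4 := by
        have h1 : 4 * n * ((4 * u + 1) * (lam / n)) = 4 * lam * (4 * u + 1) := by
          field_simp
        rw [h1, div_le_iff₀ (by exact_mod_cast hmpos)]
        have h2 : 4 * (u : ℝ) + 1 ≤ 5 * (a * y) := by linarith only [hu1, y2]
        calc 4 * lam * (4 * u + 1) ≤ 4 * lam * (5 * (a * y)) := by gcongr
          _ = ε / 4 * (b * y / 2) := by rw [hb]; field_simp; ring
          _ ≤ _ := by gcongr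
      have t4 : ∀ P : ℝ, 0 < P → 16 ≤ y * (ε * P ^ 2) → 2 / (n * P ^ 2) ≤ ε / 8 := by
        intro P hP h
        rw [div_le_iff₀ (by positivity)]
        have h5 : y * (ε * P ^ 2) ≤ n * (ε * P ^ 2) := by gcongr
        linarith only [h, h5]
      have t5 := t4 P₁ h₁ y10
      have t6 := t4 P₂ h₂ y11
      rw [← hσ, ← hP₁, ← hP₂]
      exact (add_le_add (add_le_add (add_le_add t1 t2) t3) (add_le_add t5 t6)).trans
        (by linarith only [hε])
    · calc σ ≤ y * (a ^ 3 * lam * c ^ 2) / 10000 := by linarith only [y6]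
        _ = (a * y) * (lam / n) * (a * c * y / 100) ^ 2 := by rw [hn]; field_simp; ring
        _ ≤ (u + 1) * (lam / n) * (a * c * y / 100) ^ 2 := by gcongr
    · have h1 : B * (ρ₀ / y) / (lam / n) * C₀ = a * y / 20 * (B / (B + 1)) := by
        rw [hρ₀, hn]; field_simp
      have h2 : B / (B + 1) ≤ 1 := by rw [div_le_one (by linarith only [hB])]; linarith only
      have h3 : a * y / 20 * (B / (B + 1)) ≤ a * y / 20 * 1 := by gcongr
      have h4 : 3 * (2 * (a * c * y / 100) / c + 1) = 6 / 100 * (a * y) + 3 := by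
        field_simp
        ring
      rw [h4, ← hC₀, h1]
      linarith only [h3, hu2, y2]
    · calc M * y = 2 * (a₂ - a₁) * (M * y / (2 * (a₂ - a₁))) := by field_simp
        _ ≤ _ := by gcongr
    · have h1 : M * y / (2 * (a₂ - a₁)) ≤ a * y / 160 := by
        rw [div_le_div_iff₀ (by positivity) (by norm_num)]
        linarith only [mul_le_mul_of_nonneg_right haM hy0.le]
      linarith only [h1, hk₁1, hk₂1, hu2, y2]
    · intro q hq
      refine lt_of_le_of_lt ?_ (mul_exp_neg_rpow_lt hr hc (Γ := Γ) le_rfl hq)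
      have h1 : Γ ≤ ρ₀ / y * k₂ := by
        calc Γ ≤ ρ₀ * (a / 80) := hρΓ
          _ = ρ₀ / y * (a * y / 80) := by field_simp
          _ ≤ _ := by gcongr
      have h2 : 0 ≤ (1 + q) ^ (r - 1) := Real.rpow_nonneg (by linarith only [hq]) _
      have h3 : Γ * (1 + q) ^ (r - 1) ≤ ρ₀ / y * (1 + q) ^ (r - 1) * k₂ := by
        calc Γ * (1 + q) ^ (r - 1) ≤ ρ₀ / y * k₂ * (1 + q) ^ (r - 1) := by gcongr
          _ = _ := by ring
      gcongr
  exact eventually_atTop.1 key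

/-! ### Translates of product densities -/

/-- A finite power of a measure with integrable density has the product density. -/
theorem pi_withDensity_ofReal {ι : Type*} [Fintype ι] {g : ℝ → ℝ} (hg : Integrable g)
    (hg0 : ∀ x, 0 ≤ g x) :
    (Measure.pi fun _ : ι => (volume : Measure ℝ).withDensity fun x => ENNReal.ofReal (g x)) =
      (volume : Measure (ι → ℝ)).withDensity fun x => ENNReal.ofReal (∏ i, g (x i)) := by
  have : IsFiniteMeasure ((volume : Measure ℝ).withDensity fun x => ENNReal.ofReal (g x)) :=
    isFiniteMeasure_withDensity_ofReal hg.2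
  refine Measure.pi_eq fun s hs => ?_
  rw [withDensity_apply _ (MeasurableSet.univ_pi hs), volume_pi, Measure.restrict_pi_pi]
  have hint : ∀ i, Integrable g (volume.restrict (s i)) := fun i => hg.restrict
  rw [← ofReal_integral_eq_lintegral_ofReal
      (Integrable.fintype_prod (f := fun _ => g) hint)
      (Eventually.of_forall fun x => Finset.prod_nonneg fun i _ => hg0 _),
    integral_fintype_prod_eq_prod (fun _ => g),
    ENNReal.ofReal_prod_of_nonneg fun i _ => integral_nonneg fun x => hg0 x]
  refine Finset.prod_congr rfl fun i _ => ?_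
  rw [withDensity_apply _ (hs i), ofReal_integral_eq_lintegral_ofReal (hint i)
    (Eventually.of_forall hg0)]

theorem one_sub_sum_le_prod_one_sub_of_mem {ι : Type*} (s : Finset ι) {β : ι → ℝ}
    (h0 : ∀ i ∈ s, 0 ≤ β i) (h1 : ∀ i ∈ s, β i ≤ 1) :
    1 - ∑ i ∈ s, β i ≤ ∏ i ∈ s, (1 - β i) := by
  classical
  induction s using Finset.induction_on with
  | empty => simp
  | insert a s ha ih =>
    rw [Finset.sum_insert ha, Finset.prod_insert ha]
    have ih' := ih (fun i hi => h0 i (Finset.mem_insert_of_mem hi))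
      (fun i hi => h1 i (Finset.mem_insert_of_mem hi))
    have ha0 := h0 a (Finset.mem_insert_self _ _)
    have ha1 := h1 a (Finset.mem_insert_self _ _)
    have hs : 0 ≤ ∑ i ∈ s, β i := Finset.sum_nonneg fun i hi => h0 i (Finset.mem_insert_of_mem hi)
    nlinarith [mul_le_mul_of_nonneg_left ih' (sub_nonneg.2 ha1)]

theorem measureReal_withDensity_ofReal {E : Type*} [MeasurableSpace E] {ρ : Measure E} {g : E → ℝ}
    (hg : Integrable g ρ) (hg0 : ∀ x, 0 ≤ g x) {s : Set E} (hs : MeasurableSet s) :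
    (ρ.withDensity fun x => ENNReal.ofReal (g x)).real s = ∫ x in s, g x ∂ρ := by
  rw [measureReal_def, withDensity_apply _ hs, ← ofReal_integral_eq_lintegral_ofReal hg.restrict
    (Eventually.of_forall hg0), ENNReal.toReal_ofReal (integral_nonneg hg0)]

/-- Translating a power of the law with density `φ ^ 2` changes probabilities by little: a form of
the bound of the total variation distance by the Hellinger distance. -/
theorem measureReal_pi_translate_le {ι : Type*} [Fintype ι] {φ : ℝ → ℝ} (hφc : Continuous φ)
    (hφs : HasCompactSupport φ) (hφ0 : ∀ x, 0 ≤ φ x) (hφ1 : ∫ x, φ x ^ 2 = 1) {Q : ℝ}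
    (hQ : ∀ s, ∫ x, (φ (x - s) - φ x) ^ 2 ≤ Q * s ^ 2) (a : ι → ℝ) {B : Set (ι → ℝ)}
    (hB : MeasurableSet B) {η : ℝ} (hη : 0 < η) :
    (Measure.pi fun _ : ι => (volume : Measure ℝ).withDensity fun x =>
        ENNReal.ofReal (φ x ^ 2)).real {x | x + a ∈ B} ≤
      (Measure.pi fun _ : ι => (volume : Measure ℝ).withDensity fun x =>
        ENNReal.ofReal (φ x ^ 2)).real B + Q * (∑ i, a i ^ 2) / (2 * η) + 2 * η := by
  have hcs : ∀ s, Continuous fun x => φ (x - s) := fun s => by fun_prop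
  have hss : ∀ s, HasCompactSupport fun x => φ (x - s) := fun s =>
    hφs.comp_homeomorph (Homeomorph.subRight s)
  have hint2 : ∀ s s', Integrable fun x => φ (x - s) * φ (x - s') := fun s s' =>
    ((hcs s).mul (hcs s')).integrable_of_hasCompactSupport ((hss s).mul_right)
  have hsq : Integrable fun x => φ x ^ 2 := by
    have := hint2 0 0
    simpa [sq] using this
  have hsqs : ∀ s, Integrable fun x => φ (x - s) ^ 2 := fun s => hsq.comp_sub_right s
  have hsqi : ∀ s, ∫ x, φ (x - s) ^ 2 = 1 := fun s => by
    rw [integral_sub_right_eq_self (fun x => φ x ^ 2) s, hφ1]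
  set Φ : (ι → ℝ) → ℝ := fun x => ∏ i, φ (x i) with hΦ
  set Ψ : (ι → ℝ) → ℝ := fun x => ∏ i, φ (x i - a i) with hΨ
  have hΦi : Integrable fun x => Φ x ^ 2 := by
    simp only [hΦ, ← Finset.prod_pow]
    exact Integrable.fintype_prod (f := fun _ x => φ x ^ 2) fun _ => hsq
  have hΨi : Integrable fun x => Ψ x ^ 2 := by
    simp only [hΨ, ← Finset.prod_pow]
    exact Integrable.fintype_prod (f := fun i x => φ (x - a i) ^ 2) fun i => hsqs (a i)
  have hΦΨi : Integrable fun x => Ψ x * Φ x := by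
    simp only [hΨ, hΦ, ← Finset.prod_mul_distrib]
    refine Integrable.fintype_prod (f := fun i x => φ (x - a i) * φ x) fun i => ?_
    simpa using hint2 (a i) 0
  have hΦ1 : ∫ x, Φ x ^ 2 = 1 := by
    simp only [hΦ, ← Finset.prod_pow]
    rw [integral_fintype_prod_volume_eq_prod (fun _ x => φ x ^ 2)]
    simp [hφ1]
  have hΨ1 : ∫ x, Ψ x ^ 2 = 1 := by
    simp only [hΨ, ← Finset.prod_pow]
    rw [integral_fintype_prod_volume_eq_prod (fun i x => φ (x - a i) ^ 2)]
    simp [hsqi]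
  set β : ι → ℝ := fun i => (∫ x, (φ (x - a i) - φ x) ^ 2) / 2 with hβ
  have hβe : ∀ i, ∫ x, φ (x - a i) * φ x = 1 - β i := by
    intro i
    have h1 : ∫ x, (φ (x - a i) - φ x) ^ 2 =
        (∫ x, φ (x - a i) ^ 2) - 2 * (∫ x, φ (x - a i) * φ x) + ∫ x, φ x ^ 2 := by
      rw [← integral_const_mul, ← integral_sub (hsqs _) (((by simpa using hint2 (a i) 0 :
        Integrable fun x => φ (x - a i) * φ x)).const_mul 2), ← integral_add _ hsq]
      · refine integral_congr_ae (Eventually.of_forall fun x => ?_)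
        simp only
        ring
      · exact (hsqs _).sub (((by simpa using hint2 (a i) 0 :
          Integrable fun x => φ (x - a i) * φ x)).const_mul 2)
    rw [hsqi, hφ1] at h1
    simp only [hβ]
    linarith
  have hβ0 : ∀ i ∈ Finset.univ, 0 ≤ β i := fun i _ =>
    div_nonneg (integral_nonneg fun x => sq_nonneg _) (by norm_num)
  have hβ1 : ∀ i ∈ Finset.univ, β i ≤ 1 := fun i _ => by
    have : 0 ≤ ∫ x, φ (x - a i) * φ x := integral_nonneg fun x => mul_nonneg (hφ0 _) (hφ0 _)
    rw [hβe] at this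
    linarith
  -- The affinity of product densities is the product of the affinities `1 - β i`.
  have hcross : 1 - ∑ i, β i ≤ ∫ x, Ψ x * Φ x := by
    simp only [hΨ, hΦ, ← Finset.prod_mul_distrib]
    rw [integral_fintype_prod_volume_eq_prod (fun i x => φ (x - a i) * φ x)]
    simp_rw [hβe]
    exact one_sub_sum_le_prod_one_sub_of_mem _ hβ0 hβ1
  have hβQ : 2 * ∑ i, β i ≤ Q * ∑ i, a i ^ 2 := by
    rw [Finset.mul_sum, Finset.mul_sum]
    refine Finset.sum_le_sum fun i _ => ?_
    simp only [hβ]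
    linarith [hQ (a i)]
  -- Cauchy–Schwarz replaced by a pointwise inequality with parameter `η`: `(Ψ - Φ) (Ψ + Φ) ≤ (Ψ -
  -- Φ) ^ 2 / (2 η) + η (Ψ + Φ) ^ 2 / 2`, together with `(Ψ + Φ) ^ 2 ≤ 2 Ψ ^ 2 + 2 Φ ^ 2`.
  have hpw : ∀ x, Ψ x ^ 2 - Φ x ^ 2 ≤ (1 / (2 * η) + η) * Ψ x ^ 2 + (1 / (2 * η) + η) * Φ x ^ 2 -
      1 / η * (Ψ x * Φ x) := by
    intro x
    have h1 : 0 ≤ (Ψ x - Φ x - η * (Ψ x + Φ x)) ^ 2 / (2 * η) := by positivity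
    have h2 : (Ψ x - Φ x - η * (Ψ x + Φ x)) ^ 2 / (2 * η) =
        1 / (2 * η) * (Ψ x ^ 2 + Φ x ^ 2) - 1 / η * (Ψ x * Φ x) - (Ψ x ^ 2 - Φ x ^ 2) +
          η / 2 * (Ψ x + Φ x) ^ 2 := by
      field_simp
      ring
    nlinarith [sq_nonneg (Ψ x - Φ x)]
  have hdens := pi_withDensity_ofReal (ι := ι) hsq (fun x => sq_nonneg _)
  have hreal : ∀ s, MeasurableSet s → (Measure.pi fun _ : ι =>
      (volume : Measure ℝ).withDensity fun x => ENNReal.ofReal (φ x ^ 2)).real s =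
      ∫ x in s, Φ x ^ 2 := by
    intro s hs
    rw [hdens]
    have h1 : ∀ x : ι → ℝ, ∏ i, φ (x i) ^ 2 = Φ x ^ 2 := fun x => Finset.prod_pow _ _ _
    simp_rw [h1]
    exact measureReal_withDensity_ofReal hΦi (fun x => sq_nonneg _) hs
  have hBa : MeasurableSet {x | x + a ∈ B} := (measurable_add_const a) hB
  rw [hreal _ hBa, hreal _ hB]
  have htrans : ∫ x in {x | x + a ∈ B}, Φ x ^ 2 = ∫ x in B, Ψ x ^ 2 := by
    rw [← integral_indicator hBa, ← integral_indicator hB,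
      ← integral_add_right_eq_self (B.indicator fun x => Ψ x ^ 2) a]
    refine integral_congr_ae (Eventually.of_forall fun x => ?_)
    by_cases hx : x + a ∈ B
    · simp [Set.indicator, hx, hΦ, hΨ]
    · simp [Set.indicator, hx]
  rw [htrans]
  have h1 : ∫ x in B, (Ψ x ^ 2 - Φ x ^ 2) ≤ ∫ x, ((1 / (2 * η) + η) * Ψ x ^ 2 +
      (1 / (2 * η) + η) * Φ x ^ 2 - 1 / η * (Ψ x * Φ x)) := by
    have hI : Integrable fun x => ((1 / (2 * η) + η) * Ψ x ^ 2 +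
      (1 / (2 * η) + η) * Φ x ^ 2 - 1 / η * (Ψ x * Φ x)) :=
      ((hΨi.const_mul _).add (hΦi.const_mul _)).sub (hΦΨi.const_mul _)
    have hnn : ∀ x, 0 ≤ ((1 / (2 * η) + η) * Ψ x ^ 2 +
      (1 / (2 * η) + η) * Φ x ^ 2 - 1 / η * (Ψ x * Φ x)) := by
      intro x
      have : ((1 / (2 * η) + η) * Ψ x ^ 2 + (1 / (2 * η) + η) * Φ x ^ 2 - 1 / η * (Ψ x * Φ x)) =
        (Ψ x - Φ x) ^ 2 / (2 * η) + η * Ψ x ^ 2 + η * Φ x ^ 2 := by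
        field_simp
        ring
      rw [this]
      positivity
    refine (setIntegral_mono (hΨi.sub hΦi).integrableOn hI.integrableOn hpw).trans ?_
    exact setIntegral_le_integral hI (Eventually.of_forall hnn)
  have hsum : Integrable fun x => (1 / (2 * η) + η) * Ψ x ^ 2 + (1 / (2 * η) + η) * Φ x ^ 2 :=
    (hΨi.const_mul _).add (hΦi.const_mul _)
  rw [integral_sub hΨi.integrableOn hΦi.integrableOn, integral_sub hsum (hΦΨi.const_mul _),
    integral_add (hΨi.const_mul _) (hΦi.const_mul _),
    integral_const_mul, integral_const_mul, integral_const_mul, hΦ1, hΨ1] at h1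
  have h2 : 1 / η * (1 - ∑ i, β i) ≤ 1 / η * ∫ x, Ψ x * Φ x := by gcongr
  have h3 : (2 * ∑ i, β i) / (2 * η) ≤ Q * (∑ i, a i ^ 2) / (2 * η) := by gcongr
  have h4 : (1 / (2 * η) + η) * 1 + (1 / (2 * η) + η) * 1 - 1 / η * (1 - ∑ i, β i) =
      (2 * ∑ i, β i) / (2 * η) + 2 * η := by
    field_simp
    ring
  linarith

/-- A normalized Lipschitz bump on a given interval. -/
theorem exists_bump (x₀ : ℝ) {l : ℝ} (hl : 0 < l) : ∃ φ : ℝ → ℝ, Continuous φ ∧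
    HasCompactSupport φ ∧ (∀ x, 0 ≤ φ x) ∧ (∫ x, φ x ^ 2 = 1) ∧
    (∀ x, x ∉ Set.Icc (x₀ - l) (x₀ + l) → φ x = 0) ∧ (∃ M, 0 < M ∧ ∀ x, φ x ^ 2 ≤ M) ∧
    ∃ Q, 0 ≤ Q ∧ ∀ s, ∫ x, (φ (x - s) - φ x) ^ 2 ≤ Q * s ^ 2 := by
  set ψ : ℝ → ℝ := fun x => max 0 (l - |x - x₀|) with hψ
  have hψc : Continuous ψ := by fun_prop
  have hψ0 : ∀ x, 0 ≤ ψ x := fun x => le_max_left _ _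
  have hψl : ∀ x, ψ x ≤ l := fun x => max_le hl.le (by linarith [abs_nonneg (x - x₀)])
  have hψs : ∀ x, x ∉ Set.Icc (x₀ - l) (x₀ + l) → ψ x = 0 := by
    intro x hx
    refine max_eq_left ?_
    by_contra! h
    refine hx ?_
    have h1 : |x - x₀| < l := by linarith
    rw [abs_lt] at h1
    constructor <;> linarith [h1.1, h1.2]
  have hψlip : ∀ x y, |ψ x - ψ y| ≤ |x - y| := by
    intro x y
    have h1 : |ψ x - ψ y| ≤ |(l - |x - x₀|) - (l - |y - x₀|)| := by
      simp only [hψ, max_comm (0 : ℝ)]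
      exact abs_max_sub_max_le_abs _ _ 0
    refine h1.trans ?_
    have h2 : (l - |x - x₀|) - (l - |y - x₀|) = |y - x₀| - |x - x₀| := by ring
    rw [h2]
    refine (abs_abs_sub_abs_le _ _).trans (le_of_eq ?_)
    rw [abs_sub_comm]
    congr 1
    ring
  have hsqc : Continuous fun x => ψ x ^ 2 := by fun_prop
  have hsqs : HasCompactSupport fun x => ψ x ^ 2 := by
    exact HasCompactSupport.intro
      (isCompact_Icc (a := x₀ - l) (b := x₀ + l)) fun x hx => by simp [hψs x hx]
  have hsqi : Integrable fun x => ψ x ^ 2 := hsqc.integrable_of_hasCompactSupport hsqs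
  set Z := ∫ x, ψ x ^ 2 with hZ
  have hZ0 : 0 < Z := by
    refine hsqc.integral_pos_of_hasCompactSupport_nonneg_nonzero hsqs (fun x => sq_nonneg _)
      (x := x₀) ?_
    simp [hψ, hl.ne', hl.le]
  have hsZ : Real.sqrt Z ^ 2 = Z := Real.sq_sqrt hZ0.le
  refine ⟨fun x => ψ x / Real.sqrt Z, by fun_prop, ?_, fun x => div_nonneg (hψ0 x) (Real.sqrt_nonneg _),
    ?_,    fun x hx => by simp [hψs x hx], ⟨l ^ 2 / Z, by positivity, fun x => ?_⟩,
    4 * l / Z, by positivity, fun s => ?_⟩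
  · exact HasCompactSupport.intro
      (isCompact_Icc (a := x₀ - l) (b := x₀ + l)) fun x hx => by simp [hψs x hx]
  · simp only [div_pow, hsZ]
    rw [integral_div, ← hZ, div_self hZ0.ne']
  · rw [div_pow, hsZ]
    have := hψ0 x
    have := hψl x
    gcongr
  · set K := Set.Icc (x₀ - l) (x₀ + l) with hK
    set K' := Set.Icc (x₀ - l + s) (x₀ + l + s) with hK'
    -- The tent `ψ` is 1-Lipschitz, and the difference vanishes off two intervals of length `2 * l`;
    -- hence the constant `4 * l / Z`.
    have hb : ∀ x, (ψ (x - s) / Real.sqrt Z - ψ x / Real.sqrt Z) ^ 2 ≤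
        K.indicator (fun _ => s ^ 2 / Z) x + K'.indicator (fun _ => s ^ 2 / Z) x := by
      intro x
      have hnn : 0 ≤ s ^ 2 / Z := by positivity
      have h0 : ∀ (S : Set ℝ), 0 ≤ S.indicator (fun _ => s ^ 2 / Z) x := fun S =>
        Set.indicator_nonneg (fun _ _ => hnn) x
      rw [← sub_div, div_pow, hsZ]
      have h1 : (ψ (x - s) - ψ x) ^ 2 ≤ s ^ 2 := by
        rw [← sq_abs, ← sq_abs s]
        have := hψlip (x - s) x
        rw [show x - s - x = -s by ring, abs_neg] at this
        gcongr
      by_cases hx : x ∈ K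
      · have h2 : K.indicator (fun _ => s ^ 2 / Z) x = s ^ 2 / Z := Set.indicator_of_mem hx _
        rw [h2]
        have := h0 K'
        have h3 : (ψ (x - s) - ψ x) ^ 2 / Z ≤ s ^ 2 / Z := by gcongr
        linarith
      by_cases hx' : x ∈ K'
      · have h2 : K'.indicator (fun _ => s ^ 2 / Z) x = s ^ 2 / Z := Set.indicator_of_mem hx' _
        rw [h2]
        have := h0 K
        have h3 : (ψ (x - s) - ψ x) ^ 2 / Z ≤ s ^ 2 / Z := by gcongr
        linarith
      have h3 : ψ (x - s) = 0 := hψs _ fun h => hx' ⟨by linarith [h.1], by linarith [h.2]⟩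
      rw [h3, hψs x hx]
      have := h0 K
      have := h0 K'
      simp only [sub_self, ne_eq, OfNat.ofNat_ne_zero, not_false_eq_true, zero_pow, zero_div]
      linarith
    have hiK : Integrable (K.indicator fun _ => s ^ 2 / Z) :=
      (integrable_indicator_iff measurableSet_Icc).2 (integrableOn_const (by simp))
    have hiK' : Integrable (K'.indicator fun _ => s ^ 2 / Z) :=
      (integrable_indicator_iff measurableSet_Icc).2 (integrableOn_const (by simp))
    refine (integral_mono_of_nonneg (Eventually.of_forall fun x => sq_nonneg _) (hiK.add hiK')
      (Eventually.of_forall hb)).trans (le_of_eq ?_)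
    simp only [Pi.add_apply]
    rw [integral_add hiK hiK', integral_indicator measurableSet_Icc,
      integral_indicator measurableSet_Icc, setIntegral_const, setIntegral_const,
      Real.volume_real_Icc_of_le (by linarith), Real.volume_real_Icc_of_le (by linarith)]
    simp only [smul_eq_mul]
    field_simp
    ring

/-! ### Second moment bound for hits by pairs -/

open ProbabilityTheory in
theorem map_pi_eval_pair {ι Ω : Type*} [Fintype ι] [MeasurableSpace Ω] (ν : Measure Ω)
    [IsProbabilityMeasure ν] {i j : ι} (hij : i ≠ j) :
    (Measure.pi fun _ : ι => ν).map (fun y => (y i, y j)) = ν.prod ν := by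
  have hind : iIndepFun (fun i (y : ι → Ω) => y i) (Measure.pi fun _ : ι => ν) :=
    iIndepFun_pi (X := fun _ x => x) fun _ => aemeasurable_id
  have h := (hind.indepFun hij).map_prod_eq_prod_map_map (measurable_pi_apply i).aemeasurable
    (measurable_pi_apply j).aemeasurable
  rw [h]
  congr 1
  · exact (measurePreserving_eval (fun _ : ι => ν) i).map_eq
  · exact (measurePreserving_eval (fun _ : ι => ν) j).map_eq

open ProbabilityTheory in
theorem map_pi_eval_triple {ι Ω : Type*} [Fintype ι] [MeasurableSpace Ω] (ν : Measure Ω)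
    [IsProbabilityMeasure ν] {i j k : ι} (hij : i ≠ j) (hik : i ≠ k) (hjk : j ≠ k) :
    (Measure.pi fun _ : ι => ν).map (fun y => ((y i, y j), y k)) = (ν.prod ν).prod ν := by
  have hind : iIndepFun (fun i (y : ι → Ω) => y i) (Measure.pi fun _ : ι => ν) :=
    iIndepFun_pi (X := fun _ x => x) fun _ => aemeasurable_id
  have h := (hind.indepFun_prodMk (fun i => measurable_pi_apply i) i j k hik
    hjk).map_prod_eq_prod_map_map (by fun_prop) (measurable_pi_apply k).aemeasurable
  rw [h]
  congr 1
  · exact map_pi_eval_pair ν hij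
  · exact (measurePreserving_eval (fun _ : ι => ν) k).map_eq

/-- Given the common coordinate, the two events are independent, each of probability at most `m`.
This serves pairs that share one subject. -/
theorem measureReal_prod_prod_le {Ω : Type*} [MeasurableSpace Ω] (ν : Measure Ω)
    [IsProbabilityMeasure ν] {D : Set (Ω × Ω)} (hD : MeasurableSet D) {m : ℝ} (hm : 0 ≤ m)
    (h : ∀ u, ν.real {v | (v, u) ∈ D} ≤ m) :
    ((ν.prod ν).prod ν).real {q | (q.1.1, q.2) ∈ D ∧ (q.1.2, q.2) ∈ D} ≤ m ^ 2 := by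
  have hmeas : MeasurableSet {q : (Ω × Ω) × Ω | (q.1.1, q.2) ∈ D ∧ (q.1.2, q.2) ∈ D} :=
    ((by fun_prop : Measurable fun q : (Ω × Ω) × Ω => (q.1.1, q.2)) hD).inter
      ((by fun_prop : Measurable fun q : (Ω × Ω) × Ω => (q.1.2, q.2)) hD)
  refine ENNReal.toReal_le_of_le_ofReal (by positivity) ?_
  rw [Measure.prod_apply_symm hmeas]
  have hu : ∀ u, (ν.prod ν) ((fun x => (x, u)) ⁻¹'
      {q : (Ω × Ω) × Ω | (q.1.1, q.2) ∈ D ∧ (q.1.2, q.2) ∈ D}) ≤ ENNReal.ofReal (m ^ 2) := by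
    intro u
    have hset : (fun x => (x, u)) ⁻¹' {q : (Ω × Ω) × Ω | (q.1.1, q.2) ∈ D ∧ (q.1.2, q.2) ∈ D} =
        {v | (v, u) ∈ D} ×ˢ {v | (v, u) ∈ D} := by
      ext x; simp
    have h1 : ν {v | (v, u) ∈ D} ≤ ENNReal.ofReal m := by
      rw [← ofReal_measureReal]
      exact ENNReal.ofReal_le_ofReal (h u)
    rw [hset, Measure.prod_prod, sq, ENNReal.ofReal_mul hm]
    gcongr
  refine (lintegral_mono hu).trans ?_
  simp

open ProbabilityTheory in
/-- Second moment bound for the probability that no pair from `T × C` hits `W`. -/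
theorem measureReal_no_pair_le {ι Ω : Type*} [Fintype ι] [DecidableEq ι] [MeasurableSpace Ω]
    (ν : Measure Ω) [IsProbabilityMeasure ν] {W : Set (Ω × Ω)} (hW : MeasurableSet W)
    {m π₀ : ℝ} (hm : 0 ≤ m) (hπ₀ : 0 < π₀) (hπ : π₀ ≤ (ν.prod ν).real W)
    (hrow : ∀ u, ν.real {v | (u, v) ∈ W} ≤ m) (hcol : ∀ v, ν.real {u | (u, v) ∈ W} ≤ m)
    {T C : Finset ι} (hTC : Disjoint T C) (hT : T.Nonempty) (hC : C.Nonempty) :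
    (Measure.pi fun _ : ι => ν).real {y | ∀ i ∈ T, ∀ j ∈ C, (y i, y j) ∉ W} ≤
      1 / (T.card * C.card * π₀) + (1 / T.card + 1 / C.card) * (m / π₀) ^ 2 := by
  set P := Measure.pi fun _ : ι => ν with hP
  set π := (ν.prod ν).real W with hπdef
  have hπ0 : 0 < π := hπ₀.trans_le hπ
  have hind : iIndepFun (fun i (y : ι → Ω) => y i) P :=
    iIndepFun_pi (X := fun _ x => x) fun _ => aemeasurable_id
  have hne : ∀ {i j}, i ∈ T → j ∈ C → i ≠ j := fun hi hj h =>
    (Finset.disjoint_left.1 hTC) hi (h ▸ hj)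
  set E : ι × ι → Set (ι → Ω) := fun p => {y | (y p.1, y p.2) ∈ W} with hE
  have hEm : ∀ p, MeasurableSet (E p) := fun p =>
    (by fun_prop : Measurable fun y : ι → Ω => (y p.1, y p.2)) hW
  set X : ι × ι → (ι → Ω) → ℝ := fun p => (E p).indicator 1 with hX
  have hXm : ∀ p, MemLp (X p) 2 P := fun p => (memLp_const (1 : ℝ)).indicator (hEm p)
  have hXi : ∀ p ∈ T ×ˢ C, ∫ y, X p y ∂P = π := by
    intro p hp
    rw [Finset.mem_product] at hp
    rw [hX, integral_indicator_one (hEm p), hπdef, ← map_pi_eval_pair ν (hne hp.1 hp.2),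
      map_measureReal_apply (by fun_prop) hW]
    rfl
  -- The product of the means is nonnegative and is dropped.
  have hcov_le : ∀ p ∈ T ×ˢ C, ∀ q ∈ T ×ˢ C, ∀ b, P.real (E p ∩ E q) ≤ b →
      cov[X p, X q; P] ≤ b := by
    intro p hp q hq b hb
    rw [covariance_eq_sub (hXm p) (hXm q), hXi p hp, hXi q hq]
    have h1 : ∫ y, (X p * X q) y ∂P = P.real (E p ∩ E q) := by
      rw [← integral_indicator_one ((hEm p).inter (hEm q))]
      refine integral_congr_ae (Eventually.of_forall fun y => ?_)
      simp only [hX, Pi.mul_apply]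
      by_cases h1 : y ∈ E p <;> by_cases h2 : y ∈ E q <;> simp [h1, h2]
    rw [h1]
    nlinarith
  have hcov : ∀ p ∈ T ×ˢ C, ∀ q ∈ T ×ˢ C, cov[X p, X q; P] ≤
      (if p = q then π else 0) + ((if p.1 = q.1 then m ^ 2 else 0) +
        (if p.2 = q.2 then m ^ 2 else 0)) := by
    intro p hp q hq
    obtain ⟨hp1, hp2⟩ := Finset.mem_product.1 hp
    obtain ⟨hq1, hq2⟩ := Finset.mem_product.1 hq
    by_cases hpq : p = q
    · subst hpq
      refine hcov_le p hp p hp _ ?_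
      rw [Set.inter_self]
      have : P.real (E p) = π := by
        rw [← hXi p hp, hX, integral_indicator_one (hEm p)]
      rw [this]
      simp only [if_true]
      have : 0 ≤ m ^ 2 := sq_nonneg m
      linarith
    by_cases h1 : p.1 = q.1
    · have h2 : p.2 ≠ q.2 := fun h => hpq (Prod.ext h1 h)
      simp only [hpq, h1, h2, if_true, if_false, zero_add, add_zero]
      refine hcov_le p hp q hq _ ?_
      have hD : MeasurableSet {z : Ω × Ω | (z.2, z.1) ∈ W} := measurable_swap hW
      have h3 := measureReal_prod_prod_le ν hD hm hrow
      rw [← map_pi_eval_triple ν h2 (hne hp1 hp2).symm (h1 ▸ (hne hq1 hq2).symm),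
        map_measureReal_apply (by fun_prop)] at h3
      · refine le_trans (le_of_eq ?_) h3
        congr 1
        ext y
        simp [hE, h1]
      · exact ((by fun_prop : Measurable fun q : (Ω × Ω) × Ω => (q.1.1, q.2)) hD).inter
          ((by fun_prop : Measurable fun q : (Ω × Ω) × Ω => (q.1.2, q.2)) hD)
    by_cases h2 : p.2 = q.2
    · simp only [hpq, h1, h2, if_true, if_false, zero_add]
      refine hcov_le p hp q hq _ ?_
      have h3 := measureReal_prod_prod_le ν hW hm hcol
      rw [← map_pi_eval_triple ν h1 (hne hp1 hp2) (h2 ▸ hne hq1 hq2),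
        map_measureReal_apply (by fun_prop)] at h3
      · refine le_trans (le_of_eq ?_) h3
        congr 1
        ext y
        simp [hE, h2]
      · exact ((by fun_prop : Measurable fun q : (Ω × Ω) × Ω => (q.1.1, q.2)) hW).inter
          ((by fun_prop : Measurable fun q : (Ω × Ω) × Ω => (q.1.2, q.2)) hW)
    -- Pairs without a common subject are independent.
    · simp only [hpq, h1, h2, if_false, add_zero]
      have h3 := hind.indepFun_prodMk_prodMk (fun i => measurable_pi_apply i) p.1 p.2 q.1 q.2 h1
        (hne hp1 hq2) (hne hq1 hp2).symm h2
      have h4 : IndepFun (X p) (X q) P := by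
        have hm1 : Measurable (W.indicator (1 : Ω × Ω → ℝ)) := measurable_one.indicator hW
        exact h3.comp hm1 hm1
      exact (h4.covariance_eq_zero (hXm p) (hXm q)).le
  have hT0 : (0 : ℝ) < T.card := by exact_mod_cast hT.card_pos
  have hC0 : (0 : ℝ) < C.card := by exact_mod_cast hC.card_pos
  set N : (ι → Ω) → ℝ := ∑ p ∈ T ×ˢ C, X p with hN
  have hNm : MemLp N 2 P := memLp_finsetSum' _ fun p _ => hXm p
  have hNi : ∫ y, N y ∂P = T.card * C.card * π := by
    simp only [hN, Finset.sum_apply]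
    rw [integral_finsetSum _ fun p _ => (hXm p).integrable one_le_two, Finset.sum_congr rfl hXi,
      Finset.sum_const, Finset.card_product, nsmul_eq_mul]
    push_cast
    ring
  have hvar : Var[N; P] ≤ T.card * C.card * (π + (C.card + T.card) * m ^ 2) := by
    rw [hN, variance_sum' fun p _ => hXm p]
    refine (Finset.sum_le_sum fun p hp => Finset.sum_le_sum fun q hq => hcov p hp q hq).trans ?_
    have hp : ∀ p ∈ T ×ˢ C, ∑ q ∈ T ×ˢ C, ((if p = q then π else 0) +
        ((if p.1 = q.1 then m ^ 2 else 0) + (if p.2 = q.2 then m ^ 2 else 0))) =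
        π + (C.card * m ^ 2 + T.card * m ^ 2) := by
      intro p hp
      obtain ⟨hp1, hp2⟩ := Finset.mem_product.1 hp
      have e1 : ∑ q ∈ T ×ˢ C, (if p.1 = q.1 then m ^ 2 else 0) = C.card * m ^ 2 := by
        rw [Finset.sum_product]
        change ∑ x ∈ T, ∑ _y ∈ C, (if p.1 = x then m ^ 2 else 0) = _
        simp [hp1]
      have e2 : ∑ q ∈ T ×ˢ C, (if p.2 = q.2 then m ^ 2 else 0) = T.card * m ^ 2 := by
        rw [Finset.sum_product_right]
        change ∑ x ∈ C, ∑ _y ∈ T, (if p.2 = x then m ^ 2 else 0) = _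
        simp [hp2]
      rw [Finset.sum_add_distrib, Finset.sum_add_distrib, Finset.sum_ite_eq, if_pos hp, e1, e2]
    rw [Finset.sum_congr rfl hp, Finset.sum_const, Finset.card_product, nsmul_eq_mul]
    push_cast
    exact le_of_eq (by ring)
  have hpos : 0 < T.card * C.card * π := by positivity
  have hcheb := meas_ge_le_variance_div_sq hNm hpos
  rw [hNi] at hcheb
  have hsub : {y : ι → Ω | ∀ i ∈ T, ∀ j ∈ C, (y i, y j) ∉ W} ⊆
      {y | T.card * C.card * π ≤ |N y - T.card * C.card * π|} := by
    intro y hy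
    have : N y = 0 := by
      simp only [hN, Finset.sum_apply]
      refine Finset.sum_eq_zero fun p hp => ?_
      obtain ⟨hp1, hp2⟩ := Finset.mem_product.1 hp
      exact Set.indicator_of_notMem (s := E p) (hy p.1 hp1 p.2 hp2) _
    simp only [Set.mem_ofPred_eq, this, zero_sub, abs_neg]
    exact le_abs_self _
  have hnn : 0 ≤ Var[N; P] / (T.card * C.card * π) ^ 2 :=
    div_nonneg (variance_nonneg _ _) (by positivity)
  refine (ENNReal.toReal_le_of_le_ofReal hnn ((measure_mono hsub).trans hcheb)).trans ?_
  calc Var[N; P] / (T.card * C.card * π) ^ 2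
      ≤ T.card * C.card * (π + (C.card + T.card) * m ^ 2) / (T.card * C.card * π) ^ 2 := by
        gcongr
    _ = 1 / (T.card * C.card * π) + (1 / T.card + 1 / C.card) * (m / π) ^ 2 := by
        field_simp
    _ ≤ _ := by gcongr

/-! ### Decoupling by a reservoir -/

open ProbabilityTheory in
/-- Decoupling: the pairs `y` and a target depending on the total signed sum behave almost like
independent ones, since the reservoir `x` smooths the sum. -/
theorem measure_prod_no_hit_le {ι : Type*} [Fintype ι] [DecidableEq ι] {ν : Measure ℝ}
    [IsProbabilityMeasure ν] (hν : MemLp id 2 ν) {V : ℝ} (hV : Var[id; ν] ≤ V)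
    {φ : ℝ → ℝ} (hφc : Continuous φ) (hφs : HasCompactSupport φ) (hφ0 : ∀ x, 0 ≤ φ x)
    (hφ1 : ∫ x, φ x ^ 2 = 1) {Q : ℝ} (hQ0 : 0 ≤ Q)
    (hQ : ∀ s, ∫ x, (φ (x - s) - φ x) ^ 2 ≤ Q * s ^ 2)
    {ε : ι → ℝ} (hε : ∀ i, ε i ^ 2 = 1) (P R : Finset ι) (hR : R.Nonempty) (T C : Finset ι)
    {e c δ : ℝ} (hδ : 0 ≤ δ)
    (hhit : ∀ d, |d| < c → (Measure.pi fun _ : ι => ν).real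
      {y | ∀ i ∈ T, ∀ j ∈ C, ¬ |y i - y j - d| ≤ e} ≤ δ)
    {d : ℝ → ℝ} (hd : Measurable d) {η : ℝ} (hη : 0 < η) :
    ((Measure.pi fun _ : ι => ν).prod (Measure.pi fun _ : ι =>
      (volume : Measure ℝ).withDensity fun x => ENNReal.ofReal (φ x ^ 2)))
      {z | |d (∑ i ∈ P, ε i * z.1 i + ∑ i ∈ R, ε i * z.2 i)| < c ∧ ∀ i ∈ T, ∀ j ∈ C,
        ¬ |z.1 i - z.1 j - d (∑ i ∈ P, ε i * z.1 i + ∑ i ∈ R, ε i * z.2 i)| ≤ e} ≤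
      ENNReal.ofReal (δ + Q * (P.card * V) / (2 * η * R.card) + 2 * η) := by
  have hsq : Integrable fun x => φ x ^ 2 := by
    refine (by fun_prop : Continuous fun x => φ x ^ 2).integrable_of_hasCompactSupport ?_
    simpa only [sq, Pi.mul_def] using hφs.mul_right
  set νR := (volume : Measure ℝ).withDensity fun x => ENNReal.ofReal (φ x ^ 2) with hνR
  have : IsProbabilityMeasure νR := by
    refine ⟨?_⟩
    rw [hνR, withDensity_apply _ MeasurableSet.univ, Measure.restrict_univ,
      ← ofReal_integral_eq_lintegral_ofReal hsq (Eventually.of_forall fun x => sq_nonneg _), hφ1,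
      ENNReal.ofReal_one]
  set PP := Measure.pi fun _ : ι => ν with hPP
  set PR := Measure.pi fun _ : ι => νR with hPR
  set sP : (ι → ℝ) → ℝ := fun y => ∑ i ∈ P, ε i * y i with hsP
  set sR : (ι → ℝ) → ℝ := fun x => ∑ i ∈ R, ε i * x i with hsR
  have hsPm : Measurable sP := by fun_prop
  have hsRm : Measurable sR := by fun_prop
  set m₀ := ∫ y, sP y ∂PP with hm₀
  set B : Set ((ι → ℝ) × ℝ) :=
    {z | |d z.2| < c ∧ ∀ i ∈ T, ∀ j ∈ C, ¬ |z.1 i - z.1 j - d z.2| ≤ e} with hB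
  have hBm : MeasurableSet B := by
    have h1 : B = {z | |d z.2| < c} ∩ ⋂ i ∈ T, ⋂ j ∈ C, {z | |z.1 i - z.1 j - d z.2| ≤ e}ᶜ := by
      ext z; simp [hB]
    rw [h1]
    refine (measurableSet_lt (by fun_prop) measurable_const).inter ?_
    refine Finset.measurableSet_biInter _ fun i _ => Finset.measurableSet_biInter _ fun j _ => ?_
    exact (measurableSet_le (by fun_prop) measurable_const).compl
  set S : Set ((ι → ℝ) × (ι → ℝ)) := {z | (z.1, sP z.1 + sR z.2) ∈ B} with hS
  set S' : Set ((ι → ℝ) × (ι → ℝ)) := {z | (z.1, m₀ + sR z.2) ∈ B} with hS'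
  have hSm : MeasurableSet S :=
    (by fun_prop : Measurable fun z : (ι → ℝ) × (ι → ℝ) => (z.1, sP z.1 + sR z.2)) hBm
  have hSm' : MeasurableSet S' :=
    (by fun_prop : Measurable fun z : (ι → ℝ) × (ι → ℝ) => (z.1, m₀ + sR z.2)) hBm
  have hR0 : (0 : ℝ) < R.card := by exact_mod_cast hR.card_pos
  -- For fixed `y`, the deviation of the pair sum from its mean `m₀` is spread evenly, with signs,
  -- over the reservoir. Translating by it turns `S'` into `S`, at cost proportional to the squared
  -- deviation over `R.card`; in `S'` the target no longer depends on `y`.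
  have hfib : ∀ y, PR (Prod.mk y ⁻¹' S) ≤ PR (Prod.mk y ⁻¹' S') +
      ENNReal.ofReal (Q / (2 * η * R.card) * (sP y - m₀) ^ 2 + 2 * η) := by
    intro y
    set a : ι → ℝ := fun i => if i ∈ R then ε i * ((sP y - m₀) / R.card) else 0 with ha
    have hBy : MeasurableSet (Prod.mk y ⁻¹' S') := measurable_prodMk_left hSm'
    have h1 := measureReal_pi_translate_le hφc hφs hφ0 hφ1 hQ a hBy hη
    have h2 : {x | x + a ∈ Prod.mk y ⁻¹' S'} = Prod.mk y ⁻¹' S := by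
      ext x
      have h3 : sR (x + a) = sR x + (sP y - m₀) := by
        simp only [hsR, Pi.add_apply, mul_add, Finset.sum_add_distrib]
        congr 1
        have h4 : ∀ i ∈ R, ε i * a i = (sP y - m₀) / R.card := by
          intro i hi
          simp only [ha, hi, if_true]
          rw [← mul_assoc, ← sq, hε, one_mul]
        rw [Finset.sum_congr rfl h4, Finset.sum_const, nsmul_eq_mul]
        field_simp
      simp only [hS, hS', Set.mem_preimage, Set.mem_ofPred_eq, h3]
      rw [show m₀ + (sR x + (sP y - m₀)) = sP y + sR x by ring]
    have h5 : ∑ i, a i ^ 2 = (sP y - m₀) ^ 2 / R.card := by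
      have h6 : ∀ i, a i ^ 2 = if i ∈ R then ((sP y - m₀) / R.card) ^ 2 else 0 := by
        intro i
        by_cases hi : i ∈ R
        · simp only [ha, hi, if_true, mul_pow, hε, one_mul]
        · simp [ha, hi]
      simp_rw [h6]
      rw [Finset.sum_ite_mem, Finset.univ_inter, Finset.sum_const, nsmul_eq_mul]
      field_simp
    rw [h2, h5, ← hνR, ← hPR] at h1
    have h7 : 0 ≤ Q / (2 * η * R.card) * (sP y - m₀) ^ 2 + 2 * η := by positivity
    rw [← ofReal_measureReal (μ := PR) (s := Prod.mk y ⁻¹' S),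
      ← ofReal_measureReal (μ := PR) (s := Prod.mk y ⁻¹' S'),
      ← ENNReal.ofReal_add measureReal_nonneg h7]
    refine ENNReal.ofReal_le_ofReal (h1.trans (le_of_eq ?_))
    field_simp
    ring
  have hgm : ∀ i, MemLp (if i ∈ P then (fun x => ε i * x) else (0 : ℝ → ℝ)) 2 ν := by
    intro i
    by_cases hi : i ∈ P
    · simpa [hi] using hν.const_mul (ε i)
    · simp [hi]
  have hsPe : sP = ∑ i, fun y : ι → ℝ => (if i ∈ P then (fun x => ε i * x) else (0 : ℝ → ℝ)) (y i) := by
    ext y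
    simp only [hsP, Finset.sum_apply]
    rw [← Finset.sum_subset (Finset.subset_univ P)]
    · exact Finset.sum_congr rfl fun i hi => by simp [hi]
    · intro i _ hi
      simp [hi]
  have hsPmem : MemLp sP 2 PP := by
    rw [hsPe]
    exact memLp_finsetSum' _ fun i _ =>
      (hgm i).comp_measurePreserving (measurePreserving_eval (fun _ : ι => ν) i)
  have hvar : ∫ y, (sP y - m₀) ^ 2 ∂PP ≤ P.card * V := by
    have h1 := variance_sum_pi (μ := fun _ : ι => ν) hgm
    rw [← hsPe, variance_eq_integral hsPm.aemeasurable] at h1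
    rw [hm₀, h1]
    have h2 : ∀ i, Var[if i ∈ P then (fun x => ε i * x) else (0 : ℝ → ℝ); ν] ≤
        if i ∈ P then V else 0 := by
      intro i
      by_cases hi : i ∈ P
      · simp only [hi, if_true]
        rw [variance_const_mul, hε, one_mul]
        exact hV
      · simp [hi]
    refine (Finset.sum_le_sum fun i _ => h2 i).trans ?_
    rw [Finset.sum_ite_mem, Finset.univ_inter, Finset.sum_const, nsmul_eq_mul]
  have hint : Integrable (fun y => (sP y - m₀) ^ 2) PP :=
    (hsPmem.sub (memLp_const m₀)).integrable_sq
  have hS'le : (PP.prod PR) S' ≤ ENNReal.ofReal δ := by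
    rw [Measure.prod_apply_symm hSm']
    have h1 : ∀ x, PP ((fun y => (y, x)) ⁻¹' S') ≤ ENNReal.ofReal δ := by
      intro x
      rw [← ofReal_measureReal]
      refine ENNReal.ofReal_le_ofReal ?_
      by_cases hx : |d (m₀ + sR x)| < c
      · exact (measureReal_mono fun y hy => hy.2).trans (hhit _ hx)
      · have : (fun y => (y, x)) ⁻¹' S' = ∅ := by
          ext y
          simp [hS', hB, hx]
        rw [this, measureReal_empty]
        exact hδ
    refine (lintegral_mono h1).trans ?_
    simp
  have hgoal : (PP.prod PR) S ≤ ENNReal.ofReal (δ + Q * (P.card * V) / (2 * η * R.card) + 2 * η) := by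
    rw [Measure.prod_apply hSm]
    refine (lintegral_mono hfib).trans ?_
    rw [lintegral_add_left (measurable_measure_prodMk_left hSm'), ← Measure.prod_apply hSm']
    have hi2 : Integrable (fun y => Q / (2 * η * R.card) * (sP y - m₀) ^ 2 + 2 * η) PP :=
      (hint.const_mul _).add (integrable_const _)
    rw [← ofReal_integral_eq_lintegral_ofReal hi2 (Eventually.of_forall fun y => by positivity),
      integral_add (hint.const_mul _) (integrable_const _), integral_const_mul, integral_const,
      probReal_univ, one_smul]
    refine (add_le_add hS'le le_rfl).trans ?_
    rw [← ENNReal.ofReal_add hδ (by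
      have : 0 ≤ ∫ y, (sP y - m₀) ^ 2 ∂PP := integral_nonneg fun y => sq_nonneg _
      positivity)]
    refine ENNReal.ofReal_le_ofReal ?_
    have h3 : Q / (2 * η * R.card) * ∫ y, (sP y - m₀) ^ 2 ∂PP ≤
        Q / (2 * η * R.card) * (P.card * V) := by gcongr
    have h4 : Q / (2 * η * R.card) * (P.card * V) = Q * (P.card * V) / (2 * η * R.card) := by ring
    linarith
  exact hgoal

/-! ### Mixtures and measurability -/

theorem pi_mixture {ι A Ω : Type*} [Fintype ι] [DecidableEq ι] [Fintype A] [MeasurableSpace Ω]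
    (c : A → ENNReal) (ν : A → Measure Ω) [∀ a, IsProbabilityMeasure (ν a)]
    (hc : ∑ a, c a = 1) :
    Measure.pi (fun _ : ι => ∑ a, c a • ν a) =
      ∑ τ : ι → A, (∏ i, c (τ i)) • Measure.pi (fun i => ν (τ i)) := by
  have : IsProbabilityMeasure (∑ a, c a • ν a) := ⟨by simp [hc]⟩
  refine Measure.pi_eq (μ := fun _ : ι => ∑ a, c a • ν a) fun s _ => ?_
  simp only [Measure.coe_finsetSum, Finset.sum_apply, Measure.smul_apply, Measure.pi_pi,
    smul_eq_mul, ← Finset.prod_mul_distrib]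
  rw [Finset.prod_univ_sum, Fintype.piFinset_univ]

theorem pi_dirac_sum_apply {ι A : Type*} [Fintype ι] [DecidableEq ι] [Fintype A]
    [MeasurableSpace A] [DiscreteMeasurableSpace A] (c : A → ENNReal) (hc : ∑ a, c a = 1)
    (B : Set (ι → A)) :
    Measure.pi (fun _ : ι => ∑ a, c a • Measure.dirac a) B =
      ∑ τ : ι → A, (∏ i, c (τ i)) * B.indicator 1 τ := by
  rw [pi_mixture c (fun a => Measure.dirac a) hc]
  simp only [Measure.coe_finsetSum, Finset.sum_apply, Measure.smul_apply, smul_eq_mul]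
  refine Finset.sum_congr rfl fun τ _ => ?_
  congr 1
  have h : Measure.pi (fun i => Measure.dirac (τ i)) = Measure.dirac τ := by
    refine (Measure.pi_eq fun s hs => ?_)
    rw [Measure.dirac_apply' _ (MeasurableSet.univ_pi hs)]
    simp only [Measure.dirac_apply' _ (hs _)]
    by_cases h : τ ∈ Set.pi univ s
    · rw [Set.indicator_of_mem h]
      rw [Finset.prod_eq_one fun i _ => Set.indicator_of_mem (h i trivial) _]
      rfl
    · rw [Set.indicator_of_notMem h]
      simp only [Set.mem_pi, Set.mem_univ, true_imp_iff, not_forall] at h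
      obtain ⟨i, hi⟩ := h
      exact (Finset.prod_eq_zero (Finset.mem_univ i) (Set.indicator_of_notMem hi _)).symm
  rw [h, Measure.dirac_apply]

/-- Conditioning on the types of the coordinates of a mixture. -/
theorem pi_mixture_le {ι A Ω : Type*} [Fintype ι] [DecidableEq ι] [Fintype A]
    [MeasurableSpace A] [DiscreteMeasurableSpace A] [MeasurableSpace Ω]
    (c : A → ENNReal) (ν : A → Measure Ω) [∀ a, IsProbabilityMeasure (ν a)]
    (hc : ∑ a, c a = 1) (B : Set (ι → A)) (S : Set (ι → Ω)) {δ : ENNReal}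
    (hS : ∀ τ ∉ B, Measure.pi (fun i => ν (τ i)) S ≤ δ) :
    Measure.pi (fun _ : ι => ∑ a, c a • ν a) S ≤
      Measure.pi (fun _ : ι => ∑ a, c a • Measure.dirac a) B + δ := by
  have hprod : ∑ τ : ι → A, ∏ i, c (τ i) = 1 := by
    have h := Finset.prod_univ_sum (fun _ : ι => (Finset.univ : Finset A)) (fun _ a => c a)
    rw [Fintype.piFinset_univ] at h
    rw [← h]
    simp [hc]
  rw [pi_mixture c ν hc, pi_dirac_sum_apply c hc]
  simp only [Measure.coe_finsetSum, Finset.sum_apply, Measure.smul_apply, smul_eq_mul]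
  have hδ : δ = ∑ τ : ι → A, (∏ i, c (τ i)) * δ := by rw [← Finset.sum_mul, hprod, one_mul]
  rw [hδ, ← Finset.sum_add_distrib]
  refine Finset.sum_le_sum fun τ _ => ?_
  rw [← mul_add]
  gcongr
  by_cases h : τ ∈ B
  · rw [Set.indicator_of_mem h]
    exact prob_le_one.trans (le_add_of_nonneg_right zero_le)
  · exact (hS τ h).trans (le_add_of_nonneg_left zero_le)

/-- The vector whose `i`-th coordinate is taken from the source `τ i`. -/
def combine {ι : Type*} (τ : ι → Fin 3) (q : (ι → ℝ) × (ι → ℝ) × (ι → ℝ)) : ι → ℝ :=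
  fun i => if τ i = 0 then q.1 i else if τ i = 1 then q.2.1 i else q.2.2 i

theorem measurable_combine {ι : Type*} (τ : ι → Fin 3) : Measurable (combine τ) := by
  refine measurable_pi_lambda _ fun i => ?_
  unfold combine
  by_cases h0 : τ i = 0
  · simp only [h0, if_true]; fun_prop
  by_cases h1 : τ i = 1
  · simp only [h1, if_true]; simp; fun_prop
  · simp only [h0, h1, if_false]; fun_prop

/-- Realises a vector with prescribed types from three independent vectors, each with a full set of
coordinates, so that the index set is the same for every `τ`. -/
theorem map_combine {ι : Type*} [Fintype ι] (τ : ι → Fin 3) (ν : Fin 3 → Measure ℝ)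
    [∀ a, IsProbabilityMeasure (ν a)] :
    ((Measure.pi fun _ : ι => ν 0).prod
      ((Measure.pi fun _ : ι => ν 1).prod (Measure.pi fun _ : ι => ν 2))).map (combine τ) =
      Measure.pi fun i => ν (τ i) := by
  symm
  refine Measure.pi_eq fun s hs => ?_
  rw [Measure.map_apply (measurable_combine τ) (MeasurableSet.univ_pi hs)]
  have hset : combine τ ⁻¹' Set.pi univ s =
      (Set.pi univ fun i => if τ i = 0 then s i else univ) ×ˢ
        (Set.pi univ fun i => if τ i = 1 then s i else univ) ×ˢ
        (Set.pi univ fun i => if τ i = 2 then s i else univ) := by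
    ext q
    simp only [combine, Set.mem_preimage, Set.mem_pi, Set.mem_univ, true_imp_iff, Set.mem_prod,
      ← forall_and]
    refine forall_congr' fun i => ?_
    generalize τ i = a
    fin_cases a <;> simp
  rw [hset, Measure.prod_prod, Measure.prod_prod, Measure.pi_pi, Measure.pi_pi, Measure.pi_pi,
    ← Finset.prod_mul_distrib, ← Finset.prod_mul_distrib]
  refine Finset.prod_congr rfl fun i _ => ?_
  generalize τ i = a
  fin_cases a <;> simp

/-- There are finitely many patterns of truth values, and each is met on a measurable set. Events
about greedy runs are of this kind, which avoids following a run step by step. -/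
theorem measurableSet_of_finite_family {Ω κ : Type*} [MeasurableSpace Ω] [Finite κ]
    {p : Ω → κ → Prop} (hp : ∀ k, MeasurableSet {ω | p ω k}) (Q : (κ → Prop) → Prop) :
    MeasurableSet {ω | Q (p ω)} := by
  have h : {ω | Q (p ω)} = ⋃ ρ : {ρ : κ → Prop // Q ρ}, ⋂ k, {ω | p ω k ↔ ρ.1 k} := by
    ext ω
    simp only [Set.mem_ofPred_eq, Set.mem_iUnion, Set.mem_iInter]
    constructor
    · exact fun hQ => ⟨⟨p ω, hQ⟩, fun k => Iff.rfl⟩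
    · rintro ⟨ρ, hρ⟩
      have : p ω = ρ.1 := funext fun k => propext (hρ k)
      rw [this]
      exact ρ.2
  rw [h]
  refine MeasurableSet.iUnion fun ρ => MeasurableSet.iInter fun k => ?_
  by_cases hk : ρ.1 k
  · simpa [hk] using hp k
  · simp only [hk, iff_false]
    exact (hp k).compl

/-- A set is measurable if membership is determined by finitely many measurable properties. -/
theorem measurableSet_of_determined {Ω κ : Type*} [MeasurableSpace Ω] [Finite κ]
    {p : Ω → κ → Prop} (hp : ∀ k, MeasurableSet {ω | p ω k}) {S : Set Ω}
    (hS : ∀ x y, (∀ k, p x k ↔ p y k) → x ∈ S → y ∈ S) : MeasurableSet S := by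
  convert measurableSet_of_finite_family hp (fun ρ => ∃ x ∈ S, p x = ρ) using 1
  ext y
  exact ⟨fun hy => ⟨y, hy, rfl⟩, fun ⟨x, hx, h⟩ => hS x y (fun k => by rw [h]) hx⟩

/-! ### Small balls and densities -/

/-- Lower bound for the probability that a difference of two independent variables lies close
to `d`. -/
theorem measureReal_abs_sub_le_ge {g : ℝ → ℝ} (hg : Integrable g) (hgm : Measurable g)
    (hg0 : ∀ x, 0 ≤ g x) {c p₀ : ℝ} (hp₀ : 0 ≤ p₀)
    (hp : ∀ t, |t| ≤ c → p₀ ≤ ∫ x, g (x + t) * g x) {M : ℝ} (hM : ∀ x, g x ≤ M)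
    {d e : ℝ} (hd : |d| < c) (he0 : 0 ≤ e) (he : e ≤ c)
    [IsProbabilityMeasure ((volume : Measure ℝ).withDensity fun x => ENNReal.ofReal (g x))] :
    e * p₀ ≤ (((volume : Measure ℝ).withDensity fun x => ENNReal.ofReal (g x)).prod
      ((volume : Measure ℝ).withDensity fun x => ENNReal.ofReal (g x))).real
        {q | |q.1 - q.2 - d| ≤ e} := by
  set ν := (volume : Measure ℝ).withDensity fun x => ENNReal.ofReal (g x) with hν
  have hW : MeasurableSet {q : ℝ × ℝ | |q.1 - q.2 - d| ≤ e} :=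
    measurableSet_le (by fun_prop) measurable_const
  -- an interval of length `e` of good offsets
  obtain ⟨t₀, ht₀⟩ : ∃ t₀, ∀ t ∈ Icc t₀ (t₀ + e), |t| ≤ c ∧ |t - d| ≤ e := by
    rw [abs_lt] at hd
    rcases le_total 0 d with h | h
    · refine ⟨d - e, fun t ht => ?_⟩
      obtain ⟨h1, h2⟩ := ht
      rw [abs_le, abs_le]
      refine ⟨⟨?_, ?_⟩, ?_, ?_⟩ <;> linarith
    · refine ⟨d, fun t ht => ?_⟩
      obtain ⟨h1, h2⟩ := ht
      rw [abs_le, abs_le]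
      refine ⟨⟨?_, ?_⟩, ?_, ?_⟩ <;> linarith
  have hgE : Measurable fun x => ENNReal.ofReal (g x) := hgm.ennreal_ofReal
  have hmain : ENNReal.ofReal (e * p₀) ≤ (ν.prod ν) {q : ℝ × ℝ | |q.1 - q.2 - d| ≤ e} := by
    rw [Measure.prod_apply_symm hW]
    have h1 : ∀ v, ∫⁻ t in Icc t₀ (t₀ + e), ENNReal.ofReal (g (v + t)) ≤
        ν ((fun u => (u, v)) ⁻¹' {q : ℝ × ℝ | |q.1 - q.2 - d| ≤ e}) := by
      intro v
      have hm : MeasurableSet ((fun u => (u, v)) ⁻¹' {q : ℝ × ℝ | |q.1 - q.2 - d| ≤ e}) :=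
        (by fun_prop : Measurable fun u : ℝ => (u, v)) hW
      rw [hν, withDensity_apply _ hm, ← lintegral_indicator measurableSet_Icc,
        ← lintegral_indicator hm]
      conv_rhs => rw [← lintegral_add_left_eq_self _ v]
      refine lintegral_mono fun t => ?_
      by_cases ht : t ∈ Icc t₀ (t₀ + e)
      · rw [Set.indicator_of_mem ht, Set.indicator_of_mem]
        simp only [Set.mem_preimage, Set.mem_ofPred_eq, add_sub_cancel_left]
        exact (ht₀ t ht).2
      · rw [Set.indicator_of_notMem ht]
        exact zero_le
    refine le_trans ?_ (lintegral_mono h1)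
    have hmeas : Measurable fun v => ∫⁻ t in Icc t₀ (t₀ + e), ENNReal.ofReal (g (v + t)) := by
      refine Measurable.lintegral_prod_right' (f := fun q : ℝ × ℝ => ENNReal.ofReal (g (q.1 + q.2)))
        ?_
      exact hgE.comp (by fun_prop)
    rw [hν, lintegral_withDensity_eq_lintegral_mul _ hgE hmeas]
    simp only [Pi.mul_apply]
    have h2 : ∀ v, ENNReal.ofReal (g v) * ∫⁻ t in Icc t₀ (t₀ + e), ENNReal.ofReal (g (v + t)) =
        ∫⁻ t in Icc t₀ (t₀ + e), ENNReal.ofReal (g (v + t) * g v) := by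
      intro v
      have hv : Measurable fun t => ENNReal.ofReal (g (v + t)) :=
        hgE.comp (measurable_const_add v)
      rw [← lintegral_const_mul _ hv]
      refine lintegral_congr fun t => ?_
      rw [← ENNReal.ofReal_mul (hg0 _), mul_comm]
    simp_rw [h2]
    rw [lintegral_lintegral_swap]
    · have h3 : ∀ t ∈ Icc t₀ (t₀ + e), ENNReal.ofReal p₀ ≤ ∫⁻ v, ENNReal.ofReal (g (v + t) * g v) := by
        intro t ht
        rw [← ofReal_integral_eq_lintegral_ofReal]
        · exact ENNReal.ofReal_le_ofReal (hp t (ht₀ t ht).1)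
        · refine hg.bdd_mul (c := M) (hgm.comp (by fun_prop)).aestronglyMeasurable
            (Eventually.of_forall fun x => ?_)
          rw [Real.norm_of_nonneg (hg0 _)]
          exact hM _
        · exact Eventually.of_forall fun x => mul_nonneg (hg0 _) (hg0 _)
      refine le_trans ?_ (setLIntegral_mono' measurableSet_Icc h3)
      rw [setLIntegral_const, Real.volume_Icc, add_sub_cancel_left, ← ENNReal.ofReal_mul hp₀,
        mul_comm]
    · refine Measurable.aemeasurable ?_
      have : Measurable fun q : ℝ × ℝ => g (q.1 + q.2) * g q.1 :=
        (hgm.comp (by fun_prop)).mul (hgm.comp (by fun_prop))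
      exact this.ennreal_ofReal
  rw [measureReal_def]
  exact (ENNReal.ofReal_le_iff_le_toReal (measure_ne_top _ _)).1 hmain

theorem measureReal_withDensity_le {g : ℝ → ℝ} {M : ℝ} (hM : ∀ x, g x ≤ M) (hM0 : 0 ≤ M)
    (s : Set ℝ) {l : ℝ} (hl : 0 ≤ l) (hs : volume s ≤ ENNReal.ofReal l) :
    ((volume : Measure ℝ).withDensity fun x => ENNReal.ofReal (g x)).real s ≤ l * M := by
  refine ENNReal.toReal_le_of_le_ofReal (by positivity) ?_
  calc _ ≤ ((volume : Measure ℝ).withDensity fun _ => ENNReal.ofReal M) s :=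
        withDensity_mono (Eventually.of_forall fun x => ENNReal.ofReal_le_ofReal (hM x)) s
    _ = ENNReal.ofReal M * volume s := by
        rw [withDensity_const, Measure.smul_apply, smul_eq_mul]
    _ ≤ ENNReal.ofReal M * ENNReal.ofReal l := by gcongr
    _ = _ := by rw [← ENNReal.ofReal_mul hM0, mul_comm]

/-! ### Failure of the last switch for prescribed types -/

theorem measurableSet_isStop {Ω : Type*} [MeasurableSpace Ω] {n : ℕ} {Φ : Ω → Allocation n → ℝ}
    (hΦ : ∀ w, Measurable fun ω => Φ ω w) {S : Ω → Set (Fin (2 * n))}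
    (hS : ∀ i, MeasurableSet {ω | i ∈ S ω}) (c : ℝ) (w₀ v : Allocation n) :
    MeasurableSet {ω | IsStop (Φ ω) (S ω) c w₀ v} := by
  refine measurableSet_of_determined
    (κ := Fin (2 * n) ⊕ (Allocation n × Allocation n) ⊕ Allocation n)
    (p := fun ω => Sum.elim (fun i => i ∈ S ω)
      (Sum.elim (fun w => |Φ ω w.1| ≤ |Φ ω w.2|) fun w => c ≤ |Φ ω w|)) ?_ ?_
  · rintro (i | w | w)
    · exact hS i
    · exact measurableSet_le (hΦ w.1).abs (hΦ w.2).abs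
    · exact measurableSet_le measurable_const (hΦ w).abs
  · intro x y h hx
    have h1 : S x = S y := Set.ext fun i => h (Sum.inl i)
    have h2 : ∀ w w', |Φ x w| ≤ |Φ x w'| ↔ |Φ y w| ≤ |Φ y w'| := fun w w' =>
      h (Sum.inr (Sum.inl (w, w')))
    have h3 : ∀ w, c ≤ |Φ x w| ↔ c ≤ |Φ y w| := fun w => h (Sum.inr (Sum.inr w))
    have h4 : FunctionalStep (Φ x) (S x) c = FunctionalStep (Φ y) (S y) c := by
      ext w w'
      simp only [FunctionalStep, h1, h2, h3, ← not_le]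
    simp only [Set.mem_ofPred_eq, IsStop] at hx ⊢
    rwa [← h4]

theorem measurableSet_mem_extremes {n : ℕ} (m : ℕ) (i : Fin (2 * n)) :
    MeasurableSet {x : Fin (2 * n) → ℝ | i ∈ extremes x m} := by
  refine measurableSet_of_determined (κ := Fin (2 * n) × Fin (2 * n))
    (p := fun x k => x k.1 < x k.2)
    (fun k => measurableSet_lt (measurable_pi_apply _) (measurable_pi_apply _)) ?_
  intro x y h hx
  have h1 : ∀ i j, x i < x j ↔ y i < y j := fun i j => h (i, j)
  simpa only [Set.mem_ofPred_eq, extremes, h1] using hx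

theorem measurable_diffSum {n : ℕ} (w : Allocation n) :
    Measurable fun x : Fin (2 * n) → ℝ => diffSum x w := by
  simp_rw [diffSum_eq_sum]
  fun_prop

/-- The greedy phase stops with a small difference, but no pair from `A` brings the difference
within `2 * e` of zero. -/
def LastSwitchFails {n : ℕ} (w₀ : Allocation n) (m : ℕ) (a₁ a₂ c e : ℝ)
    (A : (Fin (2 * n) → ℝ) → Set (Fin (2 * n))) : Set (Fin (2 * n) → ℝ) :=
  {x | NoTies (diffSum x) ∧ m ≤ (Finset.univ.filter fun j => x j < a₁).card ∧
    m ≤ (Finset.univ.filter fun j => a₂ < x j).card ∧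
    ∃ v, IsStop (diffSum x) (extremes x m) c w₀ v ∧ |diffSum x v| < c ∧
      ∀ i ∈ A x, ∀ j ∈ A x, w₀ i = true → w₀ j = false →
        ¬ |x i - x j - diffSum x v / 2| ≤ e}

theorem measurableSet_lastSwitchFails {n : ℕ} (w₀ : Allocation n) (m : ℕ) (a₁ a₂ c e : ℝ)
    (A : Set (Fin (2 * n))) :
    MeasurableSet (LastSwitchFails w₀ m a₁ a₂ c e fun _ => A) := by
  refine measurableSet_of_determined
    (κ := (Allocation n × Allocation n) ⊕ Fin (2 * n) ⊕ Fin (2 * n) ⊕ Allocation n ⊕ Allocation n ⊕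
      (Allocation n × Fin (2 * n) × Fin (2 * n)))
    (p := fun x => Sum.elim (fun w => |diffSum x w.1| = |diffSum x w.2|)
      (Sum.elim (fun i => x i < a₁) (Sum.elim (fun i => a₂ < x i)
      (Sum.elim (fun v => IsStop (diffSum x) (extremes x m) c w₀ v)
      (Sum.elim (fun v => |diffSum x v| < c)
        fun k => |x k.2.1 - x k.2.2 - diffSum x k.1 / 2| ≤ e))))) ?_ ?_
  · rintro (w | i | i | v | v | k)
    · exact measurableSet_eq_fun (measurable_diffSum w.1).abs (measurable_diffSum w.2).abs
    · exact measurableSet_lt (measurable_pi_apply i) measurable_const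
    · exact measurableSet_lt measurable_const (measurable_pi_apply i)
    · exact measurableSet_isStop measurable_diffSum (measurableSet_mem_extremes m) c w₀ v
    · exact measurableSet_lt (measurable_diffSum v).abs measurable_const
    · have := measurable_diffSum k.1
      exact measurableSet_le (by fun_prop) measurable_const
  · intro x y h hx
    have h1 : ∀ w w', |diffSum x w| = |diffSum x w'| ↔ |diffSum y w| = |diffSum y w'| :=
      fun w w' => h (.inl (w, w'))
    have h2 : ∀ i, x i < a₁ ↔ y i < a₁ := fun i => h (.inr (.inl i))
    have h3 : ∀ i, a₂ < x i ↔ a₂ < y i := fun i => h (.inr (.inr (.inl i)))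
    have h4 : ∀ v, IsStop (diffSum x) (extremes x m) c w₀ v ↔
        IsStop (diffSum y) (extremes y m) c w₀ v := fun v => h (.inr (.inr (.inr (.inl v))))
    have h5 : ∀ v, |diffSum x v| < c ↔ |diffSum y v| < c :=
      fun v => h (.inr (.inr (.inr (.inr (.inl v)))))
    have h6 : ∀ v i j, |x i - x j - diffSum x v / 2| ≤ e ↔ |y i - y j - diffSum y v / 2| ≤ e :=
      fun v i j => h (.inr (.inr (.inr (.inr (.inr (v, i, j))))))
    simpa only [Set.mem_ofPred_eq, LastSwitchFails, NoTies, h1, h2, h3, h4, h5, h6] using hx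

open ProbabilityTheory in
-- Types `0`, `1`, `2` mean rest, pair and reservoir. With the rest `z` fixed, the coordinates of
-- types `1` and `2` are central, so they neither influence the extreme set nor get switched, and
-- the run sees only their signed sum `s`. The target is then a function `d s`, and the decoupling
-- bound applies.
theorem pi_lastSwitchFails_le {n : ℕ} (hn : 3 ≤ n) (w₀ : Allocation n) (m : ℕ) {a₁ a₂ : ℝ}
    (ha : a₁ ≤ a₂) {c e : ℝ} (τ : Fin (2 * n) → Fin 3) (ν : Fin 3 → Measure ℝ)
    [∀ a, IsProbabilityMeasure (ν a)] (hν₁ : ∀ᵐ x ∂(ν 1), x ∈ Icc a₁ a₂)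
    (hν₂ : ∀ᵐ x ∂(ν 2), x ∈ Icc a₁ a₂) (hν : MemLp id 2 (ν 1)) {V : ℝ} (hV : Var[id; ν 1] ≤ V)
    {φ : ℝ → ℝ} (hφc : Continuous φ) (hφs : HasCompactSupport φ) (hφ0 : ∀ x, 0 ≤ φ x)
    (hφ1 : ∫ x, φ x ^ 2 = 1) {Q : ℝ} (hQ0 : 0 ≤ Q)
    (hQ : ∀ s, ∫ x, (φ (x - s) - φ x) ^ 2 ≤ Q * s ^ 2)
    (hνφ : ν 2 = volume.withDensity fun x => ENNReal.ofReal (φ x ^ 2))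
    (hR : (Finset.univ.filter fun i => τ i = 2).Nonempty) {δ : ℝ} (hδ : 0 ≤ δ)
    (hhit : ∀ d, |d| < c / 2 → (Measure.pi fun _ : Fin (2 * n) => ν 1).real
      {y | ∀ i ∈ Finset.univ.filter (fun i => τ i = 1 ∧ w₀ i = true),
        ∀ j ∈ Finset.univ.filter (fun i => τ i = 1 ∧ w₀ i = false), ¬ |y i - y j - d| ≤ e} ≤ δ)
    {η : ℝ} (hη : 0 < η) :
    Measure.pi (fun i => ν (τ i)) (LastSwitchFails w₀ m a₁ a₂ c e fun _ => {i | τ i = 1}) ≤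
      ENNReal.ofReal (δ + Q * ((Finset.univ.filter fun i => τ i = 1).card * V) /
        (2 * η * (Finset.univ.filter fun i => τ i = 2).card) + 2 * η) := by
  set P := Finset.univ.filter fun i => τ i = 1 with hP
  set R := Finset.univ.filter fun i => τ i = 2 with hRdef
  set T := Finset.univ.filter fun i => τ i = 1 ∧ w₀ i = true with hT
  set C := Finset.univ.filter fun i => τ i = 1 ∧ w₀ i = false with hC
  have hFm := measurableSet_lastSwitchFails w₀ m a₁ a₂ c e {i | τ i = 1}
  set F := LastSwitchFails w₀ m a₁ a₂ c e fun _ => {i | τ i = 1} with hF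
  rw [← map_combine τ ν, Measure.map_apply (measurable_combine τ) hFm,
    Measure.prod_apply (measurable_combine τ hFm)]
  suffices h : ∀ z, ((Measure.pi fun _ : Fin (2 * n) => ν 1).prod
      (Measure.pi fun _ : Fin (2 * n) => ν 2)) (Prod.mk z ⁻¹' (combine τ ⁻¹' F)) ≤
      ENNReal.ofReal (δ + Q * (P.card * V) / (2 * η * R.card) + 2 * η) by
    refine (lintegral_mono h).trans ?_
    simp
  intro z
  -- A deterministic reference sample: all central values are moved to `a₁`, which does not change
  -- the extremes.
  set xr : Fin (2 * n) → ℝ := fun i => if τ i = 0 then z i else a₁ with hxr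
  set E := extremes xr m with hE
  set Φ : ℝ → Allocation n → ℝ := fun s w =>
    (∑ i ∈ Finset.univ.filter (fun i => τ i = 0), labelSign (w i) * z i) + s with hΦ
  have hΦm : ∀ w, Measurable fun s => Φ s w := fun w => by fun_prop
  have hreached : ∀ v, MeasurableSet {s | IsStop (Φ s) E c w₀ v} := fun v =>
    measurableSet_isStop hΦm (fun i => MeasurableSet.const _) c w₀ v
  -- Summing over all possible endpoints gives a measurable function of `s` without choosing one; on
  -- the event in question exactly one term is present, since the endpoint is unique.
  set d : ℝ → ℝ := fun s =>
    ∑ v, {s | IsStop (Φ s) E c w₀ v}.indicator (fun s => Φ s v / 2) s with hd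
  have hdm : Measurable d := by
    refine Finset.measurable_fun_sum _ fun v _ => ?_
    exact ((hΦm v).div_const 2).indicator (hreached v)
  have hcore := measure_prod_no_hit_le hν hV hφc hφs hφ0 hφ1 hQ0 hQ
    (ε := fun i => labelSign (w₀ i)) (fun i => labelSign_sq _) P R hR T C hδ hhit hdm hη
  rw [← hνφ] at hcore
  refine le_trans (measure_mono_ae ?_) hcore
  have hae1 : ∀ᵐ q ∂((Measure.pi fun _ : Fin (2 * n) => ν 1).prod
      (Measure.pi fun _ : Fin (2 * n) => ν 2)), ∀ i, q.1 i ∈ Icc a₁ a₂ := by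
    refine ae_all_iff.2 fun i => ?_
    exact measurePreserving_fst.quasiMeasurePreserving.ae
      ((measurePreserving_eval (fun _ : Fin (2 * n) => ν 1) i).quasiMeasurePreserving.ae hν₁)
  have hae2 : ∀ᵐ q ∂((Measure.pi fun _ : Fin (2 * n) => ν 1).prod
      (Measure.pi fun _ : Fin (2 * n) => ν 2)), ∀ i, q.2 i ∈ Icc a₁ a₂ := by
    refine ae_all_iff.2 fun i => ?_
    exact measurePreserving_snd.quasiMeasurePreserving.ae
      ((measurePreserving_eval (fun _ : Fin (2 * n) => ν 2) i).quasiMeasurePreserving.ae hν₂)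
  filter_upwards [hae1, hae2] with q hq1 hq2 hq
  set x := combine τ (z, q) with hx
  obtain ⟨hnt, hlow, hhigh, v, hv, hvc, hno⟩ : x ∈ F := hq
  have hτ : ∀ i, τ i = 0 ∨ τ i = 1 ∨ τ i = 2 := fun i => by
    generalize τ i = a
    fin_cases a <;> simp
  have hact : ∀ i, τ i ≠ 0 → x i ∈ Icc a₁ a₂ := by
    intro i hi
    rcases hτ i with h | h | h
    · exact absurd h hi
    · simpa [hx, combine, h] using hq1 i
    · simpa [hx, combine, h] using hq2 i
  have hxy : ∀ i, x i = xr i ∨ (x i ∈ Icc a₁ a₂ ∧ xr i ∈ Icc a₁ a₂) := by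
    intro i
    by_cases hi : τ i = 0
    · left
      simp [hx, hxr, combine, hi]
    · right
      refine ⟨hact i hi, ?_⟩
      simp only [hxr, hi, if_false]
      exact ⟨le_rfl, ha⟩
  have hEx : extremes x m = E := extremes_eq_of_central ha hxy hlow hhigh
  have hactE : ∀ i, τ i ≠ 0 → i ∉ E := fun i hi =>
    hEx ▸ extremes_central hlow hhigh (hact i hi)
  set s := ∑ i ∈ P, labelSign (w₀ i) * q.1 i + ∑ i ∈ R, labelSign (w₀ i) * q.2 i with hs
  have hΦs : ∀ w : Allocation n, (∀ i ∉ E, w i = w₀ i) → diffSum x w = Φ s w := by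
    intro w hw
    simp only [hΦ, hs, hP, hRdef, Finset.sum_filter]
    rw [diffSum_eq_sum, ← Finset.sum_add_distrib, ← Finset.sum_add_distrib]
    refine Finset.sum_congr rfl fun i _ => ?_
    rcases hτ i with h | h | h
    · simp [hx, combine, h]
    · have := hw i (hactE i (by simp [h]))
      simp [hx, combine, h, this]
    · have := hw i (hactE i (by simp [h]))
      simp [hx, combine, h, this]
  rw [hEx] at hv
  have hvw : ∀ i ∉ E, v i = w₀ i := fun i hi => reflTransGen_eq_of_notMem hv.1 hi
  have hds : d s = diffSum x v / 2 := by
    simp only [hd]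
    rw [Finset.sum_eq_single v]
    · rw [hΦs v hvw]
      exact Set.indicator_of_mem (s := {s | IsStop (Φ s) E c w₀ v}) (isStop_of_congr hΦs hv) _
    · intro v' _ hne
      refine Set.indicator_of_notMem (s := {s | IsStop (Φ s) E c w₀ v'}) (fun hv' => hne ?_) _
      have h1 : IsStop (diffSum x) E c w₀ v' :=
        isStop_of_congr (fun w hw => (hΦs w hw).symm) hv'
      exact IsStop.unique hn hnt h1 hv
    · simp
  show |d s| < c / 2 ∧ ∀ i ∈ T, ∀ j ∈ C, ¬ |q.1 i - q.1 j - d s| ≤ e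
  rw [hds]
  refine ⟨?_, fun i hi j hj => ?_⟩
  · rw [abs_div, abs_of_pos (by norm_num : (0 : ℝ) < 2)]
    linarith only [hvc]
  · simp only [hT, hC, Finset.mem_filter, Finset.mem_univ, true_and] at hi hj
    have h1 := hno i hi.1 j hj.1 hi.2 hj.2
    simpa [hx, combine, hi.1, hj.1] using h1

/-! ### Almost sure absence of ties -/

theorem volume_hyperplane {ι : Type*} [Fintype ι] {a : ι → ℝ} (ha : a ≠ 0) :
    volume {x : ι → ℝ | ∑ i, a i * x i = 0} = 0 := by
  classical
  set L : (ι → ℝ) →ₗ[ℝ] ℝ := ∑ i, a i • LinearMap.proj i with hL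
  have hLx : ∀ x, L x = ∑ i, a i * x i := fun x => by simp [hL]
  have h : {x : ι → ℝ | ∑ i, a i * x i = 0} = (LinearMap.ker L : Set (ι → ℝ)) := by
    ext x
    simp [hLx]
  rw [h]
  refine Measure.addHaar_submodule _ _ fun htop => ha ?_
  funext i
  have h1 : L (Pi.single i 1) = 0 := by
    have : Pi.single i 1 ∈ LinearMap.ker L := htop ▸ Submodule.mem_top
    simpa using this
  rw [hLx] at h1
  simpa [Pi.single_apply] using h1

/-- For allocations that are neither equal nor complementary, a tie puts the sample on one of two
proper hyperplanes, and there are finitely many such pairs of allocations. -/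
theorem ae_noTies {n : ℕ} {f : ℝ → ℝ} (hf : Integrable f) (hf0 : ∀ x, 0 ≤ f x) :
    ∀ᵐ x ∂(Measure.pi fun _ : Fin (2 * n) => covariateLaw f), NoTies (diffSum x) := by
  have hac : (Measure.pi fun _ : Fin (2 * n) => covariateLaw f) ≪ volume := by
    unfold covariateLaw
    rw [pi_withDensity_ofReal hf hf0]
    exact withDensity_absolutelyContinuous _ _
  refine hac.ae_le ?_
  unfold NoTies
  refine ae_all_iff.2 fun w => ae_all_iff.2 fun w' => ?_
  by_cases h1 : w = w'
  · exact Eventually.of_forall fun x _ => Or.inl h1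
  by_cases h2 : ∀ i, w i = !(w' i)
  · exact Eventually.of_forall fun x _ => Or.inr h2
  have ha : (fun i => labelSign (w i) - labelSign (w' i)) ≠ 0 := fun h => h1 <| by
    funext i
    exact labelSign_injective (sub_eq_zero.1 (congrFun h i))
  have hb : (fun i => labelSign (w i) + labelSign (w' i)) ≠ 0 := fun h => h2 fun i => by
    have := congrFun h i
    simp only [Pi.zero_apply] at this
    refine labelSign_injective ?_
    rw [labelSign_not]
    linarith
  have ha' : ∀ᵐ x : Fin (2 * n) → ℝ, x ∉ {x : Fin (2 * n) → ℝ |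
      ∑ i, (labelSign (w i) - labelSign (w' i)) * x i = 0} :=
    measure_eq_zero_iff_ae_notMem.1 (volume_hyperplane ha)
  have hb' : ∀ᵐ x : Fin (2 * n) → ℝ, x ∉ {x : Fin (2 * n) → ℝ |
      ∑ i, (labelSign (w i) + labelSign (w' i)) * x i = 0} :=
    measure_eq_zero_iff_ae_notMem.1 (volume_hyperplane hb)
  filter_upwards [ha', hb'] with x hxa hxb hx
  exfalso
  simp only [sub_mul, add_mul, Finset.sum_sub_distrib, Finset.sum_add_distrib,
    ← diffSum_eq_sum] at hxa hxb
  rcases abs_eq_abs.1 hx with h | h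
  · exact hxa (by linarith)
  · exact hxb (by linarith)

/-! ### Splitting the density and finding the last switch -/

/-- A density as a mixture of three parts: a small multiple of its restriction to an interval,
a small multiple of the square of a bump in this interval, and a rest. -/
theorem exists_mixture {f : ℝ → ℝ} (hf0 : ∀ x, 0 ≤ f x) (hfc : Continuous f)
    (hfi : Integrable f) (hf1 : ∫ x, f x = 1) {a₁ a₂ : ℝ} (ha : a₁ < a₂) {G : ℝ}
    (hG : ∫ x, (Icc a₁ a₂).indicator f x = G) (hG0 : 0 < G) :
    ∃ φ : ℝ → ℝ, Continuous φ ∧ HasCompactSupport φ ∧ (∀ x, 0 ≤ φ x) ∧ (∫ x, φ x ^ 2 = 1) ∧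
      (∀ x ∉ Icc a₁ a₂, φ x = 0) ∧ (∃ Q, 0 ≤ Q ∧ ∀ s, ∫ x, (φ (x - s) - φ x) ^ 2 ≤ Q * s ^ 2) ∧
      ∃ κ : ℝ, 0 < κ ∧ ∀ θ : ℝ, 0 < θ → θ ≤ 1 / 4 → ∃ (c₀ : ℝ) (ν₀ : Measure ℝ), 0 ≤ c₀ ∧
        IsProbabilityMeasure ν₀ ∧ c₀ + θ * G + κ = 1 ∧
        covariateLaw f = ENNReal.ofReal c₀ • ν₀ + ENNReal.ofReal (θ * G) •
            (volume.withDensity fun x => ENNReal.ofReal ((Icc a₁ a₂).indicator f x / G)) +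
          ENNReal.ofReal κ • (volume.withDensity fun x => ENNReal.ofReal (φ x ^ 2)) := by
  set g := (Icc a₁ a₂).indicator f with hg
  have hg0 : ∀ x, 0 ≤ g x := fun x => Set.indicator_nonneg (fun x _ => hf0 x) x
  have hgf : ∀ x, g x ≤ f x := fun x => Set.indicator_le_self' (fun x _ => hf0 x) x
  have hgi : Integrable g := hfi.indicator measurableSet_Icc
  obtain ⟨x₀, hx₀, hfx₀⟩ : ∃ x₀ ∈ Ioo a₁ a₂, 0 < f x₀ := by
    by_contra! h
    have h1 : ∀ x ∈ Icc a₁ a₂, f x = 0 := by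
      have h2 : closure (Ioo a₁ a₂) ⊆ {x | f x = 0} :=
        closure_minimal (fun x hx => le_antisymm (h x hx) (hf0 x))
          (isClosed_eq hfc continuous_const)
      rw [closure_Ioo ha.ne] at h2
      exact h2
    have h3 : g = 0 := by
      funext x
      by_cases hx : x ∈ Icc a₁ a₂
      · simp [hg, hx, h1 x hx]
      · simp [hg, hx]
    simp [h3] at hG
    exact hG0.ne hG
  have hnhds : {x | f x₀ / 2 < f x} ∩ Ioo a₁ a₂ ∈ nhds x₀ :=
    inter_mem (hfc.continuousAt.eventually_const_lt (by linarith)) (isOpen_Ioo.mem_nhds hx₀)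
  obtain ⟨l, hl, hball⟩ := Metric.nhds_basis_closedBall.mem_iff.1 hnhds
  rw [Real.closedBall_eq_Icc] at hball
  obtain ⟨φ, hφc, hφs, hφ0, hφ1, hφl, ⟨Mφ, hMφ, hφM⟩, hQ⟩ := exists_bump x₀ hl
  have hφi : Integrable fun x => φ x ^ 2 := by
    by_contra h
    rw [integral_undef h] at hφ1
    norm_num at hφ1
  -- The weight `κ` makes `κ * φ ^ 2 ≤ f / 4`, and `θ ≤ 1 / 4`, so at least `f / 2` remains. That
  -- `κ` is fixed before `θ` matters: the share of pair subjects is later made small relative to it.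
  refine ⟨φ, hφc, hφs, hφ0, hφ1, fun x hx => hφl x fun h => hx (Ioo_subset_Icc_self (hball h).2),
    hQ, f x₀ / (8 * Mφ), by positivity, fun θ hθ hθ4 => ?_⟩
  set κ := f x₀ / (8 * Mφ) with hκ
  have hκ0 : 0 < κ := by positivity
  have hκφ : ∀ x, κ * φ x ^ 2 ≤ f x / 4 := by
    intro x
    by_cases hx : x ∈ Icc (x₀ - l) (x₀ + l)
    · have h1 : f x₀ / 2 < f x := (hball hx).1
      calc κ * φ x ^ 2 ≤ κ * Mφ := by gcongr; exact hφM x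
        _ = f x₀ / 8 := by rw [hκ]; field_simp
        _ ≤ _ := by linarith
    · rw [hφl x hx]
      have := hf0 x
      norm_num
      linarith
  set h₀ : ℝ → ℝ := fun x => f x - θ * g x - κ * φ x ^ 2 with hh₀
  have hh0 : ∀ x, f x / 2 ≤ h₀ x := by
    intro x
    have h1 := hκφ x
    have h2 : θ * g x ≤ 1 / 4 * f x := mul_le_mul hθ4 (hgf x) (hg0 x) (by norm_num)
    simp only [hh₀]
    linarith
  have hh0' : ∀ x, 0 ≤ h₀ x := fun x => by linarith [hh0 x, hf0 x]
  have hh0i : Integrable h₀ := (hfi.sub (hgi.const_mul θ)).sub (hφi.const_mul κ)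
  set c₀ := 1 - θ * G - κ with hc₀
  have hint : ∫ x, h₀ x = c₀ := by
    have h1 : ∫ x, h₀ x = ∫ x, (f x - θ * g x) - κ * φ x ^ 2 := rfl
    have h2 : Integrable fun x => f x - θ * g x := hfi.sub (hgi.const_mul θ)
    rw [h1, integral_sub h2 (hφi.const_mul κ),
      integral_sub hfi (hgi.const_mul θ), integral_const_mul, integral_const_mul, hf1, hG, hφ1,
      mul_one]
  have hc₀p : 0 < c₀ := by
    rw [← hint]
    have h1 : ∫ x, f x / 2 ≤ ∫ x, h₀ x := integral_mono (hfi.div_const 2) hh0i hh0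
    rw [integral_div, hf1] at h1
    linarith
  have hE : ∀ {u : ℝ → ℝ}, Integrable u → AEMeasurable (fun x => ENNReal.ofReal (u x)) :=
    fun hu => hu.aestronglyMeasurable.aemeasurable.ennreal_ofReal
  refine ⟨c₀, volume.withDensity fun x => ENNReal.ofReal (h₀ x / c₀), hc₀p.le, ⟨?_⟩, by
    rw [hc₀]; ring, ?_⟩
  · rw [withDensity_apply _ MeasurableSet.univ, Measure.restrict_univ,
      ← ofReal_integral_eq_lintegral_ofReal (hh0i.div_const _)
        (Eventually.of_forall fun x => div_nonneg (hh0' x) hc₀p.le), integral_div, hint,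
      div_self hc₀p.ne', ENNReal.ofReal_one]
  · ext s hs
    simp only [covariateLaw, Measure.add_apply, Measure.smul_apply, smul_eq_mul]
    rw [withDensity_apply _ hs, withDensity_apply _ hs, withDensity_apply _ hs,
      withDensity_apply _ hs, ← lintegral_const_mul'' _ (hE (hh0i.div_const _)).restrict,
      ← lintegral_const_mul'' _ (hE (hgi.div_const _)).restrict,
      ← lintegral_const_mul'' _ (hE hφi).restrict, ← lintegral_add_left', ← lintegral_add_left']
    · refine lintegral_congr fun x => ?_
      have e1 : 0 ≤ h₀ x / c₀ := div_nonneg (hh0' x) hc₀p.le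
      have e2 : 0 ≤ g x / G := div_nonneg (hg0 x) hG0.le
      rw [← ENNReal.ofReal_mul hc₀p.le, ← ENNReal.ofReal_mul (by positivity),
        ← ENNReal.ofReal_mul hκ0.le, ← ENNReal.ofReal_add (by positivity) (by positivity),
        ← ENNReal.ofReal_add (by positivity) (by positivity)]
      congr 1
      simp only [hh₀]
      field_simp
      ring
    · exact ((hE (hh0i.div_const _)).restrict.const_mul _).add
        ((hE (hgi.div_const _)).restrict.const_mul _)
    · exact (hE (hh0i.div_const _)).restrict.const_mul _

/-- The number of coordinates of a given type is at least half and at most one and a half times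
its expectation, with high probability. -/
theorem pi_card_type_deviation_le {ι A : Type*} [Fintype ι] [Fintype A] [DecidableEq A]
    [MeasurableSpace A] [DiscreteMeasurableSpace A] (ρ : Measure A) [IsProbabilityMeasure ρ]
    (a : A) {q : ℝ} (hq : ρ.real {a} = q) (hq0 : 0 < q) (S : Finset ι) {k : ℝ} (hk : 0 < k)
    (hS : k ≤ S.card) :
    (Measure.pi fun _ : ι => ρ).real {τ | ¬ (S.card * q / 2 ≤ (S.filter fun i => τ i = a).card ∧
      ((S.filter fun i => τ i = a).card : ℝ) ≤ 3 / 2 * (S.card * q))} ≤ 4 / (k * q ^ 2) := by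
  have hS0 : (0 : ℝ) < S.card := hk.trans_le hS
  have h := measureReal_pi_card_deviation ρ (MeasurableSet.of_discrete (s := {a})) S
    (s := S.card * q / 2) (by positivity)
  rw [hq] at h
  refine (measureReal_mono ?_).trans (h.trans ?_)
  · intro τ hτ
    simp only [Set.mem_ofPred_eq, Set.mem_singleton_iff] at hτ ⊢
    by_contra! h1
    rw [abs_lt] at h1
    exact hτ ⟨by linarith, by linarith⟩
  · calc S.card / (S.card * q / 2) ^ 2 = 4 / (S.card * q ^ 2) := by field_simp; norm_num
      _ ≤ _ := by gcongr

/-- A bound for the probability that no pair from `T × C` has a difference close to `d`. -/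
theorem measureReal_no_close_pair_le {ι : Type*} [Fintype ι] [DecidableEq ι] {g : ℝ → ℝ}
    (hg : Integrable g) (hgm : Measurable g) (hg0 : ∀ x, 0 ≤ g x) {c p₀ : ℝ} (hp₀ : 0 < p₀)
    (hp : ∀ t, |t| ≤ c → p₀ ≤ ∫ x, g (x + t) * g x) {M : ℝ} (hM : ∀ x, g x ≤ M)
    {d e : ℝ} (hd : |d| < c) (he0 : 0 < e) (he : e ≤ c)
    [IsProbabilityMeasure ((volume : Measure ℝ).withDensity fun x => ENNReal.ofReal (g x))]
    {T C : Finset ι} (hTC : Disjoint T C) (hT : T.Nonempty) (hC : C.Nonempty) :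
    (Measure.pi fun _ : ι =>
      (volume : Measure ℝ).withDensity fun x => ENNReal.ofReal (g x)).real
      {y | ∀ i ∈ T, ∀ j ∈ C, ¬ |y i - y j - d| ≤ e} ≤
      1 / (T.card * C.card * (e * p₀)) + (1 / T.card + 1 / C.card) * (2 * M / p₀) ^ 2 := by
  have hM0 : 0 ≤ M := (hg0 0).trans (hM 0)
  have hW : MeasurableSet {q : ℝ × ℝ | |q.1 - q.2 - d| ≤ e} :=
    measurableSet_le (by fun_prop) measurable_const
  have h1 := measureReal_abs_sub_le_ge hg hgm hg0 hp₀.le hp hM hd he0.le he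
  have hsec : ∀ s : Set ℝ, (∃ z, s ⊆ Icc (z - e) (z + e)) →
      ((volume : Measure ℝ).withDensity fun x => ENNReal.ofReal (g x)).real s ≤ 2 * e * M := by
    rintro s ⟨z, hz⟩
    refine measureReal_withDensity_le hM hM0 s (by positivity) ?_
    refine (measure_mono hz).trans ?_
    rw [Real.volume_Icc]
    exact ENNReal.ofReal_le_ofReal (by linarith only)
  have h2 := measureReal_no_pair_le (ι := ι) _ hW (m := 2 * e * M)
    (by positivity) (mul_pos he0 hp₀) h1
    (fun u => hsec _ ⟨u - d, fun v hv => by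
      simp only [Set.mem_ofPred_eq, abs_le] at hv
      exact ⟨by linarith only [hv.2], by linarith only [hv.1]⟩⟩)
    (fun v => hsec _ ⟨v + d, fun u hu => by
      simp only [Set.mem_ofPred_eq, abs_le] at hu
      exact ⟨by linarith only [hu.1], by linarith only [hu.2]⟩⟩) hTC hT hC
  refine h2.trans (le_of_eq ?_)
  congr 3
  field_simp

/-- The constant in `e` makes the expected number of hits at least `12 / ε`, which bounds the first
term by `ε / 12`; the second term is of order `1 / n`. -/
theorem no_close_pair_bound_le {n q ε p₀ M e x y : ℝ} (hn0 : 0 < n) (hq0 : 0 < q) (hε : 0 < ε)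
    (hp₀ : 0 < p₀) (he : e = 48 / (ε * q ^ 2 * p₀) / n ^ 2)
    (hn : 48 / (q * ε) * (2 * M / p₀) ^ 2 ≤ n) (hx : n * q / 2 ≤ x) (hy : n * q / 2 ≤ y) :
    1 / (x * y * (e * p₀)) + (1 / x + 1 / y) * (2 * M / p₀) ^ 2 ≤ ε / 6 := by
  have he0 : 0 < e := by rw [he]; positivity
  have hx0 : 0 < x := lt_of_lt_of_le (by positivity) hx
  have hy0 : 0 < y := lt_of_lt_of_le (by positivity) hy
  have h3 : 1 / (x * y * (e * p₀)) ≤ ε / 12 := by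
    calc 1 / (x * y * (e * p₀)) ≤ 1 / ((n * q / 2) * (n * q / 2) * (e * p₀)) := by gcongr
      _ = ε / 12 := by
          rw [he]
          field_simp
          norm_num
  have h4 : (1 / x + 1 / y) * (2 * M / p₀) ^ 2 ≤ ε / 12 := by
    calc (1 / x + 1 / y) * (2 * M / p₀) ^ 2
        ≤ (1 / (n * q / 2) + 1 / (n * q / 2)) * (2 * M / p₀) ^ 2 := by gcongr
      _ = 48 / (q * ε) * (2 * M / p₀) ^ 2 * (ε / 12 / n) := by
          field_simp
          ring
      _ ≤ n * (ε / 12 / n) := by gcongr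
      _ = ε / 12 := by field_simp
  linarith only [h3, h4]

open ProbabilityTheory in
/-- With high probability, if the greedy phase stops with a small difference, then some pair of
subjects from the central interval brings the difference within `O(n⁻²)` of zero. -/
theorem exists_lastSwitch {f : ℝ → ℝ} (hf0 : ∀ x, 0 ≤ f x) (hfc : Continuous f)
    (hfi : Integrable f) (hf1 : ∫ x, f x = 1) {M : ℝ} (hM : ∀ x, f x ≤ M) {a₁ a₂ : ℝ}
    (ha : a₁ < a₂) {c : ℝ} (hc : 0 < c) {p₀ : ℝ} (hp₀ : 0 < p₀)
    (hp : ∀ t, |t| ≤ c / 2 →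
      p₀ ≤ ∫ x, (Icc a₁ a₂).indicator f (x + t) * (Icc a₁ a₂).indicator f x)
    {ε : ℝ} (hε : 0 < ε) :
    ∃ K : ℝ, 0 < K ∧ ∃ N : ℕ, ∀ n ≥ N, ∀ w₀ : Allocation n, IsBalanced w₀ → ∀ m : ℕ,
      Measure.pi (fun _ => covariateLaw f) (LastSwitchFails w₀ m a₁ a₂ c (K / (n : ℝ) ^ 2)
        fun x => {i | x i ∈ Icc a₁ a₂}) ≤ ENNReal.ofReal ε := by
  classical
  set g := (Icc a₁ a₂).indicator f with hg
  have hg0 : ∀ x, 0 ≤ g x := fun x => Set.indicator_nonneg (fun x _ => hf0 x) x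
  have hgf : ∀ x, g x ≤ f x := fun x => Set.indicator_le_self' (fun x _ => hf0 x) x
  have hgi : Integrable g := hfi.indicator measurableSet_Icc
  have hgm : Measurable g := hfc.measurable.indicator measurableSet_Icc
  have hM0 : 0 ≤ M := (hf0 0).trans (hM 0)
  set G := ∫ x, g x with hG
  have hG1 : G ≤ 1 := hf1 ▸ integral_mono hgi hfi hgf
  have hG0 : 0 < G := by
    refine (integral_nonneg hg0).lt_of_ne fun h => ?_
    have h1 : g =ᵐ[volume] 0 := (integral_eq_zero_iff_of_nonneg hg0 hgi).1 h.symm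
    have h2 : ∫ x, g (x + 0) * g x = 0 := by
      rw [integral_eq_zero_of_ae]
      filter_upwards [h1] with x hx
      simp [hx]
    have h3 := hp 0 (by simp; positivity)
    linarith
  obtain ⟨φ, hφc, hφs, hφ0, hφ1, hφJ, ⟨Q, hQ0, hQ⟩, κ, hκ, hmix⟩ :=
    exists_mixture hf0 hfc hfi hf1 ha hG.symm hG0
  have hφi : Integrable fun x => φ x ^ 2 := by
    by_contra h
    rw [integral_undef h] at hφ1
    norm_num at hφ1
  set ν₁ := (volume : Measure ℝ).withDensity fun x => ENNReal.ofReal (g x / G) with hν₁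
  set ν₂ := (volume : Measure ℝ).withDensity fun x => ENNReal.ofReal (φ x ^ 2) with hν₂
  have hprob : ∀ {u : ℝ → ℝ}, (∀ x, 0 ≤ u x) → Integrable u → ∫ x, u x = 1 →
      IsProbabilityMeasure ((volume : Measure ℝ).withDensity fun x => ENNReal.ofReal (u x)) := by
    intro u hu0 hui hu1
    refine ⟨?_⟩
    rw [withDensity_apply _ MeasurableSet.univ, Measure.restrict_univ,
      ← ofReal_integral_eq_lintegral_ofReal hui (Eventually.of_forall hu0), hu1,
      ENNReal.ofReal_one]
  have hgG0 : ∀ x, 0 ≤ g x / G := fun x => div_nonneg (hg0 x) hG0.le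
  have hν₁p : IsProbabilityMeasure ν₁ :=
    hprob hgG0 (hgi.div_const _) (by rw [integral_div, ← hG, div_self hG0.ne'])
  have hν₂p : IsProbabilityMeasure ν₂ := hprob (fun x => sq_nonneg _) hφi hφ1
  have hsupp : ∀ {u : ℝ → ℝ}, (∀ x ∉ Icc a₁ a₂, u x = 0) →
      ∀ᵐ x ∂((volume : Measure ℝ).withDensity fun x => ENNReal.ofReal (u x)), x ∈ Icc a₁ a₂ := by
    intro u hu
    change (volume.withDensity fun x => ENNReal.ofReal (u x)) (Icc a₁ a₂)ᶜ = 0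
    rw [withDensity_apply _ measurableSet_Icc.compl,
      setLIntegral_congr_fun (g := fun _ => 0) measurableSet_Icc.compl fun x hx => by
        simp [hu x hx]]
    simp
  have hν₁J : ∀ᵐ x ∂ν₁, x ∈ Icc a₁ a₂ := hsupp fun x hx => by simp [hg, hx]
  have hν₂J : ∀ᵐ x ∂ν₂, x ∈ Icc a₁ a₂ := hsupp fun x hx => by simp [hφJ x hx]
  have hν₁2 : MemLp id 2 ν₁ := by
    refine MemLp.of_bound aestronglyMeasurable_id (max |a₁| |a₂|) ?_
    filter_upwards [hν₁J] with x hx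
    exact abs_le_max_abs_abs hx.1 hx.2
  set V := Var[id; ν₁] with hV
  have hV0 : 0 ≤ V := variance_nonneg _ _
  have hpG : ∀ t, |t| ≤ c / 2 → p₀ ≤ ∫ x, g (x + t) / G * (g x / G) := by
    intro t ht
    have h1 : ∀ x, g (x + t) / G * (g x / G) = g (x + t) * g x / G ^ 2 := fun x => by
      field_simp
    simp_rw [h1]
    rw [integral_div, le_div_iff₀ (by positivity)]
    have h2 := hp t ht
    have h3 : G ^ 2 ≤ 1 := pow_le_one₀ hG0.le hG1
    nlinarith
  have hgM : ∀ x, g x / G ≤ M / G := fun x => by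
    gcongr
    exact (hgf x).trans (hM x)
  set η := ε / 12 with hη
  have hη0 : 0 < η := by positivity
  -- At most `3 n θ` pair subjects face at least `n κ` reservoir subjects, so this `θ` makes the
  -- translation cost at most `ε / 6`; the choice of `η` makes the remaining `2 * η` equal to `ε /
  -- 6`.
  set θ := min (1 / 4) (ε * η * κ / (9 * (Q * V + 1))) with hθ
  have hQV : 0 ≤ Q * V := by positivity
  have hθ0 : 0 < θ := lt_min (by norm_num) (by positivity)
  obtain ⟨c₀, ν₀, hc₀, hν₀p, hsum, hmix⟩ := hmix θ hθ0 (min_le_left _ _)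
  have hθV : 3 * Q * θ * V / (2 * η * κ) ≤ ε / 6 := by
    have h1 : θ ≤ ε * η * κ / (9 * (Q * V + 1)) := min_le_right _ _
    rw [le_div_iff₀ (by positivity)] at h1
    rw [div_le_iff₀ (by positivity)]
    nlinarith [hθ0]
  set q := θ * G with hq
  have hq0 : 0 < q := by positivity
  set K := 48 / (ε * q ^ 2 * p₀) with hK
  have hK0 : 0 < K := by positivity
  obtain ⟨N, hN⟩ := exists_nat_ge (32 / (ε * q ^ 2) + 32 / (ε * κ ^ 2) +
    48 / (q * ε) * (2 * (M / G) / p₀) ^ 2 + 2 * K / c + 3)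
  refine ⟨K, hK0, N, fun n hn w₀ hw₀ m => ?_⟩
  have hnr : 32 / (ε * q ^ 2) + 32 / (ε * κ ^ 2) +
    48 / (q * ε) * (2 * (M / G) / p₀) ^ 2 + 2 * K / c + 3 ≤ n := hN.trans (by exact_mod_cast hn)
  have t1 : 0 ≤ 32 / (ε * q ^ 2) := by positivity
  have t2 : 0 ≤ 32 / (ε * κ ^ 2) := by positivity
  have t3 : 0 ≤ 48 / (q * ε) * (2 * (M / G) / p₀) ^ 2 := by positivity
  have t4 : 0 ≤ 2 * K / c := by positivity
  have hn1 : 32 / (ε * q ^ 2) ≤ n := by linarith only [hnr, t1, t2, t3, t4]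
  have hn2 : 32 / (ε * κ ^ 2) ≤ n := by linarith only [hnr, t1, t2, t3, t4]
  have hn3 : 48 / (q * ε) * (2 * (M / G) / p₀) ^ 2 ≤ n := by linarith only [hnr, t1, t2, t3, t4]
  have hn4 : 2 * K / c ≤ n := by linarith only [hnr, t1, t2, t3, t4]
  have hn5 : (3 : ℝ) ≤ n := by linarith only [hnr, t1, t2, t3, t4]
  have hn6 : 3 ≤ n := by exact_mod_cast hn5
  have hn0 : (0 : ℝ) < n := by linarith only [hn5]
  clear hnr hN t1 t2 t3 t4
  set e := K / (n : ℝ) ^ 2 with he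
  have he0 : 0 < e := by positivity
  have hec : e ≤ c / 2 := by
    rw [he, div_le_iff₀ (by positivity)]
    rw [div_le_iff₀ hc] at hn4
    nlinarith only [hn4, hn5, hc, mul_pos hn0 hc]
  set ν : Fin 3 → Measure ℝ := ![ν₀, ν₁, ν₂] with hν
  have hνp : ∀ a, IsProbabilityMeasure (ν a) := by
    intro a
    fin_cases a
    · exact hν₀p
    · exact hν₁p
    · exact hν₂p
  set cs : Fin 3 → ENNReal := ![ENNReal.ofReal c₀, ENNReal.ofReal q, ENNReal.ofReal κ] with hcs
  have hcs1 : ∑ a, cs a = 1 := by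
    rw [Fin.sum_univ_three]
    simp only [hcs, Matrix.cons_val_zero, Matrix.cons_val_one, Matrix.cons_val]
    rw [← ENNReal.ofReal_add hc₀ hq0.le, ← ENNReal.ofReal_add (by positivity) hκ.le, hsum,
      ENNReal.ofReal_one]
  have hlaw : covariateLaw f = ∑ a, cs a • ν a := by
    rw [Fin.sum_univ_three, hmix]
    simp only [hcs, hν, Matrix.cons_val_zero, Matrix.cons_val_one, Matrix.cons_val]
  set ρ : Measure (Fin 3) := ∑ a, cs a • Measure.dirac a with hρ
  have hρp : IsProbabilityMeasure ρ := ⟨by simp [hρ, hcs1]⟩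
  have hρ1 : ρ.real {1} = q := by
    rw [measureReal_def, hρ, Fin.sum_univ_three]
    simp [hcs, hq0.le]
  have hρ2 : ρ.real {2} = κ := by
    rw [measureReal_def, hρ, Fin.sum_univ_three]
    simp [hcs, hκ.le]
  set S₁ : Finset (Fin (2 * n)) := Finset.univ.filter fun i => w₀ i = true with hS₁
  set S₂ : Finset (Fin (2 * n)) := Finset.univ.filter fun i => w₀ i = false with hS₂
  have hS₁c : (S₁.card : ℝ) = n := by exact_mod_cast hw₀
  have hS₂c : (S₂.card : ℝ) = n := by exact_mod_cast hw₀.card_false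
  have hSc : ((Finset.univ : Finset (Fin (2 * n))).card : ℝ) = 2 * n := by simp
  -- The type counts that matter are those of pairs in each group, of pairs in total and of the
  -- reservoir.
  set bad : Finset (Fin (2 * n)) → Fin 3 → ℝ → Set (Fin (2 * n) → Fin 3) := fun S a q =>
    {τ | ¬ (S.card * q / 2 ≤ (S.filter fun i => τ i = a).card ∧
      ((S.filter fun i => τ i = a).card : ℝ) ≤ 3 / 2 * (S.card * q))} with hbad
  set B := bad S₁ 1 q ∪ bad S₂ 1 q ∪ bad Finset.univ 1 q ∪ bad Finset.univ 2 κ with hB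
  have hBle : (Measure.pi fun _ : Fin (2 * n) => ρ).real B ≤ ε / 2 := by
    have e1 : 4 / (n * q ^ 2) ≤ ε / 8 := by
      rw [div_le_iff₀ (by positivity)] at hn1 ⊢
      linarith only [hn1]
    have e2 : 4 / (n * κ ^ 2) ≤ ε / 8 := by
      rw [div_le_iff₀ (by positivity)] at hn2 ⊢
      linarith only [hn2]
    have b1 := pi_card_type_deviation_le ρ 1 hρ1 hq0 S₁ hn0 hS₁c.ge
    have b2 := pi_card_type_deviation_le ρ 1 hρ1 hq0 S₂ hn0 hS₂c.ge
    have b3 := pi_card_type_deviation_le ρ 1 hρ1 hq0 (Finset.univ : Finset (Fin (2 * n))) hn0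
      (by rw [hSc]; linarith only [hn0])
    have b4 := pi_card_type_deviation_le ρ 2 hρ2 hκ (Finset.univ : Finset (Fin (2 * n))) hn0
      (by rw [hSc]; linarith only [hn0])
    have u1 := measureReal_union_le (μ := Measure.pi fun _ : Fin (2 * n) => ρ)
      (bad S₁ 1 q ∪ bad S₂ 1 q ∪ bad Finset.univ 1 q) (bad Finset.univ 2 κ)
    have u2 := measureReal_union_le (μ := Measure.pi fun _ : Fin (2 * n) => ρ)
      (bad S₁ 1 q ∪ bad S₂ 1 q) (bad Finset.univ 1 q)
    have u3 := measureReal_union_le (μ := Measure.pi fun _ : Fin (2 * n) => ρ)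
      (bad S₁ 1 q) (bad S₂ 1 q)
    linarith only [e1, e2, b1, b2, b3, b4, u1, u2, u3]
  have hτle : ∀ τ ∉ B, Measure.pi (fun i => ν (τ i)) (LastSwitchFails w₀ m a₁ a₂ c e
      fun x => {i | x i ∈ Icc a₁ a₂}) ≤ ENNReal.ofReal (ε / 2) := by
    intro τ hτ
    simp only [hB, hbad, Set.mem_union, not_or, Set.mem_ofPred_eq, not_not, Finset.filter_filter,
      hS₁, hS₂] at hτ
    rw [← hS₁, ← hS₂, hS₁c, hS₂c, hSc] at hτ
    obtain ⟨⟨⟨⟨hT, -⟩, ⟨hC, -⟩⟩, ⟨-, hP⟩⟩, ⟨hR, -⟩⟩ := hτ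
    simp only [and_comm (a := w₀ _ = _)] at hT hC
    set T := Finset.univ.filter fun i => τ i = 1 ∧ w₀ i = true with hTdef
    set C := Finset.univ.filter fun i => τ i = 1 ∧ w₀ i = false with hCdef
    have hT0 : (0 : ℝ) < T.card := lt_of_lt_of_le (by positivity) hT
    have hC0 : (0 : ℝ) < C.card := lt_of_lt_of_le (by positivity) hC
    have hR0 : (0 : ℝ) < (Finset.univ.filter fun i => τ i = 2).card :=
      lt_of_lt_of_le (by positivity) hR
    have hTC : Disjoint T C := by
      refine Finset.disjoint_left.2 fun i hi hi' => ?_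
      simp only [hTdef, hCdef, Finset.mem_filter] at hi hi'
      simp [hi.2.2] at hi'
    have hhit : ∀ d, |d| < c / 2 → (Measure.pi fun _ : Fin (2 * n) => ν 1).real
        {y | ∀ i ∈ T, ∀ j ∈ C, ¬ |y i - y j - d| ≤ e} ≤ ε / 6 := by
      intro d hd
      have h2 := measureReal_no_close_pair_le (hgi.div_const G) (hgm.div_const G) hgG0 hp₀ hpG hgM
        hd he0 hec hTC (Finset.card_pos.1 (by exact_mod_cast hT0))
        (Finset.card_pos.1 (by exact_mod_cast hC0))
      exact h2.trans (no_close_pair_bound_le hn0 hq0 hε hp₀ rfl hn3 hT hC)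
    have hmain := pi_lastSwitchFails_le hn6 w₀ m ha.le τ ν hν₁J hν₂J hν₁2 (le_refl V) hφc hφs hφ0
      hφ1 hQ0 hQ rfl (Finset.card_pos.1 (by exact_mod_cast hR0)) (by positivity) hhit hη0
    -- Pair subjects are central almost surely, so failure for all central pairs implies failure for
    -- all pairs of type `1`.
    have hae : ∀ᵐ x ∂(Measure.pi fun i => ν (τ i)), ∀ i, τ i = 1 → x i ∈ Icc a₁ a₂ := by
      refine ae_all_iff.2 fun i => ?_
      by_cases hi : τ i = 1
      · have h1 : ∀ᵐ x ∂(ν (τ i)), x ∈ Icc a₁ a₂ := by rw [hi]; exact hν₁J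
        filter_upwards [(measurePreserving_eval (fun i => ν (τ i)) i).quasiMeasurePreserving.ae h1]
          with x hx _ using hx
      · exact Eventually.of_forall fun x h => absurd h hi
    refine le_trans (measure_mono_ae ?_) (hmain.trans (ENNReal.ofReal_le_ofReal ?_))
    · filter_upwards [hae] with x hx hxF
      obtain ⟨h1, h2, h3, v, h4, h5, h6⟩ := hxF
      exact ⟨h1, h2, h3, v, h4, h5, fun i hi j hj => h6 i (hx i hi) j (hx j hj)⟩
    · have h1 : Q * ((Finset.univ.filter fun i => τ i = 1).card * V) /
          (2 * η * (Finset.univ.filter fun i => τ i = 2).card) ≤ ε / 6 := by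
        refine le_trans ?_ hθV
        have hPθ : ((Finset.univ.filter fun i => τ i = 1).card : ℝ) ≤ 3 * n * θ := by
          refine hP.trans ?_
          have : q ≤ θ := by
            rw [hq]
            exact mul_le_of_le_one_right hθ0.le hG1
          nlinarith only [this, hn0]
        have hRκ : n * κ ≤ ((Finset.univ.filter fun i => τ i = 2).card : ℝ) := by
          linarith only [hR]
        calc _ ≤ Q * (3 * n * θ * V) / (2 * η * (n * κ)) := by gcongr
          _ = _ := by field_simp
      have h2 : 2 * η = ε / 6 := by rw [hη]; ring
      linarith only [h1, h2]
  rw [hlaw]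
  refine (pi_mixture_le cs ν hcs1 B _ hτle).trans ?_
  rw [← hρ, ← ofReal_measureReal, ← ENNReal.ofReal_add measureReal_nonneg (by positivity)]
  exact ENNReal.ofReal_le_ofReal (by linarith only [hBle])

/-! ### Properties of the density, the standard deviation and the experiment -/

/-- The tail bound controls the complement of a compact set, and continuity controls the compact
set. Including `[-1, 1]` in it allows `1 + |x| ≤ 2 * |x|` outside. -/
theorem exists_decay_bound {f : ℝ → ℝ} (hf0 : ∀ x, 0 ≤ f x) (hfc : Continuous f) {r : ℝ}
    (hr : 0 < r) (hf_tail : f =O[cocompact ℝ] fun x => |x| ^ (-r)) :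
    ∃ B, 0 ≤ B ∧ ∀ x, f x ≤ B * (1 + |x|) ^ (-r) := by
  obtain ⟨C, hC⟩ := hf_tail.bound
  obtain ⟨S, hS, hSC⟩ := mem_cocompact.1 hC
  set S' := S ∪ Icc (-1) 1 with hS'
  have hS'c : IsCompact S' := hS.union isCompact_Icc
  have hpos : ∀ x : ℝ, 0 < 1 + |x| := fun x => by positivity
  set h : ℝ → ℝ := fun x => f x * (1 + |x|) ^ r with hh
  have hhc : Continuous h :=
    hfc.mul (Continuous.rpow_const (by fun_prop) fun x => Or.inl (hpos x).ne')
  obtain ⟨D, hD⟩ := hS'c.bddAbove_image hhc.continuousOn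
  have hD' : ∀ x ∈ S', h x ≤ D := fun x hx => hD (Set.mem_image_of_mem h hx)
  have hkey : ∀ x, h x ≤ max (max D (|C| * 2 ^ r)) 0 := by
    intro x
    refine le_trans ?_ (le_max_left _ _)
    by_cases hx : x ∈ S'
    · exact (hD' x hx).trans (le_max_left _ _)
    · refine le_trans ?_ (le_max_right _ _)
      simp only [hS', Set.mem_union, not_or] at hx
      have hx1 : 1 ≤ |x| := by
        by_contra! h1
        rw [abs_lt] at h1
        exact hx.2 ⟨h1.1.le, h1.2.le⟩
      have hx0 : 0 < |x| := by linarith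
      have h1 : ‖f x‖ ≤ C * ‖|x| ^ (-r)‖ := hSC hx.1
      rw [Real.norm_of_nonneg (hf0 x), Real.norm_of_nonneg (by positivity)] at h1
      calc h x ≤ |C| * |x| ^ (-r) * (2 * |x|) ^ r := by
            simp only [hh]
            gcongr
            · exact h1.trans (by gcongr; exact le_abs_self C)
            · linarith
        _ = |C| * 2 ^ r := by
            rw [Real.mul_rpow (by norm_num) hx0.le, Real.rpow_neg hx0.le]
            have : |x| ^ r ≠ 0 := by positivity
            field_simp
  refine ⟨max (max D (|C| * 2 ^ r)) 0, le_max_right _ _, fun x => ?_⟩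
  rw [Real.rpow_neg (hpos x).le, ← div_eq_mul_inv, le_div_iff₀ (by have := hpos x; positivity)]
  exact hkey x

theorem covariateLaw_le {f : ℝ → ℝ} {m : ℝ} (hm : 0 ≤ m) {s : Set ℝ} (hs : MeasurableSet s)
    (hf : ∀ x ∈ s, f x ≤ m) {l : ℝ} (hl : 0 ≤ l) (hsl : volume s ≤ ENNReal.ofReal l) :
    (covariateLaw f).real s ≤ m * l := by
  refine ENNReal.toReal_le_of_le_ofReal (by positivity) ?_
  unfold covariateLaw
  rw [withDensity_apply _ hs]
  calc ∫⁻ x in s, ENNReal.ofReal (f x) ≤ ∫⁻ _ in s, ENNReal.ofReal m :=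
        setLIntegral_mono' hs fun x hx => ENNReal.ofReal_le_ofReal (hf x hx)
    _ = ENNReal.ofReal m * volume s := setLIntegral_const _ _
    _ ≤ ENNReal.ofReal m * ENNReal.ofReal l := by gcongr
    _ = _ := (ENNReal.ofReal_mul hm).symm

theorem continuous_pairDensity {f : ℝ → ℝ} (hf0 : ∀ x, 0 ≤ f x) (hfc : Continuous f)
    (hfi : Integrable f) {M : ℝ} (hM : ∀ x, f x ≤ M) : Continuous (pairDensity f) := by
  unfold pairDensity
  refine continuous_of_dominated (bound := fun x => M * f x) (fun t => ?_) (fun t => ?_)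
    (hfi.const_mul M) ?_
  · exact Continuous.aestronglyMeasurable (by fun_prop)
  · refine Eventually.of_forall fun x => ?_
    rw [Real.norm_of_nonneg (mul_nonneg (hf0 _) (hf0 _))]
    exact mul_le_mul_of_nonneg_right (hM _) (hf0 x)
  · exact Eventually.of_forall fun x => by fun_prop

/-- The density of the difference is still bounded below after restriction to an interval of
almost full measure. -/
theorem pairDensity_indicator_ge {f : ℝ → ℝ} (hf0 : ∀ x, 0 ≤ f x) (hfc : Continuous f)
    (hfi : Integrable f) (hf1 : ∫ x, f x = 1) {M : ℝ} (hM : ∀ x, f x ≤ M) {s : Set ℝ}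
    (hs : MeasurableSet s) (t : ℝ) :
    pairDensity f |t| - 2 * M * (1 - ∫ x, s.indicator f x) ≤
      ∫ x, s.indicator f (x + t) * s.indicator f x := by
  set g := s.indicator f with hg
  have hg0 : ∀ x, 0 ≤ g x := fun x => Set.indicator_nonneg (fun x _ => hf0 x) x
  have hgf : ∀ x, g x ≤ f x := fun x => Set.indicator_le_self' (fun x _ => hf0 x) x
  have hgi : Integrable g := hfi.indicator hs
  have hgm : Measurable g := hfc.measurable.indicator hs
  have hM0 : 0 ≤ M := (hf0 0).trans (hM 0)
  have hmul : ∀ {u : ℝ → ℝ}, Measurable u → (∀ x, 0 ≤ u x) → (∀ x, u x ≤ f x) →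
      Integrable u → ∀ t, Integrable fun x => u (x + t) * u x := by
    intro u hum hu0 huf hui t
    refine hui.bdd_mul (c := M) (hum.comp (by fun_prop)).aestronglyMeasurable
      (Eventually.of_forall fun x => ?_)
    rw [Real.norm_of_nonneg (hu0 _)]
    exact (huf _).trans (hM _)
  have key : ∀ t, pairDensity f t - 2 * M * (1 - ∫ x, g x) ≤ ∫ x, g (x + t) * g x := by
    intro t
    have hi1 := hmul hfc.measurable hf0 (fun x => le_rfl) hfi t
    have hi2 := hmul hgm hg0 hgf hgi t
    have hi3 : Integrable fun x => M * (f x - g x) := (hfi.sub hgi).const_mul M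
    have hi4 : Integrable fun x => M * (f (x + t) - g (x + t)) :=
      ((hfi.sub hgi).comp_add_right t).const_mul M
    have h1 : ∀ x, f (x + t) * f x ≤ g (x + t) * g x + (M * (f x - g x) +
        M * (f (x + t) - g (x + t))) := by
      intro x
      have h2 := mul_le_mul_of_nonneg_right (hM (x + t)) (sub_nonneg.2 (hgf x))
      have h3 := mul_le_mul_of_nonneg_left ((hgf x).trans (hM x)) (sub_nonneg.2 (hgf (x + t)))
      linarith
    have hi5 : Integrable fun x => M * (f x - g x) + M * (f (x + t) - g (x + t)) := hi3.add hi4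
    have h2 := integral_mono hi1 (hi2.add hi5) h1
    simp only [Pi.add_def] at h2
    rw [integral_add hi2 hi5, integral_add hi3 hi4,
      integral_const_mul, integral_const_mul, integral_sub hfi hgi,
      integral_add_right_eq_self (fun x => f x - g x) t, integral_sub hfi hgi, hf1] at h2
    unfold pairDensity
    linarith
  -- The autocorrelation is even, by the translation `x ↦ x + t`.
  rcases abs_choice t with h | h
  · rw [h]
    exact key t
  · rw [h]
    refine (key (-t)).trans (le_of_eq ?_)
    rw [← integral_add_right_eq_self (fun x => g (x + -t) * g x) t]
    refine integral_congr_ae (Eventually.of_forall fun x => ?_)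
    simp only [add_neg_cancel_right]
    ring

/-- Lower bound for the standard deviation when both tails are populated. -/
theorem sampleSD_ge {n : ℕ} (hn : 0 < n) {x : Fin (2 * n) → ℝ} {a₁ a₂ s : ℝ} (ha : a₁ ≤ a₂)
    (hs : 0 ≤ s)
    (h₁ : n * s ≤ (Finset.univ.filter fun i => x i < a₁).card)
    (h₂ : n * s ≤ (Finset.univ.filter fun i => a₂ < x i).card) :
    Real.sqrt (s * (a₂ - a₁) ^ 2 / 8) ≤ sampleSD x := by
  have hn0 : (1 : ℝ) ≤ n := by exact_mod_cast hn
  unfold sampleSD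
  refine Real.sqrt_le_sqrt ?_
  have hmain : n * s * ((a₂ - a₁) / 2) ^ 2 ≤ ∑ i, (x i - overallMean x) ^ 2 := by
    have hcount : ∀ A : Finset (Fin (2 * n)), n * s ≤ A.card →
        (∀ i ∈ A, (a₂ - a₁) / 2 ≤ |x i - overallMean x|) →
        n * s * ((a₂ - a₁) / 2) ^ 2 ≤ ∑ i, (x i - overallMean x) ^ 2 := by
      intro A hA hAx
      calc n * s * ((a₂ - a₁) / 2) ^ 2 ≤ A.card * ((a₂ - a₁) / 2) ^ 2 := by gcongr
        _ = ∑ i ∈ A, ((a₂ - a₁) / 2) ^ 2 := by rw [Finset.sum_const, nsmul_eq_mul]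
        _ ≤ ∑ i ∈ A, (x i - overallMean x) ^ 2 := Finset.sum_le_sum fun i hi => by
            rw [← sq_abs (x i - overallMean x)]
            have := hAx i hi
            have h0 : 0 ≤ a₂ - a₁ := by linarith
            gcongr
        _ ≤ _ := Finset.sum_le_sum_of_subset_of_nonneg (Finset.subset_univ _)
            fun i _ _ => sq_nonneg _
    -- Wherever the mean lies, one of the two tails is at distance at least `(a₂ - a₁) / 2` from it.
    rcases le_total (overallMean x) ((a₁ + a₂) / 2) with h | h
    · refine hcount _ h₂ fun i hi => ?_
      rw [Finset.mem_filter] at hi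
      exact le_trans (by linarith [hi.2]) (le_abs_self _)
    · refine hcount _ h₁ fun i hi => ?_
      rw [Finset.mem_filter] at hi
      exact le_trans (by linarith [hi.2]) (neg_le_abs _)
  rw [le_div_iff₀ (by linarith)]
  have : 0 ≤ s * (a₂ - a₁) ^ 2 := by positivity
  nlinarith

theorem balance_eq {n : ℕ} (x : Fin (2 * n) → ℝ) (w : Allocation n) :
    balance x w = |diffSum x w| / (n * sampleSD x) := by
  have h : 0 ≤ sampleSD x := Real.sqrt_nonneg _
  unfold balance diffSum
  rw [← sub_div, div_div, abs_div, abs_of_nonneg (mul_nonneg n.cast_nonneg h)]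

/-- If a good pair of subjects outside the extremes exists, then the final switch makes the
difference small. -/
theorem abs_diffSum_le_of_isBestSwitch {n : ℕ} {x : Fin (2 * n) → ℝ} {S : Set (Fin (2 * n))}
    {c e : ℝ} {w₀ v w : Allocation n} (hv : IsStop (diffSum x) S c w₀ v)
    (hw : IsBestSwitch x Set.univ v w) {i j : Fin (2 * n)} (hi : i ∉ S) (hj : j ∉ S)
    (hwi : w₀ i = true) (hwj : w₀ j = false) (he : |x i - x j - diffSum x v / 2| ≤ e) :
    |diffSum x w| ≤ 2 * e := by
  have hvi : v i = true := (reflTransGen_eq_of_notMem hv.1 hi).trans hwi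
  have hvj : v j = false := (reflTransGen_eq_of_notMem hv.1 hj).trans hwj
  have h1 := hw.2 _ ⟨i, trivial, j, trivial, hvi, hvj, rfl⟩
  rw [diffSum_swap x v hvi hvj] at h1
  refine h1.trans ?_
  rw [show diffSum x v - 2 * (x i - x j) = -(2 * (x i - x j - diffSum x v / 2)) by ring, abs_neg,
    abs_mul, abs_of_pos (by norm_num : (0 : ℝ) < 2)]
  linarith

theorem exists_isBalanced (n : ℕ) : ∃ w : Allocation n, IsBalanced w := by
  obtain ⟨A, -, hA⟩ := Finset.exists_subset_card_eq
    (show n ≤ (Finset.univ : Finset (Fin (2 * n))).card by simp; omega)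
  refine ⟨fun i => decide (i ∈ A), ?_⟩
  simp [IsBalanced, hA]

open ProbabilityTheory in
/-- A bound that holds for every balanced initial allocation holds for a random one. -/
theorem experimentLaw_ge {f : ℝ → ℝ} [IsProbabilityMeasure (covariateLaw f)] {n : ℕ}
    (S : Set ((Fin (2 * n) → ℝ) × Allocation n)) {δ : ℝ}
    (h : ∀ w₀, IsBalanced w₀ →
      (Measure.pi fun _ => covariateLaw f).real {x | (x, w₀) ∉ S} ≤ δ) :
    1 - δ ≤ (experimentLaw f n).real S := by
  classical
  unfold experimentLaw
  set P := Measure.pi fun _ : Fin (2 * n) => covariateLaw f with hP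
  have hfin : {w : Allocation n | IsBalanced w}.Finite := Set.toFinite _
  have hU : IsProbabilityMeasure (uniformOn {w : Allocation n | IsBalanced w}) :=
    isProbabilityMeasure_uniformOn hfin (exists_isBalanced n)
  set U := uniformOn {w : Allocation n | IsBalanced w} with hUdef
  have hcompl : (P.prod U).real Sᶜ ≤ δ := by
    have hsub : Sᶜ ⊆ ⋃ w₀ ∈ (Finset.univ : Finset (Allocation n)), {x | (x, w₀) ∉ S} ×ˢ {w₀} := by
      rintro ⟨x, w₀⟩ hx
      simpa using hx
    refine (measureReal_mono hsub (measure_ne_top _ _)).trans ((measureReal_biUnion_finset_le _ _).trans ?_)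
    have hw : ∀ w₀, (P.prod U).real ({x | (x, w₀) ∉ S} ×ˢ {w₀}) ≤ δ * U.real {w₀} := by
      intro w₀
      rw [measureReal_prod_prod]
      by_cases hb : IsBalanced w₀
      · gcongr
        exact h w₀ hb
      · have : U.real {w₀} = 0 := by
          rw [measureReal_def, hUdef, (uniformOn_eq_zero_iff hfin).2, ENNReal.toReal_zero]
          ext w
          simp only [Set.mem_inter_iff, Set.mem_ofPred_eq, Set.mem_singleton_iff,
            Set.mem_empty_iff_false, iff_false, not_and]
          rintro hw rfl
          exact hb hw
        rw [this]
        simp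
    refine (Finset.sum_le_sum fun w₀ _ => hw w₀).trans ?_
    rw [← Finset.mul_sum, sum_measureReal_singleton]
    simp
  -- `S` is not assumed measurable, so subadditivity replaces the formula for the complement.
  have h1 : (P.prod U).real Set.univ ≤ (P.prod U).real S + (P.prod U).real Sᶜ := by
    rw [← Set.union_compl_self S]
    exact measureReal_union_le _ _
  rw [probReal_univ] at h1
  linarith

theorem isProbabilityMeasure_covariateLaw {f : ℝ → ℝ} (hf0 : ∀ x, 0 ≤ f x) (hfi : Integrable f)
    (hf1 : ∫ x, f x = 1) : IsProbabilityMeasure (covariateLaw f) := by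
  refine ⟨?_⟩
  rw [covariateLaw, withDensity_apply _ MeasurableSet.univ, Measure.restrict_univ,
    ← ofReal_integral_eq_lintegral_ofReal hfi (Eventually.of_forall hf0), hf1, ENNReal.ofReal_one]

theorem memLp_id_covariateLaw {f : ℝ → ℝ} (hf0 : ∀ x, 0 ≤ f x) (hfm : Measurable f)
    (hf_var : Integrable fun x => x ^ 2 * f x) : MemLp id 2 (covariateLaw f) := by
  rw [memLp_two_iff_integrable_sq aestronglyMeasurable_id, covariateLaw,
    integrable_withDensity_iff hfm.ennreal_ofReal (Eventually.of_forall fun _ =>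
      ENNReal.ofReal_lt_top)]
  simpa only [id, ENNReal.toReal_ofReal (hf0 _)] using hf_var

theorem covariateLaw_Ioc_le {f : ℝ → ℝ} {B r : ℝ} (hr : 0 ≤ r) (hB : 0 ≤ B)
    (hf : ∀ x, f x ≤ B * (1 + |x|) ^ (-r)) {ζ a b : ℝ} (hζ : 0 ≤ ζ) (ha : ζ ≤ a) (hab : a ≤ b) :
    (covariateLaw f).real (Ioc a b) ≤ B * (1 + ζ) ^ (-r) * (b - a) ∧
      ((covariateLaw f).map Neg.neg).real (Ioc a b) ≤ B * (1 + ζ) ^ (-r) * (b - a) := by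
  have h1 : ∀ x, ζ ≤ |x| → f x ≤ B * (1 + ζ) ^ (-r) := by
    intro x hx
    refine (hf x).trans ?_
    gcongr ?_ * ?_
    exact Real.rpow_le_rpow_of_nonpos (by linarith) (by linarith) (by linarith)
  have h0 : 0 ≤ B * (1 + ζ) ^ (-r) := by positivity
  constructor
  · refine covariateLaw_le h0 measurableSet_Ioc (fun x hx => h1 x ?_) (by linarith) (by simp)
    exact (ha.trans hx.1.le).trans (le_abs_self x)
  · rw [map_measureReal_apply measurable_neg measurableSet_Ioc]
    refine covariateLaw_le h0 (measurable_neg measurableSet_Ioc) (fun x hx => h1 x ?_)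
      (by linarith) ?_
    · have : a < -x := hx.1
      exact (ha.trans this.le).trans (neg_le_abs x)
    · have : (Neg.neg ⁻¹' Ioc a b : Set ℝ) = Ico (-b) (-a) := by simp
      rw [this, Real.volume_Ico]
      exact ENNReal.ofReal_le_ofReal (by linarith)

/-- An interval which carries almost all of the mass, with equal masses on both sides. -/
theorem exists_central_interval (μ : Measure ℝ) [IsProbabilityMeasure μ] [NullSingletonClass μ]
    {s : ℝ} (hs : 0 < s) (hs' : s ≤ 1 / 4) : ∃ a₁ a₂, a₁ < a₂ ∧ μ.real (Iio a₁) = s ∧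
      μ.real (Ioi a₂) = s ∧ 1 - 2 * s ≤ μ.real (Icc a₁ a₂) := by
  obtain ⟨a₂, ha₂⟩ := exists_upper_quantile μ hs (by linarith)
  have : IsProbabilityMeasure (μ.map Neg.neg) :=
    Measure.isProbabilityMeasure_map measurable_neg.aemeasurable
  have : NullSingletonClass (μ.map Neg.neg) := ⟨fun x => by
    rw [Measure.map_apply measurable_neg (measurableSet_singleton x)]
    have : (Neg.neg ⁻¹' {x} : Set ℝ) = {-x} := by simp
    rw [this]
    exact measure_singleton _⟩
  obtain ⟨q, hq⟩ := exists_upper_quantile (μ.map Neg.neg) hs (by linarith)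
  have ha₁ : μ.real (Iio (-q)) = s := by
    rw [map_measureReal_apply measurable_neg measurableSet_Ioi] at hq
    rw [← hq]
    congr 1
    simp
  set a₁ := -q with ha₁def
  have hu : ∀ A : Set ℝ, (∀ x, x ∈ A ∨ x ∈ Iio a₁ ∨ x ∈ Ioi a₂) → 1 - 2 * s ≤ μ.real A := by
    intro A hA
    have h1 : μ.real Set.univ ≤ μ.real (A ∪ (Iio a₁ ∪ Ioi a₂)) := measureReal_mono fun x _ => hA x
    have h2 := measureReal_union_le (μ := μ) A (Iio a₁ ∪ Ioi a₂)
    have h3 := measureReal_union_le (μ := μ) (Iio a₁) (Ioi a₂)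
    rw [probReal_univ] at h1
    linarith
  have hI : 1 - 2 * s ≤ μ.real (Icc a₁ a₂) := hu _ fun x => by
    by_cases h1 : x < a₁
    · exact Or.inr (Or.inl h1)
    by_cases h2 : a₂ < x
    · exact Or.inr (Or.inr h2)
    · exact Or.inl ⟨not_lt.1 h1, not_lt.1 h2⟩
  refine ⟨a₁, a₂, ?_, ha₁, ha₂, hI⟩
  by_contra! h
  have h1 : μ.real (Icc a₁ a₂) = 0 := by
    rw [measureReal_def, measure_mono_null (t := {a₁}) (fun x hx => ?_) (measure_singleton _),
      ENNReal.toReal_zero]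
    exact le_antisymm (hx.2.trans h) hx.1
  linarith

end GreedySwitch

/-! ### Assembling the proof -/

theorem mainTheorem7 (f : ℝ → ℝ) (hf_nonneg : ∀ x, 0 ≤ f x) (hf_unif : UniformContinuous f)
    (hf_int : ∫ x, f x = 1) (hf_var : Integrable (fun x => x ^ 2 * f x) volume)
    (r : ℝ) (hr : 1 < r) (hf_tail : f =O[cocompact ℝ] fun x => |x| ^ (-r))
    (c : ℝ) (hc : 0 < c) (hP : ∀ t ∈ Set.Icc 0 (c / 2), 0 < GreedySwitch.pairDensity f t)
    (γ : ℝ) (hγ : γ < 1) :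
    ∃ b : ℝ, 0 < b ∧ ∃ K : ℝ, 0 < K ∧ ∃ N : ℕ, ∀ n : ℕ, N < n →
      γ < (GreedySwitch.experimentLaw f n).real
        {p | ∀ w, GreedySwitch.IsModifiedGreedyOutput p.1 b c p.2 w →
          GreedySwitch.balance p.1 w ≤ K / (n : ℝ) ^ 3} := by
  open GreedySwitch in
  have hfc : Continuous f := hf_unif.continuous
  have hfi : Integrable f := by
    by_contra h
    rw [integral_undef h] at hf_int
    norm_num at hf_int
  obtain ⟨B, hB, hfB⟩ := exists_decay_bound hf_nonneg hfc (by linarith : 0 < r) hf_tail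
  have hM : ∀ x, f x ≤ B := fun x => by
    refine (hfB x).trans (mul_le_of_le_one_right hB ?_)
    exact Real.rpow_le_one_of_one_le_of_nonpos (by linarith [abs_nonneg x]) (by linarith)
  have hprob := isProbabilityMeasure_covariateLaw hf_nonneg hfi hf_int
  have hatom : NullSingletonClass (covariateLaw f) := by unfold covariateLaw; infer_instance
  have hmem := memLp_id_covariateLaw hf_nonneg hfc.measurable hf_var
  obtain ⟨t₀, ht₀, htmin⟩ := (isCompact_Icc (a := (0 : ℝ)) (b := c / 2)).exists_isMinOn
    (Set.nonempty_Icc.2 (by linarith))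
    (continuous_pairDensity hf_nonneg hfc hfi hM).continuousOn
  set p₁ := pairDensity f t₀ with hp₁
  have hp₁0 : 0 < p₁ := hP t₀ ht₀
  -- Cutting off mass `s` on each side lowers the density of the difference by at most `4 * B * s ≤
  -- p₁ / 2`, so half of its minimum on `[0, c / 2]` survives.
  set s := min (1 / 4) (p₁ / (8 * (B + 1))) with hs
  have hs0 : 0 < s := lt_min (by norm_num) (by positivity)
  obtain ⟨a₁, a₂, ha, h₁, h₂, hJ⟩ :=
    exists_central_interval (covariateLaw f) hs0 (min_le_left _ _)
  have hG : 1 - 2 * s ≤ ∫ x, (Set.Icc a₁ a₂).indicator f x := by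
    rw [integral_indicator measurableSet_Icc, ← measureReal_withDensity_ofReal hfi hf_nonneg
      measurableSet_Icc]
    exact hJ
  have hp : ∀ t, |t| ≤ c / 2 →
      p₁ / 2 ≤ ∫ x, (Set.Icc a₁ a₂).indicator f (x + t) * (Set.Icc a₁ a₂).indicator f x := by
    intro t ht
    have e1 := pairDensity_indicator_ge hf_nonneg hfc hfi hf_int hM
      (measurableSet_Icc (a := a₁) (b := a₂)) t
    have e2 : p₁ ≤ pairDensity f |t| := htmin ⟨abs_nonneg t, ht⟩
    have e3 : s ≤ p₁ / (8 * (B + 1)) := min_le_right _ _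
    rw [le_div_iff₀ (by positivity)] at e3
    have e4 : 2 * B * (1 - ∫ x, (Set.Icc a₁ a₂).indicator f x) ≤ 2 * B * (2 * s) := by
      gcongr
      linarith
    linarith
  -- Both phases fail with probability at most `ε`, and `1 - 2 * ε` still exceeds `γ`.
  set ε := (1 - γ) / 4 with hε
  have hε0 : 0 < ε := by
    rw [hε]
    linarith
  obtain ⟨b, hb, N₁, hN₁⟩ := exists_greedyPhase hmem hr hB
    (fun ζ a b hζ h1 h2 => (covariateLaw_Ioc_le (by linarith) hB hfB hζ h1 h2).1)
    (fun ζ a b hζ h1 h2 => (covariateLaw_Ioc_le (by linarith) hB hfB hζ h1 h2).2)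
    ha (h₁ ▸ hs0) (h₂ ▸ hs0) hc hε0
  obtain ⟨K, hK, N₂, hN₂⟩ := exists_lastSwitch hf_nonneg hfc hfi hf_int hM ha hc (half_pos hp₁0)
    hp hε0
  rw [h₁, h₂] at hN₁
  set σ := Real.sqrt (s * (a₂ - a₁) ^ 2 / 8) with hσ
  have hσ0 : 0 < σ := Real.sqrt_pos.2 (by
    have : 0 < a₂ - a₁ := sub_pos.2 ha
    positivity)
  refine ⟨b, hb, 2 * K / σ, by positivity, max N₁ N₂, fun n hn => ?_⟩
  have hn0 : 0 < n := by omega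
  have hnr : (0 : ℝ) < n := by exact_mod_cast hn0
  suffices h : 1 - 2 * ε ≤ (experimentLaw f n).real
      {p | ∀ w, IsModifiedGreedyOutput p.1 b c p.2 w → balance p.1 w ≤ 2 * K / σ / (n : ℝ) ^ 3} by
    refine lt_of_lt_of_le ?_ h
    rw [hε]
    linarith
  refine experimentLaw_ge _ fun w₀ hw₀ => ?_
  obtain ⟨hA, hm₁, hm₂⟩ := hN₁ n ((le_max_left _ _).trans hn.le) w₀ hw₀
  have hF := hN₂ n ((le_max_right _ _).trans hn.le) w₀ hw₀ ⌊b * Real.sqrt n⌋₊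
  have hT := ae_noTies (n := n) hfi hf_nonneg
  set P := Measure.pi fun _ : Fin (2 * n) => covariateLaw f with hPdef
  set m := ⌊b * Real.sqrt n⌋₊ with hm
  set A := {x : Fin (2 * n) → ℝ | ¬ ((∀ v, IsStop (diffSum x) (extremes x m) c w₀ v →
      |diffSum x v| < c) ∧ n * s ≤ (Finset.univ.filter fun i => x i < a₁).card ∧
      n * s ≤ (Finset.univ.filter fun i => a₂ < x i).card)} with hAdef
  set F := LastSwitchFails w₀ m a₁ a₂ c (K / (n : ℝ) ^ 2) fun x => {i | x i ∈ Set.Icc a₁ a₂}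
    with hFdef
  have hFr : P.real F ≤ ε := ENNReal.toReal_le_of_le_ofReal hε0.le hF
  have hTr : P.real {x | NoTies (diffSum x)}ᶜ = 0 := by
    rw [measureReal_def]
    exact (congrArg ENNReal.toReal hT).trans ENNReal.toReal_zero
  have hsub : {x | (x, w₀) ∉ {p : (Fin (2 * n) → ℝ) × Allocation n |
      ∀ w, IsModifiedGreedyOutput p.1 b c p.2 w → balance p.1 w ≤ 2 * K / σ / (n : ℝ) ^ 3}} ⊆
      A ∪ F ∪ {x | NoTies (diffSum x)}ᶜ := by
    intro x hx
    by_contra hx'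
    simp only [Set.mem_union, not_or, Set.mem_compl_iff, not_not] at hx'
    obtain ⟨⟨hxA, hxF⟩, hxT⟩ := hx'
    simp only [hAdef, Set.mem_ofPred_eq, not_not] at hxA
    obtain ⟨hreached, hlow, hhigh⟩ := hxA
    refine hx fun w hw => ?_
    obtain ⟨v, hv, hvw⟩ := isModifiedGreedyOutput_iff.1 hw
    have hlow' : m ≤ (Finset.univ.filter fun i => x i < a₁).card := by
      exact_mod_cast hm₁.trans hlow
    have hhigh' : m ≤ (Finset.univ.filter fun i => a₂ < x i).card := by
      exact_mod_cast hm₂.trans hhigh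
    obtain ⟨i, hi, j, hj, hwi, hwj, hij⟩ : ∃ i, x i ∈ Set.Icc a₁ a₂ ∧ ∃ j, x j ∈ Set.Icc a₁ a₂ ∧
        w₀ i = true ∧ w₀ j = false ∧ |x i - x j - diffSum x v / 2| ≤ K / (n : ℝ) ^ 2 := by
      by_contra! h
      exact hxF ⟨hxT, hlow', hhigh', v, hv, hreached v hv,
        fun i hi j hj hwi hwj => not_le.2 (h i hi j hj hwi hwj)⟩
    have hD := abs_diffSum_le_of_isBestSwitch hv hvw (extremes_central hlow' hhigh' hi)
      (extremes_central hlow' hhigh' hj) hwi hwj hij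
    have hsd : σ ≤ sampleSD x := sampleSD_ge hn0 ha.le hs0.le hlow hhigh
    show balance x w ≤ _
    rw [balance_eq]
    calc |diffSum x w| / (n * sampleSD x) ≤ 2 * (K / (n : ℝ) ^ 2) / (n * σ) := by gcongr
      _ = 2 * K / σ / (n : ℝ) ^ 3 := by field_simp
  refine (measureReal_mono hsub).trans ?_
  have u1 := measureReal_union_le (μ := P) (A ∪ F) {x | NoTies (diffSum x)}ᶜ
  have u2 := measureReal_union_le (μ := P) A F
  linarith
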